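/- A concept class $\mathcal C=\{\mathcal C_n\}_{n\in\mathbb N}$ consists, for every $n$, of a set $\mathcal C_n$ of Boolean functions $c:\{0,1\}^n\to\{0,1\}$. It is (worst-case) learnable by an efficient classical learner (respectively, by an efficient quantum learner) if there are a polynomial-time randomized Turing machine (respectively, a polynomial-time quantum algorithm) $\mathcal A$, a sequence of probability distributions $D_n$ on $\{0,1\}^n$, and a polynomial $p$ such that, for all $n\in\mathbb N$, all $c\in\mathcal C_n$ and all $x\in\{0,1\}^n$, $$\mathbb P\bigl(\mathcal A(x,\mathcal T_{p(n)})=c(x)\bigr)\ \ge\ \tfrac23,\qquad \mathcal T_{p(n)}=\{(x_i,c(x_i))\}_{i=1}^{p(n)},$$ where $x_1,\dots,x_{p(n)}$ are independent samples from $D_n$ and the probability is over the training set and the internal randomness of $\mathcal A$. $\mathbf{PromiseBQP}$ is the class of promise problems $(L_{\mathrm{YES}},L_{\mathrm{NO}})$ (disjoint subsets of $\{0,1\}^*$) for which some polynomial-time quantum algorithm outputs $1$ with probability at least $2/3$ on every $x\in L_{\mathrm{YES}}$ and $0$ with probability at least $2/3$ on every $x\in L_{\mathrm{NO}}$. $\mathbf{PromiseP/poly}$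 is the class of promise problems for which there are a polynomial-time deterministic Turing machine $M$ and advice strings $a_0,a_1,\dots$ of length polynomial in the index such that $M(x,a_{|x|})=1$ for every $x\in L_{\mathrm{YES}}$ and $M(x,a_{|x|})=0$ for every $x\in L_{\mathrm{NO}}$. $\mathbf{BQP}$ and $\mathbf{P/poly}$ are the corresponding classes of languages $L$, where $L_{\mathrm{YES}}=L$ and $L_{\mathrm{NO}}=\{0,1\}^*\setminus L$. **Theorem.** (a) If $\mathbf{BQP}\not\subseteq\mathbf{P/poly}$, then there is a concept class that is worst-case learnable by an efficient quantum learner but not by any efficient classical learner. (b) If there is a concept class that is worst-case learnable by an efficient quantum learner but not by any efficient classical learner, then $\mathbf{PromiseBQP}\not\subseteq\mathbf{PromiseP/poly}$. -/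

import Mathlib

namespace WorstCaseLearning

open Turing

/-! ### Encodings of binary strings -/

/-- Self-delimiting code of a pair of binary strings: every bit of `u` is preceded by `true`,
the end of `u` is marked by `false`, and `v` follows. -/
def pairCode : List Bool → List Bool → List Bool
  | [], v => false :: v
  | b :: u, v => true :: b :: pairCode u v

/-- The point of the Boolean cube `{0,1}^n`, written as a binary string of length `n`. -/
def bitString {n : ℕ} (x : Fin n → Bool) : List Bool := List.ofFn x

/-- The binary code of a training set `(x₁, y₁), …, (x_N, y_N)` of labelled points. -/
def trainingCode {n : ℕ} : List ((Fin n → Bool) × Bool) → List Bool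
  | [] => []
  | (x, y) :: T => pairCode (bitString x) (y :: trainingCode T)

/-- The binary code of the pair `(x, T)` of an input `x` and a training set `T`. -/
def learnerInput {n : ℕ} (x : Fin n → Bool) (T : List ((Fin n → Bool) × Bool)) : List Bool :=
  pairCode (bitString x) (trainingCode T)

/-! ### Deterministic and randomized polynomial time (Turing machines) -/

/-- `M` is computed by a Turing machine in time polynomial in the length of the code of its two
arguments. -/
def PolyTimeDecider (M : List Bool → List Bool → Bool) : Prop :=
  Nonempty (TM2ComputableInPolyTime (fun z : List Bool × List Bool => pairCode z.1 z.2)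
    Computability.encodeBool (fun z => M z.1 z.2))

/-- An efficient randomized algorithm with one output bit: a polynomial-time Turing machine that
receives the input `w` and `coins (|w|)` independent fair coin flips. -/
structure RandomizedAlgorithm where
  coins : Polynomial ℕ
  run : List Bool → List Bool → Bool
  polyTime : PolyTimeDecider run

/-- The probability that the randomized algorithm outputs `b` on input `w`. -/
noncomputable def RandomizedAlgorithm.outputProb (A : RandomizedAlgorithm)
    (w : List Bool) (b : Bool) : ℝ :=
  (Finset.univ.filter
    (fun r : Fin (A.coins.eval w.length) → Bool => A.run w (List.ofFn r) = b)).card /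
      2 ^ (A.coins.eval w.length)

/-! ### Quantum circuits and polynomial-time quantum algorithms -/

/-- The gates on `m` qubits: Pauli `X`, Hadamard `H`, the `π/8` gate `T`, controlled not (control,
target) and the Toffoli gate (two controls, target). -/
inductive QGate (m : ℕ) where
  | X (i : Fin m) : QGate m
  | H (i : Fin m) : QGate m
  | T (i : Fin m) : QGate m
  | CNOT (i j : Fin m) (hij : i ≠ j) : QGate m
  | CCNOT (i j k : Fin m) (hij : i ≠ j) (hik : i ≠ k) (hjk : j ≠ k) : QGate m

/-- The action of a gate on the state of `m` qubits, given by its amplitudes in the computational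
basis. -/
noncomputable def QGate.apply {m : ℕ} (g : QGate m) (ψ : (Fin m → Bool) → ℂ) :
    (Fin m → Bool) → ℂ :=
  match g with
  | .X i => fun s => ψ (Function.update s i (!(s i)))
  | .H i => fun s => ((Real.sqrt 2 : ℝ) : ℂ)⁻¹ *
      (ψ (Function.update s i false) +
        (if s i = true then -1 else 1) * ψ (Function.update s i true))
  | .T i => fun s => (if s i = true then Complex.exp (Real.pi * Complex.I / 4) else 1) * ψ s
  | .CNOT i j _ => fun s => ψ (Function.update s j (xor (s j) (s i)))
  | .CCNOT i j k _ _ _ => fun s => ψ (Function.update s k (xor (s k) (s i && s j)))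

/-- A quantum circuit on `ancillas + 1` qubits; the qubit `0` is the output qubit. -/
structure QCircuit where
  ancillas : ℕ
  gates : List (QGate (ancillas + 1))

/-- The final state of the circuit, started in the state `|0…0⟩`. -/
noncomputable def QCircuit.finalState (Q : QCircuit) : (Fin (Q.ancillas + 1) → Bool) → ℂ :=
  Q.gates.foldl (fun ψ g => g.apply ψ) (Pi.single (fun _ => false) 1)

/-- The probability that measuring the output qubit of the final state yields `b`. -/
noncomputable def QCircuit.outputProb (Q : QCircuit) (b : Bool) : ℝ :=
  ∑ s : Fin (Q.ancillas + 1) → Bool, if s 0 = b then ‖Q.finalState s‖ ^ 2 else 0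

/-- Unary code of a natural number. -/
def unaryCode (k : ℕ) : List Bool := List.replicate k true ++ [false]

/-- Binary description of a gate: a tag followed by the qubits that the gate acts on. -/
def QGate.code {m : ℕ} : QGate m → List Bool
  | .X i => unaryCode 0 ++ unaryCode i
  | .H i => unaryCode 1 ++ unaryCode i
  | .T i => unaryCode 2 ++ unaryCode i
  | .CNOT i j _ => unaryCode 3 ++ unaryCode i ++ unaryCode j
  | .CCNOT i j k _ _ _ => unaryCode 4 ++ unaryCode i ++ unaryCode j ++ unaryCode k

/-- Binary description of a quantum circuit. -/
def QCircuit.code (Q : QCircuit) : List Bool :=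
  unaryCode Q.ancillas ++ Q.gates.flatMap QGate.code

/-- A polynomial-time quantum algorithm with one output bit: a polynomial-time Turing machine maps
the input `w` to the description of a quantum circuit, which is run on `|0…0⟩`, and the output qubit
is measured. -/
structure QuantumAlgorithm where
  circuit : List Bool → QCircuit
  polyTime : Nonempty (TM2ComputableInPolyTime (id : List Bool → List Bool) QCircuit.code circuit)

/-- The probability that the quantum algorithm outputs `b` on input `w`. -/
noncomputable def QuantumAlgorithm.outputProb (A : QuantumAlgorithm) (w : List Bool) (b : Bool) :
    ℝ :=
  (A.circuit w).outputProb b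

/-! ### Complexity classes -/

/-- A sequence of advice strings of polynomially bounded length. -/
def PolyAdvice (a : ℕ → List Bool) : Prop :=
  ∃ q : Polynomial ℕ, ∀ n, (a n).length ≤ q.eval n

/-- A promise problem: disjoint sets of yes-instances and of no-instances. -/
structure PromiseProblem where
  yes : Set (List Bool)
  no : Set (List Bool)
  disjoint : Disjoint yes no

/-- The class **PromiseBQP**. -/
def PromiseBQP : Set PromiseProblem :=
  {L | ∃ A : QuantumAlgorithm,
    (∀ x ∈ L.yes, 2 / 3 ≤ A.outputProb x true) ∧ (∀ x ∈ L.no, 2 / 3 ≤ A.outputProb x false)}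

/-- The class **PromiseP/poly**. -/
def PromisePPoly : Set PromiseProblem :=
  {L | ∃ M : List Bool → List Bool → Bool, PolyTimeDecider M ∧
    ∃ a : ℕ → List Bool, PolyAdvice a ∧
      (∀ x ∈ L.yes, M x (a x.length) = true) ∧ (∀ x ∈ L.no, M x (a x.length) = false)}

/-- The class **BQP** of languages. -/
def BQP : Set (Language Bool) :=
  {L | ∃ A : QuantumAlgorithm, ∀ x : List Bool,
    (x ∈ L → 2 / 3 ≤ A.outputProb x true) ∧ (x ∉ L → 2 / 3 ≤ A.outputProb x false)}

/-- The class **P/poly** of languages. -/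
def PPoly : Set (Language Bool) :=
  {L | ∃ M : List Bool → List Bool → Bool, PolyTimeDecider M ∧
    ∃ a : ℕ → List Bool, PolyAdvice a ∧
      ∀ x : List Bool, M x (a x.length) = true ↔ x ∈ L}

/-! ### Worst-case learnability -/

/-- A concept class: for every `n` a set of Boolean functions on `{0,1}^n`. -/
def ConceptClass : Type := (n : ℕ) → Set ((Fin n → Bool) → Bool)

/-- The training set formed by the points `xs` and their labels under the concept `c`. -/
def trainingSet {n N : ℕ} (c : (Fin n → Bool) → Bool) (xs : Fin N → (Fin n → Bool)) :
    List ((Fin n → Bool) × Bool) :=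
  List.ofFn (fun i => (xs i, c (xs i)))

/-- Let `P w b` be the probability that an algorithm outputs `b` on input `w`. This is the
probability that it outputs `c x` on input `x` and a training set of `N` independent samples from
`μ` labelled by `c`, over the samples and the internal randomness of the algorithm. -/
noncomputable def successProb (P : List Bool → Bool → ℝ) {n : ℕ} (N : ℕ) (μ : PMF (Fin n → Bool))
    (c : (Fin n → Bool) → Bool) (x : Fin n → Bool) : ℝ :=
  ∑ xs : Fin N → (Fin n → Bool),
    (∏ i, (μ (xs i)).toReal) * P (learnerInput x (trainingSet c xs)) (c x)

/-- An algorithm with output probabilities `P` learns the concept class `C` in the worst case, for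
some sequence of distributions `D` and some polynomial number of samples. -/
def LearnsWorstCase (P : List Bool → Bool → ℝ) (C : ConceptClass) : Prop :=
  ∃ (D : (n : ℕ) → PMF (Fin n → Bool)) (p : Polynomial ℕ),
    ∀ n : ℕ, ∀ c ∈ C n, ∀ x : Fin n → Bool, 2 / 3 ≤ successProb P (p.eval n) (D n) c x

/-- Worst-case learnability by an efficient randomized classical algorithm. -/
def ClassicallyLearnable (C : ConceptClass) : Prop :=
  ∃ A : RandomizedAlgorithm, LearnsWorstCase A.outputProb C

/-- Worst-case learnability by an efficient quantum algorithm. -/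
def QuantumLearnable (C : ConceptClass) : Prop :=
  ∃ A : QuantumAlgorithm, LearnsWorstCase A.outputProb C

end WorstCaseLearning

/-!
A language outside **P/poly** that is in **BQP** gives a concept class with one concept per input
length. A quantum learner ignores the training set. A classical learner of the class would put the
language into **P/poly**: for every input length, by the Chernoff and union bounds
(`prob_exists_le_badCount_le`), some list of polynomially many training sets and coin flips
predicts the concept correctly everywhere by majority vote, and this list can serve as advice
(`mem_pPoly_of_classicallyLearnable`).

For the second part, suppose that **PromiseBQP** is contained in **PromiseP/poly**, and consider a
quantum learner. Its success probability averages over training sets, so for some training sets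
the input need not satisfy any promise. Amplification over disjoint parts of the training set
raises the success probability above `11 / 12` (`successProb_amplify_three`); then, by Markov's
inequality, for all but a third of the training sets the amplified algorithm is correct with
probability `2 / 3`, and a polynomial-time machine `M` with advice is correct on these
(`exists_advice_of_learnsWorstCase`).

The advice of `M` has to be supplied by the distribution of the samples of a classical learner,
which is the same for all concepts of the given input length.

* Few concepts are learnable: they are determined by the labels of polynomially many points
  (`card_le_of_learns`). So, by a union bound over all concepts and all inputs, one fixed list of
  unlabelled training sets suffices to predict all concepts everywhere by majority vote
  (`exists_training_points`).
* The advice and these training points form a string `bits` of polynomial length. A set `S` of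
  polynomially many points contains the training points and a key `v`, and encodes `bits`: the
  `j`-th bit tells whether `v + j + 1` is in `S`, with points read as binary numbers. Such a key
  exists unless the cube is so small that `S` can be the whole cube (`exists_encoding`).
* The distribution gives the weight `9 / 10` to `v` and spreads the rest evenly over `S`. With
  high probability the first sample is `v` and polynomially many samples exhaust `S`
  (`exists_pmf_reveal`). The learner then decodes `bits`, finds the labels of the training points
  among the samples, and takes the majority vote of the predictions of `M` (`advicePredict_eq`).

All of this rests on closure properties of the functions that Turing machines compute in
polynomial time: composition, case distinction and iteration. They are obtained from program
fragments over finitely many registers that can call other machines as subroutines (`Frag`,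
`Runs`). Everything else is built from finite transducers by these operations, including the
circuit for the majority vote of three quantum circuits (`polyTime_majCircuit`).
-/

namespace WorstCaseLearning

open Turing

/-! ### Reachability in bounded time and machine fragments with subroutines -/

/-- `f` leads from `a` to `b` in at most `n` steps. -/
def ReachIn {S : Type*} (f : S → Option S) (a b : S) (n : ℕ) : Prop :=
  ∃ k ≤ n, (flip bind f)^[k] (some a) = some b

namespace ReachIn

variable {S : Type*} {f : S → Option S} {a b c : S} {n m : ℕ}

theorem refl (a : S) : ReachIn f a a 0 := ⟨0, le_rfl, rfl⟩

theorem trans (h₁ : ReachIn f a b n) (h₂ : ReachIn f b c m) : ReachIn f a c (n + m) := by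
  obtain ⟨k, hk, e⟩ := h₁
  obtain ⟨l, hl, e'⟩ := h₂
  refine ⟨l + k, by omega, ?_⟩
  rw [Function.iterate_add_apply, e, e']

theorem mono (h : ReachIn f a b n) (hnm : n ≤ m) : ReachIn f a b m := by
  obtain ⟨k, hk, e⟩ := h
  exact ⟨k, hk.trans hnm, e⟩

theorem head (h : f a = some b) (h' : ReachIn f b c n) : ReachIn f a c (n + 1) := by
  have : ReachIn f a b 1 := ⟨1, le_rfl, h⟩
  exact (this.trans h').mono (by omega)

end ReachIn

attribute [instance] FinTM2.kFin FinTM2.ΛFin FinTM2.σFin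

section Fragments

variable {ι : Type} (A : ι → TM2ComputableAux Bool Bool)

/-- The Boolean registers of a program. Register `0` holds the input and register `1` the
output. -/
abbrev Reg : Type := Fin 6

/-- The stacks of a program with subroutines `A i`: the registers, and the stacks of every
subroutine. -/
abbrev StackIdx : Type := Reg ⊕ (Σ i, (A i).tm.K)

/-- The stack alphabets of a program with subroutines `A i`. -/
abbrev StackAlph : StackIdx A → Type
  | .inl _ => Bool
  | .inr p => (A p.1).tm.Γ p.2

/-- The internal states of a program: the bit popped last, and the internal states of the
subroutines. -/
abbrev Var : Type := Option Bool × (∀ i, (A i).tm.σ)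

/-- The internal state of a program between two of its steps. -/
def initVar : Var A := (none, fun i => (A i).tm.initialState)

/-- The statements of a program with labels `Λ` and subroutines `A i`. -/
abbrev Code (Λ : Type) : Type := TM2.Stmt (StackAlph A) Λ (Var A)

/-- All the stacks of a program, given by the registers and the stacks of the subroutines. -/
def stk (s : Reg → List Bool) (F : ∀ i k, List ((A i).tm.Γ k)) : ∀ k, List (StackAlph A k)
  | .inl r => s r
  | .inr p => F p.1 p.2

@[simp] theorem stk_inl (s : Reg → List Bool) (F : ∀ i k, List ((A i).tm.Γ k)) (r : Reg) :
    stk A s F (.inl r) = s r := rfl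

@[simp] theorem stk_inr (s : Reg → List Bool) (F : ∀ i k, List ((A i).tm.Γ k))
    (p : Σ i, (A i).tm.K) : stk A s F (.inr p) = F p.1 p.2 := rfl

variable [DecidableEq ι]

theorem update_stk_inl (s : Reg → List Bool) (F : ∀ i k, List ((A i).tm.Γ k)) (r : Reg)
    (l : List Bool) :
    Function.update (stk A s F) (.inl r) l = stk A (Function.update s r l) F := by
  funext k
  rcases k with k | p
  · by_cases h : k = r
    · subst h; simp
    · simp [Function.update_of_ne, h]
  · simp

theorem update_stk_inr (s : Reg → List Bool) (F : ∀ i k, List ((A i).tm.Γ k)) (i : ι)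
    (k : (A i).tm.K) (l : List ((A i).tm.Γ k)) :
    Function.update (stk A s F) (.inr ⟨i, k⟩) l =
      stk A s (Function.update F i (Function.update (F i) k l)) := by
  funext k'
  rcases k' with k' | ⟨j, k'⟩
  · simp
  · by_cases h : j = i
    · subst h
      by_cases h' : k' = k
      · subst h'; simp
      · have : (⟨j, k'⟩ : Σ i, (A i).tm.K) ≠ ⟨j, k⟩ := by
          intro e; exact h' (eq_of_heq (Sigma.mk.inj e).2)
        simp [Function.update_of_ne, this, h']
    · have : (⟨j, k'⟩ : Σ i, (A i).tm.K) ≠ ⟨i, k⟩ := fun e => h (Sigma.mk.inj e).1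
      simp [Function.update_of_ne, this, h]

/-- The configuration between two steps of a program, with label `l`, registers `s`, and all
subroutines idle. -/
def cfg {Λ : Type} (l : Λ) (s : Reg → List Bool) : TM2.Cfg (StackAlph A) Λ (Var A) :=
  ⟨some l, initVar A, stk A s (fun _ _ => [])⟩

/-- A program fragment with one entry `start` and one exit. Its code refers to its own labels
through an embedding into the labels of an ambient program. -/
structure Frag where
  Pos : Type
  fin : Fintype Pos
  start : Pos
  code : ∀ {Λ : Type}, (Pos → Λ) → Λ → Pos → Code A Λ

/-- The fragment `p`, placed in any program, leads from registers `s` at its entry to registers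
`s'` at its exit in at most `n` steps. -/
def Runs (p : Frag A) (s s' : Reg → List Bool) (n : ℕ) : Prop :=
  ∀ (Λ : Type) (m : Λ → Code A Λ) (emb : p.Pos → Λ) (exit : Λ),
    (∀ x, m (emb x) = p.code emb exit x) →
      ReachIn (TM2.step m) (cfg A (emb p.start) s) (cfg A exit s') n

variable {A} in
theorem Runs.mono {p : Frag A} {s s' : Reg → List Bool} {n m : ℕ} (h : Runs A p s s' n)
    (hnm : n ≤ m) : Runs A p s s' m :=
  fun Λ M emb exit hm => (h Λ M emb exit hm).mono hnm

/-- Sequential composition. -/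
abbrev Frag.seq (p q : Frag A) : Frag A where
  Pos := p.Pos ⊕ q.Pos
  fin := letI := p.fin; letI := q.fin; inferInstance
  start := .inl p.start
  code emb exit
    | .inl x => p.code (fun y => emb (.inl y)) (emb (.inr q.start)) x
    | .inr x => q.code (fun y => emb (.inr y)) exit x

variable {A} in
theorem Runs.seq {p q : Frag A} {s s' s'' : Reg → List Bool} {n m : ℕ} (hp : Runs A p s s' n)
    (hq : Runs A q s' s'' m) : Runs A (Frag.seq A p q) s s'' (n + m) := by
  intro Λ M emb exit hm
  exact (hp Λ M (fun y => emb (.inl y)) (emb (.inr q.start)) fun x => hm (.inl x)).trans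
    (hq Λ M (fun y => emb (.inr y)) exit fun x => hm (.inr x))

/-- Pop a bit from register `r` into the internal state, then continue with `qt` or `qf` according
to the bit, or with `qe` if the register was empty. -/
def popThen {Λ : Type} (r : Reg) (qt qf qe : Code A Λ) : Code A Λ :=
  .pop (.inl r) (fun v o => (o, v.2))
    (.branch (fun v => v.1 = some true) (.load (fun v => (none, v.2)) qt)
      (.branch (fun v => v.1 = some false) (.load (fun v => (none, v.2)) qf) qe))

theorem stepAux_popThen {Λ : Type} (r : Reg) (qt qf qe : Code A Λ) (s : Reg → List Bool)
    (F : ∀ i k, List ((A i).tm.Γ k)) :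
    TM2.stepAux (popThen A r qt qf qe) (initVar A) (stk A s F) =
      match s r with
      | [] => TM2.stepAux qe (initVar A) (stk A s F)
      | b :: l => TM2.stepAux (cond b qt qf) (initVar A) (stk A (Function.update s r l) F) := by
  have h := update_stk_inl A s F r (s r).tail
  rcases hr : s r with _ | ⟨b, l⟩
  · rw [hr, List.tail_nil] at h
    have h2 : Function.update s r [] = s := by rw [← hr]; simp
    rw [h2] at h
    simp only [popThen, TM2.stepAux]
    simp only [stk_inl, hr, List.head?_nil, List.tail_nil]
    rw [h]
    simp [initVar]
  · rw [hr, List.tail_cons] at h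
    simp only [popThen, TM2.stepAux]
    simp only [stk_inl, hr, List.head?_cons, List.tail_cons]
    rw [h]
    cases b <;> simp [initVar]

/-- Repeat `p` as long as a bit can be popped from register `r`. -/
abbrev Frag.loop (r : Reg) (p : Frag A) : Frag A where
  Pos := Option p.Pos
  fin := letI := p.fin; inferInstance
  start := none
  code emb exit
    | none => popThen A r (.goto fun _ => emb (some p.start)) (.goto fun _ => emb (some p.start))
        (.goto fun _ => exit)
    | some x => p.code (fun y => emb (some y)) (emb none) x

variable {A} in
theorem Runs.loop_nil {p : Frag A} {r : Reg} {s : Reg → List Bool} (h : s r = []) :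
    Runs A (Frag.loop A r p) s s 1 := by
  intro Λ M emb exit hm
  refine ReachIn.head ?_ (ReachIn.refl _)
  have h0 := hm none
  simp only at h0
  simp only [cfg, TM2.step, h0, stepAux_popThen, h]
  rfl

variable {A} in
theorem Runs.loop_cons {p : Frag A} {r : Reg} {s s' s'' : Reg → List Bool} {b : Bool}
    {l : List Bool} {n m : ℕ} (h : s r = b :: l) (hp : Runs A p (Function.update s r l) s' n)
    (hl : Runs A (Frag.loop A r p) s' s'' m) :
    Runs A (Frag.loop A r p) s s'' (n + m + 1) := by
  intro Λ M emb exit hm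
  refine ReachIn.head ?_ ((hp Λ M (fun y => emb (some y)) (emb none) fun x => hm (some x)).trans
    (hl Λ M emb exit hm))
  have h0 := hm none
  simp only at h0
  simp only [cfg, TM2.step, h0, stepAux_popThen, h]
  cases b <;> rfl

/-- Pop a bit from register `r` and run `p` if it is `true`, `q` otherwise. -/
abbrev Frag.case (r : Reg) (p q : Frag A) : Frag A where
  Pos := Option (p.Pos ⊕ q.Pos)
  fin := letI := p.fin; letI := q.fin; inferInstance
  start := none
  code emb exit
    | none => popThen A r (.goto fun _ => emb (some (.inl p.start)))
        (.goto fun _ => emb (some (.inr q.start))) (.goto fun _ => emb (some (.inr q.start)))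
    | some (.inl x) => p.code (fun y => emb (some (.inl y))) exit x
    | some (.inr x) => q.code (fun y => emb (some (.inr y))) exit x

variable {A} in
theorem Runs.case {p q : Frag A} {r : Reg} {s s' : Reg → List Bool} {b : Bool}
    {l : List Bool} {n : ℕ} (h : s r = b :: l)
    (hp : Runs A (cond b p q) (Function.update s r l) s' n) :
    Runs A (Frag.case A r p q) s s' (n + 1) := by
  intro Λ M emb exit hm
  have h0 := hm none
  simp only at h0
  cases b
  · refine ReachIn.head ?_ (hp Λ M (fun y => emb (some (.inr y))) exit fun x => hm (some (.inr x)))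
    simp only [cfg, TM2.step, h0, stepAux_popThen, h]
    rfl
  · refine ReachIn.head ?_ (hp Λ M (fun y => emb (some (.inl y))) exit fun x => hm (some (.inl x)))
    simp only [cfg, TM2.step, h0, stepAux_popThen, h]
    rfl

end Fragments

/-! ### Finite transducers -/

/-- A finite transducer on bits: in state `t` it reads a bit `b`, emits `emit t b` and moves to
`next t b`; at the end of the input it emits `last t`. -/
structure Transducer where
  State : Type
  fin : Fintype State
  start : State
  next : State → Bool → State
  emit : State → Bool → List Bool
  last : State → List Bool

/-- The output of a transducer on an input that is read from state `t` on. -/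
def Transducer.out (T : Transducer) : T.State → List Bool → List Bool
  | t, [] => T.last t
  | t, b :: l => T.emit t b ++ T.out (T.next t b) l

/-- The output of a transducer. -/
def Transducer.run (T : Transducer) (l : List Bool) : List Bool := T.out T.start l

section Scan

variable {ι : Type} [DecidableEq ι] (A : ι → TM2ComputableAux Bool Bool)

/-- Push the bits `e` on register `d`, the last one on top, then continue with `q`. -/
def pushSeq {Λ : Type} (d : Reg) (e : List Bool) (q : Code A Λ) : Code A Λ :=
  e.foldr (fun b q => .push (.inl d) (fun _ => b) q) q

/-- Push the bits `e` on all the registers in `D`, then continue with `q`. -/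
def pushAll {Λ : Type} (D : List Reg) (e : List Bool) (q : Code A Λ) : Code A Λ :=
  D.foldr (fun d q => pushSeq A d e q) q

theorem stepAux_pushSeq {Λ : Type} (d : Reg) (e : List Bool) (q : Code A Λ)
    (s : Reg → List Bool) (F : ∀ i k, List ((A i).tm.Γ k)) (v : Var A) :
    TM2.stepAux (pushSeq A d e q) v (stk A s F) =
      TM2.stepAux q v (stk A (Function.update s d (e.reverse ++ s d)) F) := by
  induction e generalizing s with
  | nil => simp [pushSeq]
  | cons b e ih =>
    have h := update_stk_inl A s F d (b :: s d)
    have : TM2.stepAux (pushSeq A d (b :: e) q) v (stk A s F) =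
        TM2.stepAux (pushSeq A d e q) v (Function.update (stk A s F) (.inl d) (b :: s d)) := rfl
    rw [this, h, ih]
    simp

/-- The registers `s` after `e` has been pushed on those in `D`. -/
def pushed (D : List Reg) (e : List Bool) (s : Reg → List Bool) : Reg → List Bool :=
  fun k => if k ∈ D then e.reverse ++ s k else s k

theorem stepAux_pushAll {Λ : Type} (D : List Reg) (hD : D.Nodup) (e : List Bool) (q : Code A Λ)
    (s : Reg → List Bool) (F : ∀ i k, List ((A i).tm.Γ k)) (v : Var A) :
    TM2.stepAux (pushAll A D e q) v (stk A s F) =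
      TM2.stepAux q v (stk A (pushed D e s) F) := by
  induction D generalizing s with
  | nil =>
    have : pushed [] e s = s := by funext k; simp [pushed]
    rw [this]
    rfl
  | cons d D ih =>
    have : pushAll A (d :: D) e q = pushSeq A d e (pushAll A D e q) := rfl
    rw [this, stepAux_pushSeq, ih (List.nodup_cons.1 hD).2]
    congr 2
    funext k
    have hd := (List.nodup_cons.1 hD).1
    by_cases hk : k = d
    · subst hk; simp [pushed, hd]
    · simp [pushed, hk, Function.update_of_ne]

/-- Read register `r` to its end and push the output of the transducer `T`, bit by bit, on the
registers in `D`; the output arrives there in reverse order. -/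
abbrev Frag.scan (T : Transducer) (r : Reg) (D : List Reg) : Frag A where
  Pos := T.State
  fin := T.fin
  start := T.start
  code emb exit t := popThen A r
    (pushAll A D (T.emit t true) (.goto fun _ => emb (T.next t true)))
    (pushAll A D (T.emit t false) (.goto fun _ => emb (T.next t false)))
    (pushAll A D (T.last t) (.goto fun _ => exit))

theorem Runs.scan (T : Transducer) (r : Reg) (D : List Reg) (hD : D.Nodup) (hr : r ∉ D)
    (s s' : Reg → List Bool) (h : s' = Function.update (pushed D (T.run (s r)) s) r []) :
    Runs A (Frag.scan A T r D) s s' ((s r).length + 1) := by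
  intro Λ M emb exit hm
  subst h
  change ReachIn _ (cfg A (emb T.start) s)
    (cfg A exit (Function.update (pushed D (T.out T.start (s r)) s) r [])) _
  generalize T.start = t
  generalize hl : s r = l
  induction l generalizing s t with
  | nil =>
    refine ReachIn.head ?_ (ReachIn.refl _)
    simp only [cfg, TM2.step, hm, stepAux_popThen, hl]
    rw [stepAux_pushAll A D hD]
    simp only [TM2.stepAux, Transducer.out]
    congr 3
    rw [eq_comm, Function.update_eq_self_iff]
    simp [pushed, hr, hl]
  | cons b l ih =>
    have := ih (pushed D (T.emit t b) (Function.update s r l)) (T.next t b)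
      (by simp [pushed, hr])
    have e : Function.update (pushed D (T.out (T.next t b) l)
        (pushed D (T.emit t b) (Function.update s r l))) r [] =
        Function.update (pushed D (T.out t (b :: l)) s) r [] := by
      funext k
      by_cases hk : k = r
      · subst hk; simp
      · by_cases hk' : k ∈ D <;> simp [pushed, hk, hk', Transducer.out]
    rw [e] at this
    refine ReachIn.head ?_ this
    simp only [cfg, TM2.step, hm, stepAux_popThen, hl]
    cases b <;> simp only [cond] <;> rw [stepAux_pushAll A D hD] <;> simp only [TM2.stepAux]

end Scan

/-! ### Subroutine calls -/

/-- The machine `a` maps the string `u` to the string `v` in at most `n` steps. -/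
def Outputs (a : TM2ComputableAux Bool Bool) (u v : List Bool) (n : ℕ) : Prop :=
  Nonempty (TM2OutputsInTime a.tm (u.map a.inputAlphabet.symm)
    (some (v.map a.outputAlphabet.symm)) n)

theorem initList_eq (tm : FinTM2) (u : List (tm.Γ tm.k₀)) :
    initList tm u = ⟨some tm.main, tm.initialState, Function.update (fun _ => []) tm.k₀ u⟩ := by
  unfold initList
  congr 1
  funext k
  by_cases h : k = tm.k₀
  · subst h; simp
  · simp [h]

theorem haltList_eq (tm : FinTM2) (u : List (tm.Γ tm.k₁)) :
    haltList tm u = ⟨none, tm.initialState, Function.update (fun _ => []) tm.k₁ u⟩ := by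
  unfold haltList
  congr 1
  funext k
  by_cases h : k = tm.k₁
  · subst h; simp
  · simp [h]

section Call

variable {ι : Type} [DecidableEq ι] (A : ι → TM2ComputableAux Bool Bool)

/-- The code of the subroutine `A i` as a part of an ambient program, in which its labels are
embedded by `emb`, and which it leaves for the label `ret` instead of halting. -/
def liftStmt (i : ι) {Λ : Type} (emb : (A i).tm.Λ → Λ) (ret : Λ) :
    TM2.Stmt (A i).tm.Γ (A i).tm.Λ (A i).tm.σ → Code A Λ
  | .push k f q => .push (.inr ⟨i, k⟩) (fun v => f (v.2 i)) (liftStmt i emb ret q)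
  | .peek k f q => .peek (.inr ⟨i, k⟩) (fun v o => (v.1, Function.update v.2 i (f (v.2 i) o)))
      (liftStmt i emb ret q)
  | .pop k f q => .pop (.inr ⟨i, k⟩) (fun v o => (v.1, Function.update v.2 i (f (v.2 i) o)))
      (liftStmt i emb ret q)
  | .load f q => .load (fun v => (v.1, Function.update v.2 i (f (v.2 i)))) (liftStmt i emb ret q)
  | .branch f q q' => .branch (fun v => f (v.2 i)) (liftStmt i emb ret q) (liftStmt i emb ret q')
  | .goto f => .goto fun v => emb (f (v.2 i))
  | .halt => .goto fun _ => ret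

/-- The configuration of the ambient program that corresponds to a configuration of the
subroutine. -/
def liftCfg (i : ι) {Λ : Type} (emb : (A i).tm.Λ → Λ) (ret : Λ) (s : Reg → List Bool)
    (c : TM2.Cfg (A i).tm.Γ (A i).tm.Λ (A i).tm.σ) : TM2.Cfg (StackAlph A) Λ (Var A) :=
  ⟨some (c.l.elim ret emb), (none, Function.update (initVar A).2 i c.var),
    stk A s (Function.update (fun _ _ => []) i c.stk)⟩

theorem stepAux_liftStmt (i : ι) {Λ : Type} (emb : (A i).tm.Λ → Λ) (ret : Λ)
    (s : Reg → List Bool) (q : TM2.Stmt (A i).tm.Γ (A i).tm.Λ (A i).tm.σ) (v : (A i).tm.σ)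
    (S : ∀ k, List ((A i).tm.Γ k)) :
    TM2.stepAux (liftStmt A i emb ret q) (none, Function.update (initVar A).2 i v)
        (stk A s (Function.update (fun _ _ => []) i S)) =
      liftCfg A i emb ret s (TM2.stepAux q v S) := by
  induction q generalizing v S with
  | push k f q ih =>
    rw [TM2.stepAux, ← ih]
    simp only [liftStmt, TM2.stepAux]
    rw [← Function.update_idem S (Function.update S k (f v :: S k))
      (fun _ _ => [] : ∀ i k, List ((A i).tm.Γ k))]
    have := update_stk_inr A s (Function.update (fun _ _ => []) i S) i k (f v :: S k)
    rw [Function.update_self] at this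
    rw [← this]
    simp
  | peek k f q ih =>
    rw [TM2.stepAux, ← ih]
    simp [liftStmt]
  | pop k f q ih =>
    rw [TM2.stepAux, ← ih]
    simp only [liftStmt, TM2.stepAux]
    rw [← Function.update_idem S (Function.update S k (S k).tail)
      (fun _ _ => [] : ∀ i k, List ((A i).tm.Γ k))]
    have := update_stk_inr A s (Function.update (fun _ _ => []) i S) i k (S k).tail
    rw [Function.update_self] at this
    rw [← this]
    simp
  | load f q ih =>
    rw [TM2.stepAux, ← ih]
    simp [liftStmt]
  | branch f q q' ih ih' =>
    simp only [liftStmt, TM2.stepAux, Function.update_self]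
    cases f v
    · exact ih' _ _
    · exact ih _ _
  | goto f => simp [liftStmt, liftCfg]
  | halt => simp [liftStmt, liftCfg]

theorem reachIn_liftStmt (i : ι) {Λ : Type} (M : Λ → Code A Λ) (emb : (A i).tm.Λ → Λ) (ret : Λ)
    (hM : ∀ x, M (emb x) = liftStmt A i emb ret ((A i).tm.m x)) (s : Reg → List Bool)
    {u v : List Bool} {n : ℕ} (h : Outputs (A i) u v n) :
    ReachIn (TM2.step M)
      ⟨some (emb (A i).tm.main), initVar A, stk A s (Function.update (fun _ _ => []) i
        (Function.update (fun _ => []) (A i).tm.k₀ (u.map (A i).inputAlphabet.symm)))⟩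
      ⟨some ret, initVar A, stk A s (Function.update (fun _ _ => []) i
        (Function.update (fun _ => []) (A i).tm.k₁ (v.map (A i).outputAlphabet.symm)))⟩ n := by
  obtain ⟨⟨⟨k, hk⟩, hkn⟩⟩ := h
  refine ⟨k, hkn, ?_⟩
  rw [Option.map_some, haltList_eq] at hk
  change (flip bind (A i).tm.step)^[k] (some (initList _ _)) = _ at hk
  rw [initList_eq] at hk
  have e : ∀ (l : Option (A i).tm.Λ) S, (⟨some (l.elim ret emb), initVar A, stk A s
      (Function.update (fun _ _ => []) i S)⟩ : TM2.Cfg (StackAlph A) Λ (Var A)) =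
      liftCfg A i emb ret s ⟨l, (A i).tm.initialState, S⟩ := by
    intro l S
    have : Function.update (initVar A).2 i (A i).tm.initialState = (initVar A).2 :=
      Function.update_eq_self _ _
    simp only [liftCfg, this]
    rfl
  have e1 := e (some (A i).tm.main)
  have e2 := e none
  simp only [Option.elim_some, Option.elim_none] at e1 e2
  rw [e1, e2]
  have key : ∀ (k : ℕ) (c c' : (A i).tm.Cfg),
      (flip bind (A i).tm.step)^[k] (some c) = some c' →
      (flip bind (TM2.step M))^[k] (some (liftCfg A i emb ret s c)) =
        some (liftCfg A i emb ret s c') := by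
    intro k
    induction k with
    | zero =>
      intro c c' h
      simp only [Function.iterate_zero, id_eq, Option.some.injEq] at h ⊢
      rw [h]
    | succ k ih =>
      intro c c' h
      rw [Function.iterate_succ_apply] at h ⊢
      rcases c with ⟨l, w, S⟩
      rcases l with _ | l
      · have hnone : ∀ k, (flip bind (A i).tm.step)^[k] none = none := by
          intro k
          induction k with
          | zero => rfl
          | succ k ih => rw [Function.iterate_succ_apply]; exact ih
        have : flip bind (A i).tm.step (some ⟨none, w, S⟩) = none := rfl
        rw [this, hnone] at h
        cases h
      · have h1 : flip bind (A i).tm.step (some ⟨some l, w, S⟩) =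
            some (TM2.stepAux ((A i).tm.m l) w S) := rfl
        rw [h1] at h
        have h2 : flip bind (TM2.step M) (some (liftCfg A i emb ret s ⟨some l, w, S⟩)) =
            some (liftCfg A i emb ret s (TM2.stepAux ((A i).tm.m l) w S)) := by
          rw [← stepAux_liftStmt, ← hM]
          rfl
        rw [h2]
        exact ih _ _ h
  exact key _ _ _ hk

/-- Call of the subroutine `A i`: the contents of register `r`, in reverse order, become its
input, and its output is pushed bit by bit on register `d`. -/
abbrev Frag.call (i : ι) (r d : Reg) : Frag A where
  Pos := Bool ⊕ (A i).tm.Λ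
  fin := inferInstance
  start := .inl false
  code emb exit
    | .inl false => popThen A r
        (.push (.inr ⟨i, (A i).tm.k₀⟩) (fun _ => (A i).inputAlphabet.symm true)
          (.goto fun _ => emb (.inl false)))
        (.push (.inr ⟨i, (A i).tm.k₀⟩) (fun _ => (A i).inputAlphabet.symm false)
          (.goto fun _ => emb (.inl false)))
        (.goto fun _ => emb (.inr (A i).tm.main))
    | .inr x => liftStmt A i (fun y => emb (.inr y)) (emb (.inl true)) ((A i).tm.m x)
    | .inl true => .pop (.inr ⟨i, (A i).tm.k₁⟩)
        (fun v o => (o.map (A i).outputAlphabet, v.2))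
        (.branch (fun v => v.1 = some true)
          (.push (.inl d) (fun _ => true) (.load (fun v => (none, v.2))
            (.goto fun _ => emb (.inl true))))
          (.branch (fun v => v.1 = some false)
            (.push (.inl d) (fun _ => false) (.load (fun v => (none, v.2))
              (.goto fun _ => emb (.inl true))))
            (.goto fun _ => exit)))

theorem reachIn_call_in (i : ι) (r d : Reg) {Λ : Type} (M : Λ → Code A Λ)
    (emb : (Frag.call A i r d).Pos → Λ) (exit : Λ)
    (hm : ∀ x, M (emb x) = (Frag.call A i r d).code emb exit x) (s : Reg → List Bool)
    (l u : List Bool) (hl : s r = l) :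
    ReachIn (TM2.step M)
      ⟨some (emb (.inl false)), initVar A, stk A s (Function.update (fun _ _ => []) i
        (Function.update (fun _ => []) (A i).tm.k₀ (u.map (A i).inputAlphabet.symm)))⟩
      ⟨some (emb (.inr (A i).tm.main)), initVar A,
        stk A (Function.update s r []) (Function.update (fun _ _ => []) i
        (Function.update (fun _ => []) (A i).tm.k₀
          ((l.reverse ++ u).map (A i).inputAlphabet.symm)))⟩ (l.length + 1) := by
  induction l generalizing s u with
  | nil =>
    refine ReachIn.head ?_ (ReachIn.refl _)
    simp only [TM2.step, hm, stepAux_popThen, hl]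
    simp only [TM2.stepAux, List.reverse_nil, List.nil_append]
    congr 3
    rw [eq_comm, Function.update_eq_self_iff, hl]
  | cons b l ih =>
    have := ih (Function.update s r l) (b :: u) (by simp)
    rw [Function.update_idem, List.reverse_cons] at *
    simp only [List.append_assoc, List.singleton_append]
    refine ReachIn.head ?_ this
    simp only [TM2.step, hm, stepAux_popThen, hl]
    have h5 := fun (c : Bool) => update_stk_inr A (Function.update s r l)
      (Function.update (fun _ _ => []) i
        (Function.update (fun _ => []) (A i).tm.k₀ (u.map (A i).inputAlphabet.symm))) i
        (A i).tm.k₀ ((A i).inputAlphabet.symm c :: u.map (A i).inputAlphabet.symm)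
    simp only [Function.update_self, Function.update_idem] at h5
    cases b <;> simp only [cond, TM2.stepAux] <;> simp [h5]

theorem reachIn_call_out (i : ι) (r d : Reg) {Λ : Type} (M : Λ → Code A Λ)
    (emb : (Frag.call A i r d).Pos → Λ) (exit : Λ)
    (hm : ∀ x, M (emb x) = (Frag.call A i r d).code emb exit x) (s : Reg → List Bool)
    (v : List Bool) :
    ReachIn (TM2.step M)
      ⟨some (emb (.inl true)), initVar A, stk A s (Function.update (fun _ _ => []) i
        (Function.update (fun _ => []) (A i).tm.k₁ (v.map (A i).outputAlphabet.symm)))⟩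
      (cfg A exit (Function.update s d (v.reverse ++ s d))) (v.length + 1) := by
  induction v generalizing s with
  | nil =>
    refine ReachIn.head ?_ (ReachIn.refl _)
    simp only [TM2.step, hm, cfg]
    have h1 : Function.update (fun _ => []) (A i).tm.k₁
      (([] : List Bool).map (A i).outputAlphabet.symm) = fun _ => [] := by
      simp
    have h2 : Function.update (fun _ _ => [] : ∀ i k, List ((A i).tm.Γ k)) i (fun _ => []) =
      fun _ _ => [] := Function.update_eq_self _ _
    rw [h1, h2]
    have h3 := update_stk_inr A s (fun _ _ => []) i (A i).tm.k₁ []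
    rw [Function.update_eq_self_iff.2 rfl, Function.update_eq_self_iff.2 rfl] at h3
    simp [initVar, h3]
  | cons b v ih =>
    have := ih (Function.update s d (b :: s d))
    rw [Function.update_idem, Function.update_self] at this
    simp only [List.reverse_cons, List.append_assoc, List.singleton_append]
    refine ReachIn.head ?_ this
    simp only [TM2.step, hm]
    have h3 := update_stk_inr A s (Function.update (fun _ _ => []) i
        (Function.update (fun _ => []) (A i).tm.k₁ ((b :: v).map (A i).outputAlphabet.symm))) i
        (A i).tm.k₁ (v.map (A i).outputAlphabet.symm)
    simp only [Function.update_self, Function.update_idem, List.map_cons] at h3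
    have h4 := fun F => update_stk_inl A s F d (b :: s d)
    cases b <;> simp [initVar, h3, h4]

theorem Runs.call (i : ι) (r d : Reg) (s s' : Reg → List Bool) (u v : List Bool) {n : ℕ}
    (hu : s r = u.reverse) (h : Outputs (A i) u v n)
    (hs' : s' = Function.update (Function.update s r []) d
      (v.reverse ++ Function.update s r [] d)) :
    Runs A (Frag.call A i r d) s s' (u.length + n + v.length + 2) := by
  intro Λ M emb exit hm
  subst hs'
  have h1 := reachIn_call_in A i r d M emb exit hm s u.reverse [] hu
  have h3 := reachIn_call_out A i r d M emb exit hm (Function.update s r []) v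
  have h2 := reachIn_liftStmt A i M (fun y => emb (.inr y)) (emb (.inl true))
    (fun x => hm (.inr x)) (Function.update s r []) h
  rw [List.reverse_reverse, List.append_nil] at h1
  have h4 := (h1.trans h2).trans h3
  have e1 : Function.update (fun _ => []) (A i).tm.k₀
      (([] : List Bool).map (A i).inputAlphabet.symm) = fun _ => [] := by
    simp
  have e2 : Function.update (fun _ _ => [] : ∀ i k, List ((A i).tm.Γ k)) i (fun _ => []) =
      fun _ _ => [] := Function.update_eq_self _ _
  rw [e1, e2, List.length_reverse] at h4
  exact ReachIn.mono h4 (by omega)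

end Call

/-! ### Programs as Turing machines -/

section Machine

variable {ι : Type} [DecidableEq ι] [Fintype ι] (A : ι → TM2ComputableAux Bool Bool)

/-- The machine that runs the program fragment `p`. -/
abbrev Frag.machine (p : Frag A) : TM2ComputableAux Bool Bool where
  tm :=
    letI := p.fin
    { K := StackIdx A
      k₀ := .inl 0
      k₁ := .inl 1
      Γ := StackAlph A
      Λ := Option p.Pos
      main := some p.start
      σ := Var A
      initialState := initVar A
      Γk₀Fin := inferInstanceAs (Fintype Bool)
      m := fun x => x.elim .halt (p.code some none) }
  inputAlphabet := Equiv.refl Bool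
  outputAlphabet := Equiv.refl Bool

theorem Frag.outputs_machine (p : Frag A) {u v : List Bool} {n : ℕ}
    (h : Runs A p (Function.update (fun _ => []) 0 u) (Function.update (fun _ => []) 1 v) n) :
    Outputs (p.machine A) u v (n + 1) := by
  have h1 := h (Option p.Pos) (fun x => x.elim .halt (p.code some none)) some none
    (fun _ => rfl)
  have h2 : ReachIn (p.machine A).tm.step (initList (p.machine A).tm u)
      (haltList (p.machine A).tm v) (n + 1) := by
    rw [initList_eq, haltList_eq]
    have e := fun (k : Reg) (l : List Bool) =>
      update_stk_inl A (fun _ => []) (fun _ _ => []) k l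
    have e0 : stk A (fun _ => []) (fun _ _ => []) = fun _ => [] := by
      funext k; rcases k with k | k <;> rfl
    rw [e0] at e
    refine ReachIn.trans (b := cfg A none (Function.update (fun _ => []) 1 v)) ?_
      (ReachIn.head (n := 0) ?_ (ReachIn.refl _))
    · convert h1 using 1
      simp only [cfg, ← e]
      rfl
    · simp only [cfg, ← e]
      rfl
  obtain ⟨k, hk, e⟩ := h2
  refine ⟨⟨⟨k, ?_⟩, hk⟩⟩
  have hm : ∀ w : List Bool, w.map (Equiv.refl Bool).symm = w := fun w => by simp
  have e1 : (List.map (⇑(p.machine A).inputAlphabet.symm) u) = u := hm u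
  have e2 : (List.map (⇑(p.machine A).outputAlphabet.symm) v) = v := hm v
  rw [e1, e2]
  exact e

end Machine

/-! ### Polynomially bounded quantities and polynomial-time functions -/

/-- A type whose elements are encoded as binary strings. -/
class Enc (α : Type) where
  enc : α → List Bool

open Enc

/-- A string is its own code. -/
instance : Enc (List Bool) := ⟨id⟩

/-- The code of a bit is a string of length `1`. -/
instance : Enc Bool := ⟨Computability.encodeBool⟩

/-- Only the code of the first component is self-delimiting. -/
instance {α β : Type} [Enc α] [Enc β] : Enc (α × β) := ⟨fun z => pairCode (enc z.1) (enc z.2)⟩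

/-- Circuits are encoded by their descriptions. -/
instance : Enc QCircuit := ⟨QCircuit.code⟩

@[simp] theorem enc_list (l : List Bool) : enc l = l := rfl
@[simp] theorem enc_bool (b : Bool) : enc b = [b] := rfl
@[simp] theorem enc_prod {α β : Type} [Enc α] [Enc β] (z : α × β) :
    enc z = pairCode (enc z.1) (enc z.2) := rfl

theorem pairCode_append (u v w : List Bool) : pairCode u (v ++ w) = pairCode u v ++ w := by
  induction u with
  | nil => rfl
  | cons b u ih => simp [pairCode, ih]

@[simp] theorem length_pairCode (u v : List Bool) :
    (pairCode u v).length = 2 * u.length + 1 + v.length := by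
  induction u with
  | nil => simp [pairCode]; omega
  | cons b u ih => simp [pairCode, ih]; omega

variable {α β γ δ : Type} [Enc α] [Enc β] [Enc γ] [Enc δ]

/-- The function `f` is computed by a Turing machine in polynomial time. -/
def PolyTime (f : α → β) : Prop :=
  Nonempty (TM2ComputableInPolyTime (enc : α → List Bool) (enc : β → List Bool) f)

/-- The numbers `g a` are bounded by a polynomial in the length of the code of `a`. -/
def PolyBdd (g : α → ℕ) : Prop := ∃ q : Polynomial ℕ, ∀ a, g a ≤ q.eval (enc a).length

theorem eval_mono (q : Polynomial ℕ) : Monotone fun n : ℕ => q.eval n := by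
  intro a b h
  simp only [Polynomial.eval_eq_sum_range]
  gcongr

namespace PolyBdd

variable {g h : α → ℕ}

theorem mono (hh : PolyBdd h) (hgh : ∀ a, g a ≤ h a) : PolyBdd g := by
  obtain ⟨q, hq⟩ := hh
  exact ⟨q, fun a => (hgh a).trans (hq a)⟩

theorem const (n : ℕ) : PolyBdd fun _ : α => n := ⟨Polynomial.C n, fun _ => by simp⟩

theorem len : PolyBdd fun a : α => (enc a).length := ⟨Polynomial.X, fun _ => by simp⟩

theorem add (hg : PolyBdd g) (hh : PolyBdd h) : PolyBdd fun a => g a + h a := by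
  obtain ⟨q, hq⟩ := hg
  obtain ⟨r, hr⟩ := hh
  exact ⟨q + r, fun a => by simpa using add_le_add (hq a) (hr a)⟩

theorem mul (hg : PolyBdd g) (hh : PolyBdd h) : PolyBdd fun a => g a * h a := by
  obtain ⟨q, hq⟩ := hg
  obtain ⟨r, hr⟩ := hh
  exact ⟨q * r, fun a => by simpa using Nat.mul_le_mul (hq a) (hr a)⟩

theorem eval (q : Polynomial ℕ) (hg : PolyBdd g) : PolyBdd fun a => q.eval (g a) := by
  obtain ⟨r, hr⟩ := hg
  exact ⟨q.comp r, fun a => by simpa using eval_mono q (hr a)⟩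

theorem comp {g : β → ℕ} (hg : PolyBdd g) {f : α → β} (hf : PolyBdd fun a => (enc (f a)).length) :
    PolyBdd fun a => g (f a) := by
  obtain ⟨q, hq⟩ := hg
  exact (eval q hf).mono fun a => hq (f a)

end PolyBdd

/-! ### The length of the output of a machine -/

/-- The number of push statements in a statement. -/
def pushCount {K : Type} {Γ : K → Type} {Λ σ : Type} : TM2.Stmt Γ Λ σ → ℕ
  | .push _ _ q => pushCount q + 1
  | .peek _ _ q => pushCount q
  | .pop _ _ q => pushCount q
  | .load _ q => pushCount q
  | .branch _ q q' => pushCount q + pushCount q'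
  | .goto _ => 0
  | .halt => 0

theorem length_stepAux_le {K : Type} [DecidableEq K] {Γ : K → Type} {Λ σ : Type}
    (q : TM2.Stmt Γ Λ σ) (v : σ) (S : ∀ k, List (Γ k)) (k : K) :
    ((TM2.stepAux q v S).stk k).length ≤ (S k).length + pushCount q := by
  induction q generalizing v S with
  | push k' f q ih =>
    refine (ih _ _).trans ?_
    by_cases h : k = k'
    · subst h; simp [pushCount]; omega
    · simp [Function.update_of_ne h, pushCount]
  | peek k' f q ih => exact ih _ _
  | pop k' f q ih =>
    refine (ih _ _).trans ?_
    by_cases h : k = k'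
    · subst h; simp [pushCount]
    · simp [Function.update_of_ne h, pushCount]
  | load f q ih => exact ih _ _
  | branch f q q' ih ih' =>
    simp only [TM2.stepAux, pushCount]
    cases f v
    · exact (ih' _ _).trans (by omega)
    · exact (ih _ _).trans (by omega)
  | goto f => simp [pushCount]
  | halt => simp [pushCount]

/-- The outputs of a machine are at most linearly long in its running time and input length. -/
theorem Outputs.exists_length_le (a : TM2ComputableAux Bool Bool) :
    ∃ c : ℕ, ∀ u v n, Outputs a u v n → v.length ≤ u.length + c * n := by
  refine ⟨∑ l : a.tm.Λ, pushCount (a.tm.m l), ?_⟩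
  rintro u v n ⟨⟨⟨k, hk⟩, hkn⟩⟩
  replace hkn : k ≤ n := hkn
  set c := ∑ l : a.tm.Λ, pushCount (a.tm.m l) with hc
  have key : ∀ (k : ℕ) (x y : a.tm.Cfg), (flip bind a.tm.step)^[k] (some x) = some y →
      (y.stk a.tm.k₁).length ≤ (x.stk a.tm.k₁).length + c * k := by
    intro k
    induction k with
    | zero =>
      intro x y h
      simp only [Function.iterate_zero, id_eq, Option.some.injEq] at h
      simp [h]
    | succ k ih =>
      intro x y h
      rw [Function.iterate_succ_apply] at h
      rcases x with ⟨l, w, S⟩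
      rcases l with _ | l
      · have hnone : ∀ k, (flip bind a.tm.step)^[k] none = none := by
          intro k
          induction k with
          | zero => rfl
          | succ k ih => rw [Function.iterate_succ_apply]; exact ih
        have : flip bind a.tm.step (some ⟨none, w, S⟩) = none := rfl
        rw [this, hnone] at h
        cases h
      · have h1 : flip bind a.tm.step (some ⟨some l, w, S⟩) =
            some (TM2.stepAux (a.tm.m l) w S) := rfl
        rw [h1] at h
        refine (ih _ _ h).trans ?_
        have h2 := length_stepAux_le (a.tm.m l) w S a.tm.k₁
        have h3 : pushCount (a.tm.m l) ≤ c :=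
          Finset.single_le_sum (f := fun l => pushCount (a.tm.m l)) (fun _ _ => Nat.zero_le _)
            (Finset.mem_univ l)
        have h4 : ((⟨some l, w, S⟩ : a.tm.Cfg).stk a.tm.k₁).length = (S a.tm.k₁).length := rfl
        rw [h4, Nat.mul_succ]
        omega
  have h := key _ _ _ hk
  rw [haltList_eq, initList_eq] at h
  simp only [Function.update_self, List.length_map] at h
  have h5 : (Function.update (fun _ => []) a.tm.k₀ (u.map a.inputAlphabet.symm)
      a.tm.k₁ : List (a.tm.Γ a.tm.k₁)).length ≤ u.length := by
    have : ∀ k, (Function.update (fun _ => []) a.tm.k₀ (u.map a.inputAlphabet.symm)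
      k : List (a.tm.Γ k)).length ≤ u.length := by
      intro k
      by_cases hk : k = a.tm.k₀
      · subst hk; simp
      · simp [Function.update_of_ne hk]
    exact this _
  calc v.length ≤ _ := h
    _ ≤ u.length + c * n := Nat.add_le_add h5 (Nat.mul_le_mul_left _ hkn)

theorem polyTime_iff {f : α → β} : PolyTime f ↔ ∃ (a : TM2ComputableAux Bool Bool) (t : α → ℕ),
    PolyBdd t ∧ ∀ x, Outputs a (enc x) (enc (f x)) (t x) := by
  constructor
  · rintro ⟨h⟩
    exact ⟨h.toTM2ComputableAux, _, ⟨h.time, fun _ => le_rfl⟩, fun x => ⟨h.outputsFun x⟩⟩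
  · rintro ⟨a, t, ⟨q, hq⟩, h⟩
    exact ⟨{ toTM2ComputableAux := a, time := q, outputsFun := fun x =>
      ⟨(h x).some.toEvalsTo, (h x).some.steps_le_m.trans (hq x)⟩ }⟩

theorem PolyTime.length_bdd {f : α → β} (hf : PolyTime f) :
    PolyBdd fun a => (enc (f a)).length := by
  obtain ⟨a, t, ht, h⟩ := polyTime_iff.1 hf
  obtain ⟨c, hc⟩ := Outputs.exists_length_le a
  exact (PolyBdd.len.add ((PolyBdd.const c).mul ht)).mono fun x => hc _ _ _ (h x)

/-- Time-bounded runs of a program fragment from input register `0` to output register `1` yield a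
polynomial-time function. -/
theorem PolyTime.of_runs {ι : Type} [DecidableEq ι] [Fintype ι] {A : ι → TM2ComputableAux Bool Bool}
    {p : Frag A} {f : α → β} (t : α → ℕ) (ht : PolyBdd t)
    (h : ∀ x, Runs A p ![enc x, [], [], [], [], []] ![[], enc (f x), [], [], [], []] (t x)) :
    PolyTime f := by
  refine polyTime_iff.2 ⟨p.machine A, fun x => t x + 1, ht.add (PolyBdd.const 1), fun x => ?_⟩
  refine Frag.outputs_machine A p ?_
  convert h x using 1
  · funext k; fin_cases k <;> rfl
  · funext k; fin_cases k <;> rfl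

/-! ### Closure properties of polynomial time -/

/-- The transducer that copies its input. -/
def copyTransducer : Transducer where
  State := Unit
  fin := inferInstance
  start := ()
  next _ _ := ()
  emit _ b := [b]
  last _ := []

@[simp] theorem copyTransducer_run (l : List Bool) : copyTransducer.run l = l := by
  have : ∀ l, copyTransducer.out () l = l := by
    intro l
    induction l with
    | nil => rfl
    | cons b l ih => simp [Transducer.out, copyTransducer] at ih ⊢; exact ih
  exact this l

theorem Transducer.length_run_le (T : Transducer) :
    ∃ c : ℕ, ∀ l : List Bool, (T.run l).length ≤ c * (l.length + 1) := by
  let _ := T.fin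
  refine ⟨∑ t : T.State, ((T.emit t true).length + (T.emit t false).length + (T.last t).length),
    fun l => ?_⟩
  set c := ∑ t : T.State, ((T.emit t true).length + (T.emit t false).length + (T.last t).length)
  have hc : ∀ t : T.State,
      (T.emit t true).length + (T.emit t false).length + (T.last t).length ≤ c := fun t =>
    Finset.single_le_sum
      (f := fun t => (T.emit t true).length + (T.emit t false).length + (T.last t).length)
      (fun _ _ => Nat.zero_le _) (Finset.mem_univ t)
  have : ∀ t, (T.out t l).length ≤ c * (l.length + 1) := by
    induction l with
    | nil => intro t; have := hc t; simp [Transducer.out]; omega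
    | cons b l ih =>
      intro t
      have h1 := hc t
      have h2 := ih (T.next t b)
      simp only [Transducer.out, List.length_append, List.length_cons]
      have h3 : (T.emit t b).length ≤ c := by cases b <;> omega
      rw [Nat.mul_succ]
      omega
  exact this _

theorem PolyTime.transducer (T : Transducer) : PolyTime T.run := by
  obtain ⟨c, hc⟩ := T.length_run_le
  let A : Empty → TM2ComputableAux Bool Bool := nofun
  refine PolyTime.of_runs (A := A) (p := Frag.seq A (Frag.scan A T 0 [2])
    (Frag.scan A copyTransducer 2 [1])) (fun l => (l.length + 1) + (c * (l.length + 1) + 1))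
    ((PolyBdd.len.add (.const 1)).add (((PolyBdd.const c).mul
      (PolyBdd.len.add (.const 1))).add (.const 1))) fun l => ?_
  refine Runs.seq (s' := ![[], [], (T.run l).reverse, [], [], []])
    (Runs.scan A T 0 [2] (by simp) (by simp) _ _ ?_)
    ((Runs.scan A copyTransducer 2 [1] (by simp) (by simp) _ _ ?_).mono ?_)
  · funext k; fin_cases k <;> simp [pushed]
  · funext k; fin_cases k <;> simp [pushed]
  · simpa using hc l

/-- Composition: the output of the machine for `f` becomes the input of the machine for `g`. -/
theorem PolyTime.comp {g : β → γ} {f : α → β} (hg : PolyTime g) (hf : PolyTime f) :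
    PolyTime fun a => g (f a) := by
  have hfl := hf.length_bdd
  have hgl := hg.length_bdd
  obtain ⟨a, t, ht, h⟩ := polyTime_iff.1 hf
  obtain ⟨b, t', ht', h'⟩ := polyTime_iff.1 hg
  let A : Bool → TM2ComputableAux Bool Bool := fun i => cond i b a
  refine PolyTime.of_runs (A := A)
    (p := Frag.seq A (Frag.scan A copyTransducer 0 [2]) (Frag.seq A (Frag.call A false 2 3)
      (Frag.seq A (Frag.call A true 3 2) (Frag.scan A copyTransducer 2 [1]))))
    (fun x => ((enc x).length + 1) + (((enc x).length + t x + (enc (f x)).length + 2) +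
      (((enc (f x)).length + t' (f x) + (enc (g (f x))).length + 2) +
      ((enc (g (f x))).length + 1)))) ?_ fun x => ?_
  · have := hgl.comp hfl
    have := ht'.comp hfl
    repeat first | assumption | apply PolyBdd.add | apply PolyBdd.const | apply PolyBdd.len
  refine Runs.seq (s' := ![[], [], (enc x).reverse, [], [], []])
    (Runs.scan A _ 0 [2] (by simp) (by simp) _ _ ?_)
    (Runs.seq (s' := ![[], [], [], (enc (f x)).reverse, [], []])
      (Runs.call A false 2 3 _ _ (enc x) (enc (f x)) (by simp) (h x) ?_)
      (Runs.seq (s' := ![[], [], (enc (g (f x))).reverse, [], [], []])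
        (Runs.call A true 3 2 _ _ (enc (f x)) (enc (g (f x))) (by simp) (h' (f x)) ?_)
        ((Runs.scan A _ 2 [1] (by simp) (by simp) _ _ ?_).mono (by simp))))
  all_goals funext k; fin_cases k <;> simp [pushed]

theorem PolyTime.append {f g : α → List Bool} (hf : PolyTime f) (hg : PolyTime g) :
    PolyTime fun a => f a ++ g a := by
  have hfl := hf.length_bdd
  have hgl := hg.length_bdd
  obtain ⟨a, t, ht, h⟩ := polyTime_iff.1 hf
  obtain ⟨b, t', ht', h'⟩ := polyTime_iff.1 hg
  simp only [enc_list] at h h' hfl hgl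
  let A : Bool → TM2ComputableAux Bool Bool := fun i => cond i b a
  refine PolyTime.of_runs (A := A)
    (p := Frag.seq A (Frag.scan A copyTransducer 0 [2, 3]) (Frag.seq A (Frag.call A true 3 4)
      (Frag.seq A (Frag.scan A copyTransducer 4 [1]) (Frag.seq A (Frag.call A false 2 4)
        (Frag.scan A copyTransducer 4 [1])))))
    (fun x => ((enc x).length + 1) + (((enc x).length + t' x + (g x).length + 2) +
      (((g x).length + 1) + (((enc x).length + t x + (f x).length + 2) +
      ((f x).length + 1))))) ?_ fun x => ?_
  · repeat first | assumption | apply PolyBdd.add | apply PolyBdd.const | apply PolyBdd.len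
  refine Runs.seq (s' := ![[], [], (enc x).reverse, (enc x).reverse, [], []])
    (Runs.scan A _ 0 [2, 3] (by simp) (by simp) _ _ ?_)
    (Runs.seq (s' := ![[], [], (enc x).reverse, [], (g x).reverse, []])
      (Runs.call A true 3 4 _ _ (enc x) (g x) (by simp) (h' x) ?_)
      (Runs.seq (s' := ![[], g x, (enc x).reverse, [], [], []])
        ((Runs.scan A _ 4 [1] (by simp) (by simp) _ _ ?_).mono (by simp))
        (Runs.seq (s' := ![[], g x, [], [], (f x).reverse, []])
          (Runs.call A false 2 4 _ _ (enc x) (f x) (by simp) (h x) ?_)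
          ((Runs.scan A _ 4 [1] (by simp) (by simp) _ _ ?_).mono (by simp)))))
  all_goals funext k; fin_cases k <;> simp [pushed]

theorem PolyTime.ite {c : α → Bool} {f g : α → β} (hc : PolyTime c) (hf : PolyTime f)
    (hg : PolyTime g) : PolyTime fun a => if c a then f a else g a := by
  have hfl := hf.length_bdd
  have hgl := hg.length_bdd
  obtain ⟨m₀, t₀, ht₀, h₀⟩ := polyTime_iff.1 hc
  obtain ⟨m₁, t₁, ht₁, h₁⟩ := polyTime_iff.1 hf
  obtain ⟨m₂, t₂, ht₂, h₂⟩ := polyTime_iff.1 hg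
  let A : Fin 3 → TM2ComputableAux Bool Bool := ![m₀, m₁, m₂]
  refine PolyTime.of_runs (A := A)
    (p := Frag.seq A (Frag.scan A copyTransducer 0 [2, 3]) (Frag.seq A (Frag.call A 0 2 4)
      (Frag.seq A (Frag.case A 4 (Frag.call A 1 3 5) (Frag.call A 2 3 5))
        (Frag.scan A copyTransducer 5 [1]))))
    (fun x => ((enc x).length + 1) + (((enc x).length + t₀ x + 1 + 2) +
      (((enc x).length + (t₁ x + t₂ x) + ((enc (f x)).length + (enc (g x)).length) + 2 + 1) +
      (((enc (f x)).length + (enc (g x)).length) + 1)))) ?_ fun x => ?_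
  · repeat first | assumption | apply PolyBdd.add | apply PolyBdd.const | apply PolyBdd.len
  set y := if c x then f x else g x with hy
  have hl : (enc y).length ≤ (enc (f x)).length + (enc (g x)).length := by
    rw [hy]; split_ifs <;> omega
  refine Runs.seq (s' := ![[], [], (enc x).reverse, (enc x).reverse, [], []])
    (Runs.scan A _ 0 [2, 3] (by simp) (by simp) _ _ ?_)
    (Runs.seq (s' := ![[], [], [], (enc x).reverse, [c x], []])
      (Runs.call A 0 2 4 _ _ (enc x) [c x] (by simp) (h₀ x) ?_)
      (Runs.seq (s' := ![[], [], [], [], [], (enc y).reverse])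
        (Runs.case (b := c x) (l := []) (by simp) ?_)
        ((Runs.scan A _ 5 [1] (by simp) (by simp) _ _ ?_).mono (by simpa using hl))))
  · funext k; fin_cases k <;> simp [pushed]
  · funext k; fin_cases k <;> simp
  · cases hcx : c x
    · simp only [hcx, Bool.false_eq_true, if_false] at hy
      refine (Runs.call A 2 3 5 _ _ (enc x) (enc y) (by simp) (by rw [hy]; exact h₂ x) ?_).mono
        (by omega)
      funext k; fin_cases k <;> simp
    · simp only [hcx, if_true] at hy
      refine (Runs.call A 1 3 5 _ _ (enc x) (enc y) (by simp) (by rw [hy]; exact h₁ x) ?_).mono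
        (by omega)
      funext k; fin_cases k <;> simp
  · funext k; fin_cases k <;> simp [pushed]

/-- Iteration: `step` is applied as many times as `count a` is long. The intermediate values have
to stay polynomially short. -/
theorem PolyTime.iterate {count : α → List Bool} {init : α → β} {step : β → β}
    (hc : PolyTime count) (hi : PolyTime init) (hs : PolyTime step) (B : α → ℕ) (hB : PolyBdd B)
    (hle : ∀ a, ∀ i ≤ (count a).length, (enc (step^[i] (init a))).length ≤ B a) :
    PolyTime fun a => step^[(count a).length] (init a) := by
  have hcl := hc.length_bdd
  obtain ⟨m₀, t₀, ht₀, h₀⟩ := polyTime_iff.1 hc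
  obtain ⟨m₁, t₁, ht₁, h₁⟩ := polyTime_iff.1 hi
  obtain ⟨m₂, t₂, ⟨q, hq⟩, h₂⟩ := polyTime_iff.1 hs
  simp only [enc_list] at h₀ hcl
  let A : Fin 3 → TM2ComputableAux Bool Bool := ![m₀, m₁, m₂]
  refine PolyTime.of_runs (A := A)
    (p := Frag.seq A (Frag.scan A copyTransducer 0 [2, 3]) (Frag.seq A (Frag.call A 0 2 4)
      (Frag.seq A (Frag.call A 1 3 5)
        (Frag.seq A (Frag.loop A 4 (Frag.seq A (Frag.call A 2 5 2)
          (Frag.seq A (Frag.scan A copyTransducer 2 [3]) (Frag.scan A copyTransducer 3 [5]))))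
        (Frag.scan A copyTransducer 5 [1])))))
    (fun x => ((enc x).length + 1) + (((enc x).length + t₀ x + (count x).length + 2) +
      (((enc x).length + t₁ x + B x + 2) +
      (((count x).length * ((B x + q.eval (B x) + B x + 2) + ((B x + 1) + (B x + 1)) + 1) + 1) +
      (B x + 1))))) ?_ fun x => ?_
  · repeat first
      | assumption | apply PolyBdd.add | apply PolyBdd.const | apply PolyBdd.len
      | apply PolyBdd.mul | apply PolyBdd.eval
  refine Runs.seq (s' := ![[], [], (enc x).reverse, (enc x).reverse, [], []])
    (Runs.scan A _ 0 [2, 3] (by simp) (by simp) _ _ ?_)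
    (Runs.seq (s' := ![[], [], [], (enc x).reverse, (count x).reverse, []])
      (Runs.call A 0 2 4 _ _ (enc x) (count x) (by simp) (h₀ x) ?_)
      (Runs.seq (s' := ![[], [], [], [], (count x).reverse, (enc (init x)).reverse])
        ((Runs.call A 1 3 5 _ _ (enc x) (enc (init x)) (by simp) (h₁ x) ?_).mono ?_)
        (Runs.seq (s' := ![[], [], [], [], [], (enc (step^[(count x).length] (init x))).reverse])
          ?_ ((Runs.scan A _ 5 [1] (by simp) (by simp) _ _ ?_).mono ?_))))
  · funext k; fin_cases k <;> simp [pushed]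
  · funext k; fin_cases k <;> simp
  · funext k; fin_cases k <;> simp
  · have := hle x 0 (Nat.zero_le _)
    simp only [Function.iterate_zero, id_eq] at this
    omega
  · have key : ∀ (l : List Bool) (y : β),
        (∀ i ≤ l.length, (enc (step^[i] y)).length ≤ B x) →
        Runs A (Frag.loop A 4 (Frag.seq A (Frag.call A 2 5 2)
          (Frag.seq A (Frag.scan A copyTransducer 2 [3]) (Frag.scan A copyTransducer 3 [5]))))
          ![[], [], [], [], l, (enc y).reverse]
          ![[], [], [], [], [], (enc (step^[l.length] y)).reverse]
          (l.length * ((B x + q.eval (B x) + B x + 2) + ((B x + 1) + (B x + 1)) + 1) + 1) := by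
      intro l
      induction l with
      | nil =>
        intro y _
        exact (Runs.loop_nil (by simp)).mono (by simp)
      | cons b l ih =>
        intro y hy
        have e0 := hy 0 (Nat.zero_le _)
        have e1 := hy 1 (by simp)
        simp only [Function.iterate_zero, id_eq, Function.iterate_one] at e0 e1
        have hl := ih (step y) fun i hi => by
          rw [← Function.iterate_succ_apply]; exact hy (i + 1) (by simpa using hi)
        rw [← Function.iterate_succ_apply] at hl
        refine (Runs.loop_cons (b := b) (l := l) (by simp) (Runs.seq
          (s' := ![[], [], (enc (step y)).reverse, [], l, []])
          (Runs.call A 2 5 2 _ _ (enc y) (enc (step y)) (by simp) (h₂ y) ?_)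
          (Runs.seq (s' := ![[], [], [], enc (step y), l, []])
            (Runs.scan A _ 2 [3] (by simp) (by simp) _ _ ?_)
            (Runs.scan A _ 3 [5] (by simp) (by simp) _ _ ?_))) hl).mono ?_
        · funext k; fin_cases k <;> simp
        · funext k; fin_cases k <;> simp [pushed]
        · funext k; fin_cases k <;> simp [pushed]
        · have h3 : t₂ y ≤ q.eval (B x) := (hq y).trans (eval_mono q e0)
          simp only [List.length_cons, Nat.add_mul, Nat.one_mul]
          simp
          omega
    have := key (count x).reverse (init x) (by simpa using hle x)
    simpa using this
  · funext k; fin_cases k <;> simp [pushed]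
  · simpa using hle x _ le_rfl

/-! ### Elementary polynomial-time functions -/

/-- A function is polynomial-time if it is represented on codes by one that is. -/
theorem PolyTime.of_string {F : List Bool → List Bool} (hF : PolyTime F) {f : α → β}
    (h : ∀ a, enc (f a) = F (enc a)) : PolyTime f := by
  obtain ⟨m, t, ⟨q, hq⟩, hm⟩ := polyTime_iff.1 hF
  refine polyTime_iff.2 ⟨m, fun a => t (enc a), ⟨q, fun a => hq (enc a)⟩, fun a => ?_⟩
  rw [h]
  exact hm (enc a)

/-- Change of the type of the values of a function, not of their codes. -/
theorem PolyTime.recode {f : α → β} (hf : PolyTime f) {g : α → γ}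
    (h : ∀ a, enc (g a) = enc (f a)) : PolyTime g := by
  obtain ⟨m, t, ht, hm⟩ := polyTime_iff.1 hf
  refine polyTime_iff.2 ⟨m, t, ht, fun a => ?_⟩
  rw [h]
  exact hm a

theorem PolyTime.id : PolyTime fun a : α => a := ⟨idComputableInPolyTime _⟩

theorem PolyTime.of_eq {f g : α → β} (hf : PolyTime f) (h : ∀ a, f a = g a) : PolyTime g := by
  rwa [← funext h]

theorem PolyTime.const (b : β) : PolyTime fun _ : α => b := by
  let T : Transducer := ⟨Unit, inferInstance, (), fun _ _ => (), fun _ _ => [], fun _ => enc b⟩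
  refine (PolyTime.transducer T).of_string fun a => ?_
  change _ = T.out () _
  induction enc a with
  | nil => rfl
  | cons c l ih => exact ih

/-- The first component of a pair of strings, for an arbitrary string. -/
def unpairFst : List Bool → List Bool
  | true :: b :: l => b :: unpairFst l
  | _ => []

/-- The second component of a pair of strings, for an arbitrary string. -/
def unpairSnd : List Bool → List Bool
  | true :: _ :: l => unpairSnd l
  | false :: l => l
  | _ => []

@[simp] theorem unpairFst_pairCode (u v : List Bool) : unpairFst (pairCode u v) = u := by
  induction u with
  | nil => simp [pairCode, unpairFst]
  | cons b u ih => simp [pairCode, unpairFst, ih]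

@[simp] theorem unpairSnd_pairCode (u v : List Bool) : unpairSnd (pairCode u v) = v := by
  induction u with
  | nil => simp [pairCode, unpairSnd]
  | cons b u ih => simp [pairCode, unpairSnd, ih]

theorem length_unpairFst_le (l : List Bool) : (unpairFst l).length ≤ l.length := by
  fun_induction unpairFst l <;> simp_all; omega

theorem length_unpairSnd_le (l : List Bool) : (unpairSnd l).length ≤ l.length := by
  fun_induction unpairSnd l <;> simp_all; omega

theorem polyTime_unpairFst : PolyTime unpairFst := by
  -- State `some false` expects a flag, `some true` a payload bit, and `none` skips the rest.
  let T : Transducer :=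
    { State := Option Bool
      fin := inferInstance
      start := some false
      next := fun t b => match t with
        | some false => if b then some true else none
        | some true => some false
        | none => none
      emit := fun t b => if t = some true then [b] else []
      last := fun _ => [] }
  have h0 : ∀ l, T.out none l = [] := by
    intro l
    induction l with
    | nil => rfl
    | cons b l ih => exact ih
  have h : ∀ l, T.out (some false) l = unpairFst l := by
    intro l
    fun_induction unpairFst l with
    | case1 b l ih =>
      rw [← ih]; rfl
    | case2 l hl =>
      rcases l with _ | ⟨_ | _, l⟩
      · rfl
      · exact h0 l
      · rcases l with _ | ⟨b, l⟩
        · rfl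
        · exact absurd rfl (hl b l)
  exact (PolyTime.transducer T).of_eq h

theorem polyTime_unpairSnd : PolyTime unpairSnd := by
  -- State `some false` expects a flag, `some true` a payload bit, and `none` copies the rest.
  let T : Transducer :=
    { State := Option Bool
      fin := inferInstance
      start := some false
      next := fun t b => match t with
        | some false => if b then some true else none
        | some true => some false
        | none => none
      emit := fun t b => if t = none then [b] else []
      last := fun _ => [] }
  have h0 : ∀ l, T.out none l = l := by
    intro l
    induction l with
    | nil => rfl
    | cons b l ih => exact congrArg (b :: ·) ih
  have h : ∀ l, T.out (some false) l = unpairSnd l := by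
    intro l
    fun_induction unpairSnd l with
    | case1 b l ih =>
      rw [← ih]; rfl
    | case2 l => exact h0 l
    | case3 l hl hl' =>
      rcases l with _ | ⟨_ | _, l⟩
      · rfl
      · exact absurd rfl (hl' l)
      · rcases l with _ | ⟨b, l⟩
        · rfl
        · exact absurd rfl (hl b l)
  exact (PolyTime.transducer T).of_eq h

theorem PolyTime.unpairFst {f : α → List Bool} (hf : PolyTime f) :
    PolyTime fun a => unpairFst (f a) := polyTime_unpairFst.comp hf

theorem PolyTime.unpairSnd {f : α → List Bool} (hf : PolyTime f) :
    PolyTime fun a => unpairSnd (f a) := polyTime_unpairSnd.comp hf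

theorem PolyTime.fst {f : α → β × γ} (hf : PolyTime f) : PolyTime fun a => (f a).1 :=
  PolyTime.comp (g := fun z : β × γ => z.1)
    (polyTime_unpairFst.of_string fun _ => (unpairFst_pairCode _ _).symm) hf

theorem PolyTime.snd {f : α → β × γ} (hf : PolyTime f) : PolyTime fun a => (f a).2 :=
  PolyTime.comp (g := fun z : β × γ => z.2)
    (polyTime_unpairSnd.of_string fun _ => (unpairSnd_pairCode _ _).symm) hf

theorem PolyTime.pair {f : α → β} {g : α → γ} (hf : PolyTime f) (hg : PolyTime g) :
    PolyTime fun a => (f a, g a) := by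
  let T : Transducer :=
    ⟨Unit, inferInstance, (), fun _ _ => (), fun _ b => [true, b], fun _ => [false]⟩
  have h : ∀ l, T.out () l = pairCode l [] := by
    intro l
    induction l with
    | nil => rfl
    | cons b l ih => exact congrArg (fun l => true :: b :: l) ih
  have h1 : PolyTime fun a => enc (f a) := hf.recode fun _ => rfl
  have h2 : PolyTime fun a => enc (g a) := hg.recode fun _ => rfl
  refine (((PolyTime.transducer T).comp h1).append h2).recode fun a => ?_
  change pairCode _ _ = T.out () _ ++ _
  rw [h, ← pairCode_append, List.nil_append]

theorem PolyTime.pairCode {f g : α → List Bool} (hf : PolyTime f) (hg : PolyTime g) :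
    PolyTime fun a => pairCode (f a) (g a) :=
  (hf.pair hg).recode fun _ => rfl

theorem PolyTime.cons {f : α → Bool} {g : α → List Bool} (hf : PolyTime f) (hg : PolyTime g) :
    PolyTime fun a => f a :: g a := by
  have h1 : PolyTime fun a => [f a] := hf.recode fun _ => rfl
  exact h1.append hg

theorem PolyTime.tail {f : α → List Bool} (hf : PolyTime f) : PolyTime fun a => (f a).tail := by
  let T : Transducer :=
    ⟨Bool, inferInstance, false, fun _ _ => true, fun t b => if t then [b] else [], fun _ => []⟩
  have h : ∀ l, T.out true l = l := by
    intro l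
    induction l with
    | nil => rfl
    | cons b l ih => exact congrArg (b :: ·) ih
  have h' : ∀ l, T.run l = l.tail := by
    rintro (_ | ⟨b, l⟩)
    · rfl
    · exact h l
  exact ((PolyTime.transducer T).of_eq h').comp hf

theorem PolyTime.head {f : α → List Bool} (hf : PolyTime f) :
    PolyTime fun a => (f a).headD false := by
  let T : Transducer :=
    ⟨Option Bool, inferInstance, none, fun t b => some (t.getD b), fun _ _ => [],
      fun t => [t.getD false]⟩
  have h : ∀ l c, T.out (some c) l = [c] := by
    intro l c
    induction l with
    | nil => rfl
    | cons b l ih => exact ih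
  have h' : PolyTime fun l : List Bool => l.headD false := by
    refine (PolyTime.transducer T).of_string fun l => ?_
    rcases l with _ | ⟨b, l⟩
    · rfl
    · exact (h l b).symm
  exact h'.comp hf

theorem PolyTime.isEmpty {f : α → List Bool} (hf : PolyTime f) :
    PolyTime fun a => (f a).isEmpty := by
  let T : Transducer :=
    ⟨Bool, inferInstance, true, fun _ _ => false, fun _ _ => [], fun t => [t]⟩
  have h : ∀ l, T.out false l = [false] := by
    intro l
    induction l with
    | nil => rfl
    | cons b l ih => exact ih
  have h' : PolyTime fun l : List Bool => l.isEmpty := by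
    refine (PolyTime.transducer T).of_string fun l => ?_
    rcases l with _ | ⟨b, l⟩
    · rfl
    · exact (h l).symm
  exact h'.comp hf

theorem PolyTime.not {c : α → Bool} (hc : PolyTime c) : PolyTime fun a => !c a :=
  (hc.ite (.const false) (.const true)).of_eq fun a => by cases c a <;> rfl

theorem PolyTime.and {c d : α → Bool} (hc : PolyTime c) (hd : PolyTime d) :
    PolyTime fun a => c a && d a :=
  (hc.ite hd (.const false)).of_eq fun a => by cases c a <;> simp

theorem PolyTime.beq {c d : α → Bool} (hc : PolyTime c) (hd : PolyTime d) :
    PolyTime fun a => c a == d a :=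
  (hc.ite hd hd.not).of_eq fun a => by cases c a <;> simp

theorem iterate_invariant {S : Type*} {f : S → S} (P : ℕ → S → Prop) {s : S} (h0 : P 0 s)
    (hs : ∀ i s, P i s → P (i + 1) (f s)) (i : ℕ) : P i (f^[i] s) := by
  induction i with
  | zero => exact h0
  | succ i ih => rw [Function.iterate_succ_apply']; exact hs _ _ ih

/-- Iteration of a step that lengthens the code of every state that satisfies an invariant by a
polynomially bounded amount. -/
theorem PolyTime.iterate_of_growth {count : α → List Bool} {init : α → β} {step : β → β}
    (hc : PolyTime count) (hi : PolyTime init) (hs : PolyTime step) (Inv : α → β → Prop)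
    (h0 : ∀ a, Inv a (init a)) (h1 : ∀ a b, Inv a b → Inv a (step b)) (B : α → ℕ) (hB : PolyBdd B)
    (hle : ∀ a b, Inv a b → (enc (step b)).length ≤ (enc b).length + B a) :
    PolyTime fun a => step^[(count a).length] (init a) := by
  refine PolyTime.iterate hc hi hs (fun a => (enc (init a)).length + (count a).length * B a)
    (hi.length_bdd.add (PolyBdd.mul hc.length_bdd hB)) fun a i hi => ?_
  have := iterate_invariant (f := step) (s := init a)
    (fun i b => Inv a b ∧ (enc b).length ≤ (enc (init a)).length + i * B a)
    ⟨h0 a, by simp⟩ (fun i b hb => ⟨h1 a b hb.1, by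
      have := hle a b hb.1
      rw [Nat.add_mul, Nat.one_mul]
      omega⟩) i
  exact this.2.trans (Nat.add_le_add_left (Nat.mul_le_mul_right _ hi) _)

/-! ### Comparison of strings and of lengths -/

/-- One step of the comparison of two strings. -/
def eqStep (s : (List Bool × List Bool) × Bool) : (List Bool × List Bool) × Bool :=
  ((s.1.1.tail, s.1.2.tail),
    (s.2 && (s.1.1.isEmpty == s.1.2.isEmpty)) && (s.1.1.headD false == s.1.2.headD false))

theorem iterate_eqStep (n : ℕ) (u v : List Bool) (b : Bool) (hu : u.length ≤ n)
    (hv : v.length ≤ n) : (eqStep^[n] ((u, v), b)).2 = (b && decide (u = v)) := by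
  induction n generalizing u v b with
  | zero =>
    simp only [Nat.le_zero, List.length_eq_zero_iff] at hu hv
    simp [hu, hv]
  | succ n ih =>
    rw [Function.iterate_succ_apply, eqStep, ih _ _ _ (by simp; omega) (by simp; omega)]
    rcases u with _ | ⟨c, u⟩ <;> rcases v with _ | ⟨d, v⟩ <;> simp
    rw [Bool.and_assoc]
    rfl

theorem PolyTime.eqStr {f g : α → List Bool} (hf : PolyTime f) (hg : PolyTime g) :
    PolyTime fun a => decide (f a = g a) := by
  have h1 : PolyTime eqStep :=
    ((PolyTime.id.fst.fst.tail).pair PolyTime.id.fst.snd.tail).pair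
      ((PolyTime.id.snd.and (PolyTime.id.fst.fst.isEmpty.beq PolyTime.id.fst.snd.isEmpty)).and
        (PolyTime.id.fst.fst.head.beq PolyTime.id.fst.snd.head))
  have h2 := PolyTime.iterate_of_growth (count := fun a => f a ++ g a)
    (init := fun a => ((f a, g a), true)) (step := eqStep) (hf.append hg)
    ((hf.pair hg).pair (.const true)) h1 (fun _ _ => True) (fun _ => trivial)
    (fun _ _ _ => trivial) (fun _ => 0) (.const 0) fun a b _ => by
      simp [eqStep]
      omega
  refine h2.snd.of_eq fun a => ?_
  rw [iterate_eqStep _ _ _ _ (by simp) (by simp)]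
  simp

theorem PolyTime.lengthLT {f g : α → List Bool} (hf : PolyTime f) (hg : PolyTime g) :
    PolyTime fun a => decide ((f a).length < (g a).length) := by
  have h := PolyTime.iterate_of_growth (step := List.tail) hf hg PolyTime.id.tail
    (fun _ _ => True) (fun _ => trivial) (fun _ _ _ => trivial) (fun _ => 0) (.const 0)
    fun a b _ => by simp
  refine h.isEmpty.not.of_eq fun a => ?_
  have : ∀ (n : ℕ) (l : List Bool), List.tail^[n] l = l.drop n := by
    intro n
    induction n with
    | zero => simp
    | succ n ih => intro l; rw [Function.iterate_succ_apply, ih]; simp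
  rw [this]
  rcases h : (g a).drop (f a).length with _ | ⟨b, l⟩
  · simpa using h
  · have : (f a).length < (g a).length := by
      by_contra hlt
      rw [List.drop_eq_nil_of_le (by omega)] at h
      cases h
    simpa using this

/-! ### Majority votes over a list of strings -/

/-- The code of a list of strings. -/
def itemsCode : List (List Bool) → List Bool
  | [] => []
  | u :: l => pairCode u (itemsCode l)

/-- The state of a vote: the parameter, the remaining items, and the votes in favour and against,
counted in unary. -/
abbrev VoteState (α : Type) : Type := (α × List Bool) × (List Bool × List Bool)

/-- The evaluation of the first remaining vote. -/
def voteStep (G : α × List Bool → Bool) (s : VoteState α) : VoteState α :=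
  if s.1.2.isEmpty then s else
    ((s.1.1, unpairSnd s.1.2),
      if G (s.1.1, unpairFst s.1.2) then (true :: s.2.1, s.2.2) else (s.2.1, true :: s.2.2))

/-- The majority vote of `G (a, u)` over all strings `u` in the list with code `z.2`, where
`a = z.1`. The length of the code bounds the number of strings, and steps after the last string
have no effect. -/
def majority (G : α × List Bool → Bool) (z : α × List Bool) : Bool :=
  let s := (voteStep G)^[z.2.length] (z, ([], []))
  decide (s.2.2.length < s.2.1.length)

theorem length_itemsCode (l : List (List Bool)) : l.length ≤ (itemsCode l).length := by
  induction l with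
  | nil => simp
  | cons u l ih => simp [itemsCode]; omega

theorem itemsCode_cons_isEmpty (u : List Bool) (l : List (List Bool)) :
    (itemsCode (u :: l)).isEmpty = false := by
  have := length_itemsCode (u :: l)
  rw [List.isEmpty_eq_false_iff]
  intro h
  rw [h] at this
  simp at this

theorem iterate_voteStep {σ : Type} (G : σ × List Bool → Bool) (a : σ) (l : List (List Bool))
    (n : ℕ) (hn : l.length ≤ n) (p q : List Bool) :
    ((voteStep G)^[n] ((a, itemsCode l), (p, q))).2.1.length =
        p.length + l.countP (fun u => G (a, u)) ∧
      ((voteStep G)^[n] ((a, itemsCode l), (p, q))).2.2.length =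
        q.length + l.countP (fun u => !G (a, u)) := by
  induction n generalizing l p q with
  | zero =>
    have : l = [] := by simpa using hn
    subst this
    simp
  | succ n ih =>
    rw [Function.iterate_succ_apply]
    rcases l with _ | ⟨u, l⟩
    · have : voteStep G ((a, itemsCode []), (p, q)) = ((a, itemsCode []), (p, q)) := rfl
      rw [this]
      exact ih [] (by simp) p q
    · have hl : l.length ≤ n := by simpa using hn
      simp only [voteStep, itemsCode_cons_isEmpty, Bool.false_eq_true, if_false]
      simp only [itemsCode, unpairFst_pairCode, unpairSnd_pairCode]
      cases hG : G (a, u)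
      · have := ih l hl p (true :: q)
        simp only [Bool.false_eq_true, if_false, this, List.countP_cons, hG]
        simp; omega
      · have := ih l hl (true :: p) q
        simp only [if_true, this, List.countP_cons, hG]
        simp; omega

theorem majority_itemsCode {σ : Type} (G : σ × List Bool → Bool) (a : σ) (l : List (List Bool)) :
    majority G (a, itemsCode l) =
      decide (l.countP (fun u => !G (a, u)) < l.countP (fun u => G (a, u))) := by
  obtain ⟨h1, h2⟩ := iterate_voteStep G a l (itemsCode l).length (length_itemsCode l) [] []
  simp only [majority, h1, h2, List.length_nil, zero_add]

theorem PolyTime.majority {G : α × List Bool → Bool} (hG : PolyTime G) :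
    PolyTime (majority G) := by
  have id' : PolyTime fun s : VoteState α => s := PolyTime.id
  have hs : PolyTime (voteStep G) :=
    id'.fst.snd.isEmpty.ite id' ((id'.fst.fst.pair id'.fst.snd.unpairSnd).pair
      ((hG.comp (id'.fst.fst.pair id'.fst.snd.unpairFst)).ite
        (((PolyTime.const true).cons id'.snd.fst).pair id'.snd.snd)
        (id'.snd.fst.pair ((PolyTime.const true).cons id'.snd.snd))))
  have h := PolyTime.iterate_of_growth (α := α × List Bool) (count := fun z => z.2)
    (init := fun z => (z, ([], []))) (step := voteStep G) PolyTime.id.snd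
    (PolyTime.id.pair (.const ([], []))) hs (fun _ _ => True) (fun _ => trivial)
    (fun _ _ _ => trivial) (fun _ => 2) (.const 2) fun a b _ => by
      have := length_unpairSnd_le b.1.2
      simp only [voteStep]
      split_ifs <;> simp <;> omega
  exact h.snd.snd.lengthLT h.snd.fst

/-! ### Labelling points by a training set -/

/-- One step of the search for a point in a training set. The state consists of the unread part of
the training set, the point, and the label found so far, if any. -/
def lookupStep (s : (List Bool × List Bool) × List Bool) : (List Bool × List Bool) × List Bool :=
  if s.1.1.isEmpty then s else
    (((unpairSnd s.1.1).tail, s.1.2),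
      if s.2.isEmpty && decide (unpairFst s.1.1 = s.1.2) then [(unpairSnd s.1.1).headD false]
      else s.2)

/-- The label of the point `z.2` in the training set with code `z.1`, as a string of length `1`, or
the empty string if the point is not in the training set. -/
def lookup (z : List Bool × List Bool) : List Bool :=
  (lookupStep^[z.1.length] (z, [])).2

theorem polyTime_lookup : PolyTime lookup := by
  have id' : PolyTime fun s : (List Bool × List Bool) × List Bool => s := PolyTime.id
  have hs : PolyTime lookupStep :=
    id'.fst.fst.isEmpty.ite id' ((id'.fst.fst.unpairSnd.tail.pair id'.fst.snd).pair
      ((id'.snd.isEmpty.and (id'.fst.fst.unpairFst.eqStr id'.fst.snd)).ite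
        (id'.fst.fst.unpairSnd.head.cons (.const [])) id'.snd))
  have h := PolyTime.iterate_of_growth (α := List Bool × List Bool) (count := fun z => z.1)
    (init := fun z => (z, ([] : List Bool))) (step := lookupStep) PolyTime.id.fst
    (PolyTime.id.pair (.const [])) hs (fun _ _ => True) (fun _ => trivial)
    (fun _ _ _ => trivial) (fun _ => 1) (.const 1) fun a b _ => by
      have := length_unpairSnd_le b.1.1
      simp only [lookupStep]
      split_ifs <;> simp <;> omega
  exact h.snd

theorem length_lookup_le (z : List Bool × List Bool) : (lookup z).length ≤ 1 := by
  refine iterate_invariant (f := lookupStep) (fun _ s => s.2.length ≤ 1) (by simp)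
    (fun i s hs => ?_) _
  simp only [lookupStep]
  split_ifs <;> simp [hs]

theorem trainingCode_cons {n : ℕ} (x : Fin n → Bool) (y : Bool)
    (T : List ((Fin n → Bool) × Bool)) :
    trainingCode ((x, y) :: T) = pairCode (bitString x) (y :: trainingCode T) := rfl

theorem length_trainingCode {n : ℕ} (T : List ((Fin n → Bool) × Bool)) :
    (trainingCode T).length = T.length * (2 * n + 2) := by
  induction T with
  | nil => simp [trainingCode]
  | cons a T ih =>
    obtain ⟨x, y⟩ := a
    simp [trainingCode_cons, bitString, ih, Nat.add_mul]
    omega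

theorem trainingCode_cons_isEmpty {n : ℕ} (a : (Fin n → Bool) × Bool)
    (T : List ((Fin n → Bool) × Bool)) : (trainingCode (a :: T)).isEmpty = false := by
  have := length_trainingCode (a :: T)
  rw [List.isEmpty_eq_false_iff]
  intro h
  simp [h, Nat.add_mul] at this

theorem bitString_injective {n : ℕ} : Function.Injective (bitString (n := n)) :=
  List.ofFn_injective

theorem iterate_lookupStep {n : ℕ} (T : List ((Fin n → Bool) × Bool)) (c : (Fin n → Bool) → Bool)
    (hT : ∀ a ∈ T, a.2 = c a.1) (x : Fin n → Bool) (m : ℕ) (hm : T.length ≤ m) (r : List Bool) :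
    (lookupStep^[m] ((trainingCode T, bitString x), r)).2 =
      if r.isEmpty ∧ x ∈ T.map Prod.fst then [c x] else r := by
  induction m generalizing T r with
  | zero =>
    have : T = [] := by simpa using hm
    subst this
    simp
  | succ m ih =>
    rw [Function.iterate_succ_apply]
    rcases T with _ | ⟨⟨y, b⟩, T⟩
    · have : lookupStep ((trainingCode ([] : List ((Fin n → Bool) × Bool)), bitString x), r) =
          ((trainingCode ([] : List ((Fin n → Bool) × Bool)), bitString x), r) := rfl
      rw [this]
      exact ih [] (by simp) (by simp) r
    · have hb : b = c y := hT (y, b) (by simp)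
      have hT' : ∀ a ∈ T, a.2 = c a.1 := fun a ha => hT a (by simp [ha])
      have hm' : T.length ≤ m := by simpa using hm
      simp only [lookupStep, trainingCode_cons_isEmpty, Bool.false_eq_true, if_false]
      simp only [trainingCode_cons, unpairFst_pairCode, unpairSnd_pairCode, List.tail_cons,
        List.headD_cons]
      rw [ih T hT' hm']
      by_cases hxy : y = x
      · subst hxy
        rcases r with _ | ⟨d, r⟩ <;> simp [hb]
      · have : bitString y ≠ bitString x := fun h => hxy (bitString_injective h)
        have hxy' : x ≠ y := Ne.symm hxy
        rcases r with _ | ⟨d, r⟩ <;> simp [this, hxy']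

theorem lookup_trainingCode {n : ℕ} (T : List ((Fin n → Bool) × Bool)) (c : (Fin n → Bool) → Bool)
    (hT : ∀ a ∈ T, a.2 = c a.1) (x : Fin n → Bool) :
    lookup (trainingCode T, bitString x) = if x ∈ T.map Prod.fst then [c x] else [] := by
  rw [lookup, iterate_lookupStep T c hT x _ (by
    rw [length_trainingCode]; exact Nat.le_mul_of_pos_right _ (by omega))]
  simp

/-- One step of the labelling of a list of points. The state consists of the unread part of the
list, the training set, and the labelled points. -/
def labelStep (s : (List Bool × List Bool) × List Bool) : (List Bool × List Bool) × List Bool :=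
  if s.1.1.isEmpty then s else
    (((unpairSnd s.1.1).tail, s.1.2),
      s.2 ++ pairCode (unpairFst s.1.1) (lookup (s.1.2, unpairFst s.1.1)))

/-- Replace every label in the training set with code `z.1` by the label that the same point has
in the training set with code `z.2`. -/
def relabel (z : List Bool × List Bool) : List Bool :=
  (labelStep^[z.1.length] (z, [])).2

theorem polyTime_relabel : PolyTime relabel := by
  have id' : PolyTime fun s : (List Bool × List Bool) × List Bool => s := PolyTime.id
  have hs : PolyTime labelStep :=
    id'.fst.fst.isEmpty.ite id' ((id'.fst.fst.unpairSnd.tail.pair id'.fst.snd).pair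
      (id'.snd.append (id'.fst.fst.unpairFst.pairCode
        (polyTime_lookup.comp (id'.fst.snd.pair id'.fst.fst.unpairFst)))))
  have h := PolyTime.iterate_of_growth (α := List Bool × List Bool) (count := fun z => z.1)
    (init := fun z => (z, ([] : List Bool))) (step := labelStep) PolyTime.id.fst
    (PolyTime.id.pair (.const [])) hs (fun a s => s.1.1.length ≤ a.1.length) (fun _ => le_rfl)
    (fun a s hs => by
      have := length_unpairSnd_le s.1.1
      simp only [labelStep]
      split_ifs
      · exact hs
      · simp; omega)
    (fun a => 2 * a.1.length + 2) (((PolyBdd.const 2).mul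
      (PolyTime.id.fst.length_bdd)).add (.const 2)) fun a b hb => by
      have := length_unpairSnd_le b.1.1
      have := length_unpairFst_le b.1.1
      have := length_lookup_le (b.1.2, unpairFst b.1.1)
      simp only [labelStep]
      split_ifs
      · simp
      · simp
        omega
  exact h.snd

theorem iterate_labelStep {n : ℕ} (U T : List ((Fin n → Bool) × Bool)) (c : (Fin n → Bool) → Bool)
    (hT : ∀ a ∈ T, a.2 = c a.1) (hU : ∀ a ∈ U, a.1 ∈ T.map Prod.fst) (m : ℕ) (hm : U.length ≤ m)
    (r : List Bool) :
    (labelStep^[m] ((trainingCode U, trainingCode T), r)).2 =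
      r ++ trainingCode (U.map fun a => (a.1, c a.1)) := by
  induction m generalizing U r with
  | zero =>
    have : U = [] := by simpa using hm
    subst this
    simp [trainingCode]
  | succ m ih =>
    rw [Function.iterate_succ_apply]
    rcases U with _ | ⟨⟨y, b⟩, U⟩
    · have : labelStep ((trainingCode ([] : List ((Fin n → Bool) × Bool)), trainingCode T), r) =
          ((trainingCode ([] : List ((Fin n → Bool) × Bool)), trainingCode T), r) := rfl
      rw [this]
      exact ih [] (by simp) (by simp) r
    · have hU' : ∀ a ∈ U, a.1 ∈ T.map Prod.fst := fun a ha => hU a (by simp [ha])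
      have hy : y ∈ T.map Prod.fst := hU (y, b) (by simp)
      have hm' : U.length ≤ m := by simpa using hm
      simp only [labelStep, trainingCode_cons_isEmpty, Bool.false_eq_true, if_false]
      simp only [trainingCode_cons, unpairFst_pairCode, unpairSnd_pairCode, List.tail_cons]
      rw [ih U hU' hm', lookup_trainingCode T c hT, if_pos hy, List.map_cons, trainingCode_cons,
        List.append_assoc, ← pairCode_append]
      rfl

theorem relabel_trainingCode {n : ℕ} (U T : List ((Fin n → Bool) × Bool))
    (c : (Fin n → Bool) → Bool) (hT : ∀ a ∈ T, a.2 = c a.1)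
    (hU : ∀ a ∈ U, a.1 ∈ T.map Prod.fst) :
    relabel (trainingCode U, trainingCode T) = trainingCode (U.map fun a => (a.1, c a.1)) := by
  rw [relabel, iterate_labelStep U T c hT hU _ (by
    rw [length_trainingCode]; exact Nat.le_mul_of_pos_right _ (by omega))]
  simp

/-! ### Binary increments and strings encoded by sets of points -/

/-- Increment of a binary number of fixed length, least significant bit first, modulo a power
of `2`. -/
def inc : List Bool → List Bool
  | [] => []
  | false :: l => true :: l
  | true :: l => false :: inc l

@[simp] theorem length_inc (l : List Bool) : (inc l).length = l.length := by
  fun_induction inc l <;> simp_all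

theorem polyTime_inc : PolyTime inc := by
  let T : Transducer :=
    ⟨Bool, inferInstance, true, fun t b => t && b, fun t b => [t ^^ b], fun _ => []⟩
  have h0 : ∀ l, T.out false l = l := by
    intro l
    induction l with
    | nil => rfl
    | cons b l ih =>
      have : T.out false (b :: l) = [false ^^ b] ++ T.out false l := rfl
      rw [this, ih]
      simp
  have h : ∀ l, T.out true l = inc l := by
    intro l
    fun_induction inc l with
    | case1 => rfl
    | case2 l => exact congrArg (true :: ·) (h0 l)
    | case3 l ih => exact congrArg (false :: ·) ih
  exact (PolyTime.transducer T).of_eq h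

/-- The value of a binary number, least significant bit first. -/
def val : List Bool → ℕ
  | [] => 0
  | b :: l => b.toNat + 2 * val l

theorem val_lt (l : List Bool) : val l < 2 ^ l.length := by
  induction l with
  | nil => simp [val]
  | cons b l ih =>
    have := Bool.toNat_le b
    simp only [val, List.length_cons, pow_succ]
    omega

theorem val_inc (l : List Bool) : (val (inc l)) ≡ val l + 1 [MOD 2 ^ l.length] := by
  fun_induction inc l with
  | case1 => simp [Nat.ModEq, Nat.mod_one]
  | case2 l => simp only [val, Bool.toNat_true, Bool.toNat_false]; rw [show 0 + 2 * val l + 1 =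
      1 + 2 * val l by ring]
  | case3 l ih =>
    have := Nat.ModEq.mul_left' 2 ih
    simp only [val, Bool.toNat_true, Bool.toNat_false, List.length_cons, pow_succ, zero_add]
    rw [mul_comm _ 2, show 1 + 2 * val l + 1 = 2 * (val l + 1) by ring]
    exact this

theorem val_injective : ∀ u v : List Bool, u.length = v.length → val u = val v → u = v := by
  intro u
  induction u with
  | nil => intro v h _; exact (List.length_eq_zero_iff.1 h.symm).symm
  | cons b u ih =>
    intro v h hv
    rcases v with _ | ⟨c, v⟩
    · simp at h
    · simp only [val] at hv
      have hbc : b = c := by cases b <;> cases c <;> simp at hv ⊢ <;> omega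
      subst hbc
      rw [ih v (by simpa using h) (by omega)]

theorem val_iterate_inc (j : ℕ) (l : List Bool) :
    val (inc^[j] l) ≡ val l + j [MOD 2 ^ l.length] := by
  induction j generalizing l with
  | zero => exact Nat.ModEq.refl _
  | succ j ih =>
    rw [Function.iterate_succ_apply]
    have h1 := ih (inc l)
    rw [length_inc] at h1
    have h2 := (val_inc l).add_right j
    rw [show val l + 1 + j = val l + (j + 1) by ring] at h2
    exact h1.trans h2

theorem length_iterate_inc (j : ℕ) (l : List Bool) : (inc^[j] l).length = l.length := by
  induction j generalizing l with
  | zero => rfl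
  | succ j ih => rw [Function.iterate_succ_apply, ih, length_inc]

/-- Distinct small shifts of a point are distinct points. -/
theorem iterate_inc_inj {l : List Bool} {i j : ℕ} (hi : i < 2 ^ l.length) (hj : j < 2 ^ l.length)
    (h : inc^[i] l = inc^[j] l) : i = j := by
  have h1 := (val_iterate_inc i l).symm.trans (h ▸ val_iterate_inc j l)
  exact (Nat.ModEq.add_left_cancel' _ h1).eq_of_lt_of_lt hi hj

/-- Shifts are injective on points. -/
theorem iterate_inc_injective {u v : List Bool} (j : ℕ) (huv : u.length = v.length)
    (h : inc^[j] u = inc^[j] v) : u = v := by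
  have h1 := val_iterate_inc j v
  rw [← huv] at h1
  have h2 := (val_iterate_inc j u).symm.trans (h ▸ h1)
  refine val_injective u v huv ((Nat.ModEq.add_right_cancel' _ h2).eq_of_lt_of_lt (val_lt u) ?_)
  rw [huv]
  exact val_lt v

/-- One step of reading the string that a training set encodes. The state consists of the current
point, the training set, and the bits read so far. -/
def readStep (s : (List Bool × List Bool) × List Bool) : (List Bool × List Bool) × List Bool :=
  ((inc s.1.1, s.1.2), s.2 ++ [!(lookup (s.1.2, inc s.1.1)).isEmpty])

/-- The string encoded by the set of points in the training set with code `z.2`: its `j`-th bit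
tells whether the point that follows the point `z.1` at distance `j + 1` belongs to the set. -/
def readBits (z : List Bool × List Bool) : List Bool :=
  (readStep^[z.2.length] (z, [])).2

theorem polyTime_readBits : PolyTime readBits := by
  have id' : PolyTime fun s : (List Bool × List Bool) × List Bool => s := PolyTime.id
  have hi := polyTime_inc.comp id'.fst.fst
  have hs : PolyTime readStep :=
    (hi.pair id'.fst.snd).pair (id'.snd.append
      ((polyTime_lookup.comp (id'.fst.snd.pair hi)).isEmpty.not.cons (.const [])))
  have h := PolyTime.iterate_of_growth (α := List Bool × List Bool) (count := fun z => z.2)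
    (init := fun z => (z, ([] : List Bool))) (step := readStep) PolyTime.id.snd
    (PolyTime.id.pair (.const [])) hs (fun _ _ => True) (fun _ => trivial)
    (fun _ _ _ => trivial) (fun _ => 1) (.const 1) fun a b _ => by
      simp [readStep]
      omega
  exact h.snd

theorem iterate_readStep (u T r : List Bool) (m : ℕ) :
    readStep^[m] ((u, T), r) = ((inc^[m] u, T),
      r ++ (List.range m).map fun j => !(lookup (T, inc^[j + 1] u)).isEmpty) := by
  induction m with
  | zero => simp
  | succ m ih =>
    rw [Function.iterate_succ_apply', ih, List.range_succ]
    simp only [readStep, ← Function.iterate_succ_apply' inc]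
    simp

theorem readBits_eq (u T : List Bool) :
    readBits (u, T) = (List.range T.length).map fun j => !(lookup (T, inc^[j + 1] u)).isEmpty := by
  rw [readBits, iterate_readStep]
  simp

/-! ### Quantum circuits preserve the norm -/

/-- The squared norm of a state. -/
noncomputable def normSq {m : ℕ} (ψ : (Fin m → Bool) → ℂ) : ℝ := ∑ s, ‖ψ s‖ ^ 2

theorem sum_comp_involutive {S M : Type*} [Fintype S] [AddCommMonoid M] {σ : S → S}
    (hσ : Function.Involutive σ) (f : S → M) : ∑ s, f (σ s) = ∑ s, f s :=
  Equiv.sum_comp hσ.toPerm f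

/-- The bit flip that the gates `X`, `CNOT` and `CCNOT` perform on basis states. -/
theorem involutive_update_xor {m : ℕ} (k : Fin m) (f : (Fin m → Bool) → Bool)
    (hf : ∀ s b, f (Function.update s k b) = f s) :
    Function.Involutive fun s : Fin m → Bool => Function.update s k (s k ^^ f s) := by
  intro s
  simp [hf]

theorem normSq_apply {m : ℕ} (g : QGate m) (ψ : (Fin m → Bool) → ℂ) :
    normSq (g.apply ψ) = normSq ψ := by
  cases g with
  | X i =>
    have h := involutive_update_xor i (fun _ => true) (fun _ _ => rfl)
    refine Eq.trans ?_ (sum_comp_involutive h fun s => ‖ψ s‖ ^ 2)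
    simp [normSq, QGate.apply]
  | H i =>
    have h := involutive_update_xor i (fun _ => true) (fun _ _ => rfl)
    have key : ∀ s : Fin m → Bool,
        ‖(QGate.H i).apply ψ s‖ ^ 2 +
          ‖(QGate.H i).apply ψ (Function.update s i (s i ^^ true))‖ ^ 2 =
        ‖ψ s‖ ^ 2 + ‖ψ (Function.update s i (s i ^^ true))‖ ^ 2 := by
      intro s
      have par : ∀ a b : ℂ, ‖((Real.sqrt 2 : ℝ) : ℂ)⁻¹ * (a + b)‖ ^ 2 +
          ‖((Real.sqrt 2 : ℝ) : ℂ)⁻¹ * (a - b)‖ ^ 2 = ‖a‖ ^ 2 + ‖b‖ ^ 2 := by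
        intro a b
        have h1 := parallelogram_law_with_norm ℝ a b
        have h2 : ‖((Real.sqrt 2 : ℝ) : ℂ)⁻¹‖ ^ 2 = 1 / 2 := by
          rw [norm_inv, Complex.norm_real, Real.norm_of_nonneg (Real.sqrt_nonneg _), inv_pow,
            Real.sq_sqrt (by norm_num)]
          norm_num
        rw [norm_mul, norm_mul, mul_pow, mul_pow, h2]
        nlinarith
      have e : s = Function.update s i (s i) := by simp
      cases hs : s i
      · rw [hs] at e
        have e' : ψ s = ψ (Function.update s i false) := by rw [← e]
        simp only [QGate.apply, hs, Bool.false_xor, Function.update_self, Function.update_idem,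
          if_true, Bool.false_eq_true, if_false]
        rw [e']
        refine Eq.trans ?_ (par (ψ (Function.update s i false)) (ψ (Function.update s i true)))
        simp only [one_mul, neg_mul, sub_eq_add_neg]
      · rw [hs] at e
        have e' : ψ s = ψ (Function.update s i true) := by rw [← e]
        simp only [QGate.apply, hs, Bool.true_xor, Function.update_self, Function.update_idem,
          if_true, Bool.not_true, Bool.false_eq_true, if_false]
        rw [e', add_comm, add_comm (‖ψ (Function.update s i true)‖ ^ 2)]
        refine Eq.trans ?_ (par (ψ (Function.update s i false)) (ψ (Function.update s i true)))
        simp only [one_mul, neg_mul, sub_eq_add_neg]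
    have h1 : 2 * normSq ((QGate.H i).apply ψ) = 2 * normSq ψ := by
      rw [two_mul, two_mul]
      nth_rewrite 2 [normSq]
      rw [← sum_comp_involutive h fun s => ‖(QGate.H i).apply ψ s‖ ^ 2]
      nth_rewrite 3 [normSq]
      rw [← sum_comp_involutive h fun s => ‖ψ s‖ ^ 2]
      rw [normSq, normSq, ← Finset.sum_add_distrib, ← Finset.sum_add_distrib]
      exact Finset.sum_congr rfl fun s _ => key s
    linarith
  | T i =>
    refine Finset.sum_congr rfl fun s _ => ?_
    have : ‖(if s i = true then Complex.exp (Real.pi * Complex.I / 4) else 1 : ℂ)‖ = 1 := by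
      split_ifs
      · rw [show (Real.pi * Complex.I / 4 : ℂ) = ((Real.pi / 4 : ℝ) : ℂ) * Complex.I by
          push_cast; ring]
        exact Complex.norm_exp_ofReal_mul_I _
      · simp
    simp only [QGate.apply]
    rw [norm_mul, this, one_mul]
  | CNOT i j hij =>
    have h := involutive_update_xor j (fun s => s i) (fun s b => by
      simp [Function.update_of_ne hij])
    exact sum_comp_involutive h fun s => ‖ψ s‖ ^ 2
  | CCNOT i j k hij hik hjk =>
    have h := involutive_update_xor k (fun s => s i && s j) (fun s b => by
      simp [Function.update_of_ne hik, Function.update_of_ne hjk])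
    exact sum_comp_involutive h fun s => ‖ψ s‖ ^ 2

theorem normSq_finalState (Q : QCircuit) : normSq Q.finalState = 1 := by
  have : ∀ (gs : List (QGate (Q.ancillas + 1))) (ψ : (Fin (Q.ancillas + 1) → Bool) → ℂ),
      normSq (gs.foldl (fun ψ g => g.apply ψ) ψ) = normSq ψ := by
    intro gs
    induction gs with
    | nil => intro ψ; rfl
    | cons g gs ih => intro ψ; rw [List.foldl_cons, ih, normSq_apply]
  rw [QCircuit.finalState, this, normSq, Finset.sum_eq_single (fun _ => false)]
  · simp
  · intro s _ hs
    simp [Pi.single_eq_of_ne hs]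
  · simp

theorem QCircuit.outputProb_nonneg (Q : QCircuit) (b : Bool) : 0 ≤ Q.outputProb b :=
  Finset.sum_nonneg fun s _ => by split_ifs <;> positivity

theorem QCircuit.outputProb_add (Q : QCircuit) : Q.outputProb true + Q.outputProb false = 1 := by
  rw [← normSq_finalState Q, QCircuit.outputProb, QCircuit.outputProb, ← Finset.sum_add_distrib]
  refine Finset.sum_congr rfl fun s _ => ?_
  cases s 0 <;> simp

/-! ### Circuits on disjoint blocks of qubits -/

/-- The gate `g`, acting on the qubits `e i` in place of `i`. -/
def QGate.map {k m : ℕ} (e : Fin k ↪ Fin m) : QGate k → QGate m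
  | .X i => .X (e i)
  | .H i => .H (e i)
  | .T i => .T (e i)
  | .CNOT i j h => .CNOT (e i) (e j) (e.injective.ne h)
  | .CCNOT i j l h h' h'' =>
    .CCNOT (e i) (e j) (e l) (e.injective.ne h) (e.injective.ne h') (e.injective.ne h'')

/-- A gate that acts on a block of qubits changes only the factor of a product state that belongs
to the block. -/
theorem QGate.apply_map {k m : ℕ} (e : Fin k ↪ Fin m) (g : QGate k) (φ : (Fin k → Bool) → ℂ)
    (χ : (Fin m → Bool) → ℂ) (hχ : ∀ s i b, χ (Function.update s (e i) b) = χ s) :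
    (g.map e).apply (fun s => χ s * φ (s ∘ e)) = fun s => χ s * g.apply φ (s ∘ e) := by
  have hu : ∀ (s : Fin m → Bool) i b,
      Function.update s (e i) b ∘ e = Function.update (s ∘ e) i b :=
    fun s i b => Function.update_comp_eq_of_injective s e.injective i b
  funext s
  cases g <;> simp only [QGate.map, QGate.apply, hχ, hu, Function.comp_apply] <;> ring

theorem foldl_apply_map {k m : ℕ} (e : Fin k ↪ Fin m) (gs : List (QGate k))
    (φ : (Fin k → Bool) → ℂ) (χ : (Fin m → Bool) → ℂ)
    (hχ : ∀ s i b, χ (Function.update s (e i) b) = χ s) :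
    (gs.map (QGate.map e)).foldl (fun ψ g => g.apply ψ) (fun s => χ s * φ (s ∘ e)) =
      fun s => χ s * gs.foldl (fun ψ g => g.apply ψ) φ (s ∘ e) := by
  induction gs generalizing φ with
  | nil => rfl
  | cons g gs ih => rw [List.map_cons, List.foldl_cons, QGate.apply_map e g φ χ hχ, ih]; rfl

/-! ### Majority vote of three quantum circuits -/

section Maj

/-- The majority of three bits, as the sum modulo `2` of their pairwise products. -/
def maj (y : Fin 3 → Bool) : Bool := ((y 0 && y 1) ^^ (y 0 && y 2)) ^^ (y 1 && y 2)

variable (Q : Fin 3 → QCircuit)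

/-- The number of ancillas of the majority vote of three circuits. The qubits of the three circuits
are interleaved, in order that the code of the new circuit arises from their codes by transducers;
therefore some qubits remain unused. -/
def majAncillas : ℕ := 3 * ((Q 0).ancillas + (Q 1).ancillas + (Q 2).ancillas) + 3

theorem ancillas_le_majAncillas (j : Fin 3) : 3 * (Q j).ancillas + 3 ≤ majAncillas Q := by
  unfold majAncillas
  fin_cases j <;> simp <;> omega

/-- The place of qubit `i` of the `j`-th circuit. -/
def majEmb (j : Fin 3) : Fin ((Q j).ancillas + 1) ↪ Fin (majAncillas Q + 1) where
  toFun i := ⟨3 * i + j + 1, by have := ancillas_le_majAncillas Q j; omega⟩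
  inj' i i' h := by
    simp only [Fin.mk.injEq] at h
    exact Fin.ext (by omega)

@[simp] theorem majEmb_val (j : Fin 3) (i : Fin ((Q j).ancillas + 1)) :
    (majEmb Q j i : ℕ) = 3 * i + j + 1 := rfl

theorem majEmb_ne {j j' : Fin 3} (h : j ≠ j') (i : Fin ((Q j).ancillas + 1))
    (i' : Fin ((Q j').ancillas + 1)) : majEmb Q j i ≠ majEmb Q j' i' := by
  intro e
  have e' := congrArg Fin.val e
  simp only [majEmb_val] at e'
  exact h (Fin.ext (by omega))

theorem majEmb_ne_zero (j : Fin 3) (i : Fin ((Q j).ancillas + 1)) : majEmb Q j i ≠ 0 := by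
  intro e
  have := congrArg Fin.val e
  simp at this

/-- The three gates that add the majority of the three output qubits to qubit `0`. -/
def majGates : List (QGate (majAncillas Q + 1)) :=
  [.CCNOT (majEmb Q 0 0) (majEmb Q 1 0) 0 (majEmb_ne Q (by decide) _ _) (majEmb_ne_zero Q _ _)
      (majEmb_ne_zero Q _ _),
    .CCNOT (majEmb Q 0 0) (majEmb Q 2 0) 0 (majEmb_ne Q (by decide) _ _) (majEmb_ne_zero Q _ _)
      (majEmb_ne_zero Q _ _),
    .CCNOT (majEmb Q 1 0) (majEmb Q 2 0) 0 (majEmb_ne Q (by decide) _ _) (majEmb_ne_zero Q _ _)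
      (majEmb_ne_zero Q _ _)]

/-- The circuit that runs three circuits on separate qubits and outputs the majority of their
outputs. -/
abbrev majCircuit : QCircuit where
  ancillas := majAncillas Q
  gates := (Q 0).gates.map (QGate.map (majEmb Q 0)) ++ (Q 1).gates.map (QGate.map (majEmb Q 1)) ++
    (Q 2).gates.map (QGate.map (majEmb Q 2)) ++ majGates Q

open Classical in
/-- The indicator function of the basis states in which all qubits outside the three blocks
are `0`. -/
noncomputable def restZero (s : Fin (majAncillas Q + 1) → Bool) : ℂ :=
  if ∀ q, (∀ j i, majEmb Q j i ≠ q) → s q = false then 1 else 0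

theorem restZero_update (j : Fin 3) (i : Fin ((Q j).ancillas + 1))
    (s : Fin (majAncillas Q + 1) → Bool) (b : Bool) :
    restZero Q (Function.update s (majEmb Q j i) b) = restZero Q s := by
  unfold restZero
  congr 1
  refine propext (forall_congr' fun q => forall_congr' fun hq => ?_)
  rw [Function.update_of_ne (hq j i).symm]

theorem update_comp_majEmb {j j' : Fin 3} (h : j ≠ j') (i : Fin ((Q j).ancillas + 1))
    (s : Fin (majAncillas Q + 1) → Bool) (b : Bool) :
    Function.update s (majEmb Q j i) b ∘ majEmb Q j' = s ∘ majEmb Q j' := by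
  funext i'
  exact Function.update_of_ne (majEmb_ne Q h i i').symm _ _

/-- The state of the three blocks before the majority vote. -/
noncomputable def blockState (s : Fin (majAncillas Q + 1) → Bool) : ℂ :=
  restZero Q s * ∏ j, (Q j).finalState (s ∘ majEmb Q j)

/-- The basis state that is given on the three blocks and `0` elsewhere. -/
noncomputable def glue (t : ∀ j, Fin ((Q j).ancillas + 1) → Bool) :
    Fin (majAncillas Q + 1) → Bool :=
  Function.extend (fun p : Σ j, Fin ((Q j).ancillas + 1) => majEmb Q p.1 p.2)
    (fun p => t p.1 p.2) fun _ => false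

theorem glue_injective_aux :
    Function.Injective fun p : Σ j, Fin ((Q j).ancillas + 1) => majEmb Q p.1 p.2 := by
  rintro ⟨j, i⟩ ⟨j', i'⟩ h
  by_cases hj : j = j'
  · subst hj
    simpa using h
  · exact absurd h (majEmb_ne Q hj i i')

theorem glue_comp (t : ∀ j, Fin ((Q j).ancillas + 1) → Bool) (j : Fin 3) :
    glue Q t ∘ majEmb Q j = t j := by
  funext i
  exact (glue_injective_aux Q).extend_apply (fun p => t p.1 p.2) (fun _ => false) ⟨j, i⟩

theorem glue_of_rest (t : ∀ j, Fin ((Q j).ancillas + 1) → Bool) (q : Fin (majAncillas Q + 1))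
    (hq : ∀ j i, majEmb Q j i ≠ q) : glue Q t q = false :=
  Function.extend_apply' _ _ _ (by rintro ⟨⟨j, i⟩, h⟩; exact hq j i h)

theorem restZero_glue (t : ∀ j, Fin ((Q j).ancillas + 1) → Bool) : restZero Q (glue Q t) = 1 :=
  if_pos fun q hq => glue_of_rest Q t q hq

theorem glue_injective : Function.Injective (glue Q) := by
  intro t t' h
  funext j
  rw [← glue_comp Q t, ← glue_comp Q t', h]

theorem restZero_eq_zero (s : Fin (majAncillas Q + 1) → Bool) (hs : s ∉ Set.range (glue Q)) :
    restZero Q s = 0 := by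
  refine if_neg fun h => hs ⟨fun j => s ∘ majEmb Q j, ?_⟩
  funext q
  by_cases hq : ∀ j i, majEmb Q j i ≠ q
  · rw [glue_of_rest Q _ q hq, h q hq]
  · push Not at hq
    obtain ⟨j, i, rfl⟩ := hq
    exact congrFun (glue_comp Q _ j) i

/-- The basis state `|0…0⟩`. -/
noncomputable def zeroState {m : ℕ} : (Fin m → Bool) → ℂ := Pi.single (fun _ => false) 1

theorem zeroState_of_ne {m : ℕ} {s : Fin m → Bool} (hs : s ≠ fun _ => false) : zeroState s = 0 :=
  Pi.single_eq_of_ne (M := fun _ => ℂ) hs 1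

theorem foldl_blocks :
    ((Q 0).gates.map (QGate.map (majEmb Q 0)) ++ (Q 1).gates.map (QGate.map (majEmb Q 1)) ++
      (Q 2).gates.map (QGate.map (majEmb Q 2))).foldl (fun ψ g => g.apply ψ)
        zeroState = blockState Q := by
  have h0 : zeroState =
      fun s => (restZero Q s * zeroState (s ∘ majEmb Q 1) *
        zeroState (s ∘ majEmb Q 2)) *
        zeroState (s ∘ majEmb Q 0) := by
    funext s
    by_cases hs : s = fun _ => false
    · subst hs
      have h1 : restZero Q (fun _ => false) = 1 := if_pos fun _ _ => rfl
      have h2 : ∀ j, (fun _ => false : Fin (majAncillas Q + 1) → Bool) ∘ majEmb Q j =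
        fun _ => false := fun _ => rfl
      simp [h1, h2, zeroState]
    · rw [zeroState_of_ne hs]
      by_cases hr : s ∈ Set.range (glue Q)
      · obtain ⟨t, rfl⟩ := hr
        simp only [glue_comp]
        have : ∃ j, t j ≠ fun _ => false := by
          by_contra hcon
          push Not at hcon
          refine hs ?_
          funext q
          by_cases hq : ∀ j i, majEmb Q j i ≠ q
          · exact glue_of_rest Q _ q hq
          · push Not at hq
            obtain ⟨j, i, rfl⟩ := hq
            rw [show glue Q t (majEmb Q j i) = t j i from congrFun (glue_comp Q t j) i, hcon]
        obtain ⟨j, hj⟩ := this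
        fin_cases j
        · have hj' : t 0 ≠ fun _ => false := hj
          rw [zeroState_of_ne hj']; ring
        · have hj' : t 1 ≠ fun _ => false := hj
          rw [zeroState_of_ne hj']; ring
        · have hj' : t 2 ≠ fun _ => false := hj
          rw [zeroState_of_ne hj']; ring
      · rw [restZero_eq_zero Q s hr]; ring
  rw [List.foldl_append, List.foldl_append, h0, foldl_apply_map]
  · have h1 : (fun s => (restZero Q s * zeroState (s ∘ majEmb Q 1) *
        zeroState (s ∘ majEmb Q 2)) *
        (Q 0).finalState (s ∘ majEmb Q 0)) =
      fun s => (restZero Q s * (Q 0).finalState (s ∘ majEmb Q 0) *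
        zeroState (s ∘ majEmb Q 2)) *
        zeroState (s ∘ majEmb Q 1) := by
      funext s; ring
    change (List.map (QGate.map (majEmb Q 2)) (Q 2).gates).foldl _
      ((List.map (QGate.map (majEmb Q 1)) (Q 1).gates).foldl _ (fun s => (restZero Q s *
        zeroState (s ∘ majEmb Q 1) *
        zeroState (s ∘ majEmb Q 2)) *
        (Q 0).finalState (s ∘ majEmb Q 0))) = _
    rw [h1, foldl_apply_map]
    · have h2 : (fun s => (restZero Q s * (Q 0).finalState (s ∘ majEmb Q 0) *
          zeroState (s ∘ majEmb Q 2)) *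
          (Q 1).finalState (s ∘ majEmb Q 1)) =
        fun s => (restZero Q s * (Q 0).finalState (s ∘ majEmb Q 0) *
          (Q 1).finalState (s ∘ majEmb Q 1)) *
          zeroState (s ∘ majEmb Q 2) := by
        funext s; ring
      change (List.map (QGate.map (majEmb Q 2)) (Q 2).gates).foldl _
        (fun s => (restZero Q s * (Q 0).finalState (s ∘ majEmb Q 0) *
          zeroState (s ∘ majEmb Q 2)) *
          (Q 1).finalState (s ∘ majEmb Q 1)) = _
      rw [h2, foldl_apply_map]
      · funext s
        simp only [blockState, Fin.prod_univ_three]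
        change _ * (Q 2).finalState _ = _
        ring
      · intro s i b
        rw [restZero_update, update_comp_majEmb Q (by decide), update_comp_majEmb Q (by decide)]
    · intro s i b
      rw [restZero_update, update_comp_majEmb Q (by decide), update_comp_majEmb Q (by decide)]
  · intro s i b
    rw [restZero_update, update_comp_majEmb Q (by decide), update_comp_majEmb Q (by decide)]

/-- The basis permutation performed by `majGates`. -/
def majFlip (s : Fin (majAncillas Q + 1) → Bool) : Fin (majAncillas Q + 1) → Bool :=
  Function.update s 0 (s 0 ^^ maj fun j => s (majEmb Q j 0))

theorem majFlip_involutive : Function.Involutive (majFlip Q) :=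
  involutive_update_xor 0 (fun s => maj fun j => s (majEmb Q j 0)) fun s b => by
    simp [Function.update_of_ne (majEmb_ne_zero Q _ _)]

theorem majCircuit_finalState :
    (majCircuit Q).finalState = fun s => blockState Q (majFlip Q s) := by
  have h : (majCircuit Q).finalState =
      (majGates Q).foldl (fun ψ g => g.apply ψ) (blockState Q) := by
    rw [← foldl_blocks, ← List.foldl_append]
    rfl
  rw [h]
  funext s
  simp only [majGates, List.foldl_cons, List.foldl_nil, QGate.apply, majFlip]
  simp only [Function.update_of_ne (majEmb_ne_zero Q _ _), Function.update_self,
    Function.update_idem, maj]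
  congr 2
  cases s 0 <;> cases s (majEmb Q 0 0) <;> cases s (majEmb Q 1 0) <;>
    cases s (majEmb Q 2 0) <;> rfl

theorem majCircuit_outputProb (b : Bool) : (majCircuit Q).outputProb b =
    ∑ y : Fin 3 → Bool, if maj y = b then ∏ j, (Q j).outputProb (y j) else 0 := by
  have h1 : (majCircuit Q).outputProb b = ∑ s : Fin (majAncillas Q + 1) → Bool,
      if (maj fun j => s (majEmb Q j 0)) = b then ‖blockState Q s‖ ^ 2 else 0 := by
    rw [QCircuit.outputProb, majCircuit_finalState]
    refine (sum_comp_involutive (majFlip_involutive Q) fun s =>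
      if s 0 = b then ‖blockState Q (majFlip Q s)‖ ^ 2 else 0).symm.trans ?_
    refine Finset.sum_congr rfl fun s _ => ?_
    rw [majFlip_involutive Q s]
    by_cases hs : s ∈ Set.range (glue Q)
    · obtain ⟨t, rfl⟩ := hs
      have : glue Q t 0 = false := glue_of_rest Q t 0 fun j i => majEmb_ne_zero Q j i
      simp [majFlip, this]
    · simp [blockState, restZero_eq_zero Q s hs]
  have h2 : (majCircuit Q).outputProb b = ∑ t : ∀ j, Fin ((Q j).ancillas + 1) → Bool,
      if (maj fun j => t j 0) = b then ∏ j, ‖(Q j).finalState (t j)‖ ^ 2 else 0 := by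
    rw [h1]
    refine (Fintype.sum_of_injective (glue Q) (glue_injective Q) _ _ ?_ ?_).symm
    · intro s hs
      simp [blockState, restZero_eq_zero Q s hs]
    · intro t
      have : ∀ j, glue Q t (majEmb Q j 0) = t j 0 := fun j => congrFun (glue_comp Q t j) 0
      simp only [this, blockState, restZero_glue, glue_comp, one_mul, norm_prod,
        Finset.prod_pow]
  rw [h2]
  have h3 : ∀ y : Fin 3 → Bool, ∏ j, (Q j).outputProb (y j) =
      ∑ t : ∀ j, Fin ((Q j).ancillas + 1) → Bool,
        if (fun j => t j 0) = y then ∏ j, ‖(Q j).finalState (t j)‖ ^ 2 else 0 := by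
    intro y
    simp only [QCircuit.outputProb, Finset.prod_univ_sum, Fintype.piFinset_univ]
    refine Finset.sum_congr rfl fun t _ => ?_
    by_cases h : (fun j => t j 0) = y
    · subst h
      simp
    · rw [if_neg h]
      obtain ⟨j, hj⟩ := Function.ne_iff.1 h
      exact Finset.prod_eq_zero (Finset.mem_univ j) (if_neg hj)
  have h4 : ∀ y : Fin 3 → Bool, (if maj y = b then ∏ j, (Q j).outputProb (y j) else 0) =
      ∑ t : ∀ j, Fin ((Q j).ancillas + 1) → Bool, if (fun j => t j 0) = y then
        (if (maj fun j => t j 0) = b then ∏ j, ‖(Q j).finalState (t j)‖ ^ 2 else 0) else 0 := by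
    intro y
    rw [h3]
    by_cases hy : maj y = b
    · rw [if_pos hy]
      refine Finset.sum_congr rfl fun t _ => ?_
      by_cases h : (fun j => t j 0) = y
      · rw [if_pos h, if_pos h, h, if_pos hy]
      · rw [if_neg h, if_neg h]
    · rw [if_neg hy]
      refine (Finset.sum_eq_zero fun t _ => ?_).symm
      by_cases h : (fun j => t j 0) = y
      · rw [if_pos h, h, if_neg hy]
      · rw [if_neg h]
  simp only [h4]
  rw [Finset.sum_comm]
  simp

end Maj

/-! ### The majority vote in polynomial time -/

/-- Triples the number of ancillas: reads the code of a circuit and emits three bits for each of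
its ancillas. -/
def ancillaTransducer : Transducer where
  State := Bool
  fin := inferInstance
  start := true
  next t b := t && b
  emit t b := if t && b then [true, true, true] else []
  last _ := []

theorem ancillaTransducer_run (Q : QCircuit) :
    ancillaTransducer.run Q.code = List.replicate (3 * Q.ancillas) true := by
  have h0 : ∀ l, ancillaTransducer.out false l = [] := by
    intro l
    induction l with
    | nil => rfl
    | cons b l ih => exact ih
  have h : ∀ (a : ℕ) (l : List Bool),
      ancillaTransducer.out true (List.replicate a true ++ false :: l) =
        List.replicate (3 * a) true := by
    intro a l
    induction a with
    | zero => exact h0 l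
    | succ a ih =>
      have : ancillaTransducer.out true (List.replicate (a + 1) true ++ false :: l) =
        [true, true, true] ++ ancillaTransducer.out true (List.replicate a true ++ false :: l) :=
      rfl
      rw [this, ih, show 3 * (a + 1) = 3 + 3 * a by ring, List.replicate_add]
      rfl
  have := h Q.ancillas (Q.gates.flatMap QGate.code)
  simpa [QCircuit.code, unaryCode, Transducer.run, ancillaTransducer] using this

/-- Moves the gates of a circuit to the `j`-th block of qubits: reads the code of the circuit and
emits the codes of its gates, with `3 * i + j + 1` in place of every qubit `i`. State `none` skips
the number of ancillas, state `inl c` has read `c` bits of a tag, and in state `inr r` there remain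
`r` qubits after the one that is being read. -/
def gateTransducer (j : ℕ) : Transducer where
  State := Option (Fin 5 ⊕ Fin 3)
  fin := inferInstance
  start := none
  next t b := match t, b with
    | none, true => none
    | none, false => some (.inl 0)
    | some (.inl c), true => some (.inl (c + 1))
    | some (.inl c), false => some (.inr (![0, 0, 0, 1, 2] c))
    | some (.inr r), true => some (.inr r)
    | some (.inr r), false => if r = 0 then some (.inl 0) else some (.inr (r - 1))
  emit t b := match t, b with
    | none, _ => []
    | some (.inl _), true => [true]
    | some (.inl _), false => false :: List.replicate (j + 1) true
    | some (.inr _), true => [true, true, true]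
    | some (.inr r), false => if r = 0 then [false] else false :: List.replicate (j + 1) true
  last _ := []

theorem gateTransducer_index (j : ℕ) (r : Fin 3) (i : ℕ) (l : List Bool) :
    List.replicate (j + 1) true ++ (gateTransducer j).out (some (.inr r)) (unaryCode i ++ l) =
      unaryCode (3 * i + j + 1) ++ (if r = 0 then (gateTransducer j).out (some (.inl 0)) l
        else List.replicate (j + 1) true ++ (gateTransducer j).out (some (.inr (r - 1))) l) := by
  have h : ∀ i, (gateTransducer j).out (some (.inr r)) (unaryCode i ++ l) =
      List.replicate (3 * i) true ++ (gateTransducer j).out (some (.inr r)) (false :: l) := by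
    intro i
    induction i with
    | zero => rfl
    | succ i ih =>
      have : (gateTransducer j).out (some (.inr r)) (unaryCode (i + 1) ++ l) =
        [true, true, true] ++ (gateTransducer j).out (some (.inr r)) (unaryCode i ++ l) := rfl
      rw [this, ih, show 3 * (i + 1) = 3 + 3 * i by ring, List.replicate_add]
      rfl
  rw [h, ← List.append_assoc, ← List.replicate_add, show j + 1 + 3 * i = 3 * i + j + 1 by ring]
  by_cases hr : r = 0
  · subst hr
    simp [Transducer.out, gateTransducer, unaryCode]
  · simp [Transducer.out, gateTransducer, unaryCode, hr]

theorem gateTransducer_gate (Q : Fin 3 → QCircuit) (j : Fin 3) (g : QGate ((Q j).ancillas + 1))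
    (l : List Bool) :
    (gateTransducer j).out (some (.inl 0)) (g.code ++ l) =
      (g.map (majEmb Q j)).code ++ (gateTransducer j).out (some (.inl 0)) l := by
  have tag : ∀ (c : Fin 5) (l : List Bool),
      (gateTransducer j).out (some (.inl 0)) (unaryCode c ++ l) =
      unaryCode c ++ (List.replicate (j + 1) true ++
        (gateTransducer j).out (some (.inr (![0, 0, 0, 1, 2] c))) l) := by
    intro c l
    fin_cases c <;> simp [unaryCode, Transducer.out, gateTransducer, List.replicate]
  cases g with
  | X i =>
    simp only [QGate.code, QGate.map, List.append_assoc]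
    refine (tag 0 _).trans (congrArg _ ?_)
    exact gateTransducer_index j 0 i l
  | H i =>
    simp only [QGate.code, QGate.map, List.append_assoc]
    refine (tag 1 _).trans (congrArg _ ?_)
    exact gateTransducer_index j 0 i l
  | T i =>
    simp only [QGate.code, QGate.map, List.append_assoc]
    refine (tag 2 _).trans (congrArg _ ?_)
    exact gateTransducer_index j 0 i l
  | CNOT i k _ =>
    simp only [QGate.code, QGate.map, List.append_assoc]
    refine (tag 3 _).trans (congrArg _ ?_)
    refine (gateTransducer_index j 1 i _).trans (congrArg _ ?_)
    exact gateTransducer_index j 0 k l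
  | CCNOT i k m _ _ _ =>
    simp only [QGate.code, QGate.map, List.append_assoc]
    refine (tag 4 _).trans (congrArg _ ?_)
    refine (gateTransducer_index j 2 i _).trans (congrArg _ ?_)
    refine (gateTransducer_index j 1 k _).trans (congrArg _ ?_)
    exact gateTransducer_index j 0 m l

theorem gateTransducer_run (Q : Fin 3 → QCircuit) (j : Fin 3) :
    (gateTransducer j).run (Q j).code =
      ((Q j).gates.map (QGate.map (majEmb Q j))).flatMap QGate.code := by
  have h : ∀ gs : List (QGate ((Q j).ancillas + 1)),
      (gateTransducer j).out (some (.inl 0)) (gs.flatMap QGate.code) =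
        (gs.map (QGate.map (majEmb Q j))).flatMap QGate.code := by
    intro gs
    induction gs with
    | nil => rfl
    | cons g gs ih =>
      rw [List.flatMap_cons, gateTransducer_gate, ih, List.map_cons, List.flatMap_cons]
  have h' : ∀ (a : ℕ) (l : List Bool), (gateTransducer j).out none (unaryCode a ++ l) =
      (gateTransducer j).out (some (.inl 0)) l := by
    intro a l
    induction a with
    | zero => rfl
    | succ a ih => exact ih
  exact (h' _ _).trans (h _)

/-- The code of the gates of `majGates`. -/
theorem majGates_code (Q : Fin 3 → QCircuit) : (majGates Q).flatMap QGate.code =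
    (unaryCode 4 ++ unaryCode 1 ++ unaryCode 2 ++ unaryCode 0) ++
    (unaryCode 4 ++ unaryCode 1 ++ unaryCode 3 ++ unaryCode 0) ++
    (unaryCode 4 ++ unaryCode 2 ++ unaryCode 3 ++ unaryCode 0) := by
  simp [majGates, QGate.code, majEmb]

theorem polyTime_majCircuit {α : Type} [Enc α] {Q : α → Fin 3 → QCircuit}
    (hQ : ∀ j, PolyTime fun a => Q a j) : PolyTime fun a => majCircuit (Q a) := by
  have hc : ∀ j, PolyTime fun a => (Q a j).code := fun j => (hQ j).recode fun _ => rfl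
  have ha := fun j => (PolyTime.transducer ancillaTransducer).comp (hc j)
  have hg := fun j : Fin 3 => (PolyTime.transducer (gateTransducer j)).comp (hc j)
  refine (((((((ha 0).append (ha 1)).append (ha 2)).append (.const (unaryCode 3))).append
    (hg 0)).append (hg 1)).append (hg 2) |>.append (.const (
    (unaryCode 4 ++ unaryCode 1 ++ unaryCode 2 ++ unaryCode 0) ++
    (unaryCode 4 ++ unaryCode 1 ++ unaryCode 3 ++ unaryCode 0) ++
    (unaryCode 4 ++ unaryCode 2 ++ unaryCode 3 ++ unaryCode 0)))).recode fun a => ?_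
  have e : unaryCode (majAncillas (Q a)) = List.replicate (3 * (Q a 0).ancillas) true ++
      List.replicate (3 * (Q a 1).ancillas) true ++ List.replicate (3 * (Q a 2).ancillas) true ++
      unaryCode 3 := by
    simp only [unaryCode, majAncillas, ← List.append_assoc, List.replicate_append_replicate]
    congr 2
    ring
  have h : enc (majCircuit (Q a)) = unaryCode (majAncillas (Q a)) ++
      ((Q a 0).gates.map (QGate.map (majEmb (Q a) 0)) ++
        (Q a 1).gates.map (QGate.map (majEmb (Q a) 1)) ++
        (Q a 2).gates.map (QGate.map (majEmb (Q a) 2)) ++ majGates (Q a)).flatMap QGate.code := rfl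
  rw [h, List.flatMap_append, List.flatMap_append, List.flatMap_append, majGates_code,
    ← gateTransducer_run, ← gateTransducer_run, ← gateTransducer_run, e]
  simp only [ancillaTransducer_run, enc_list, List.append_assoc]

/-! ### Splitting training sets -/

/-- Every third element of a list, where the first element has number `k` modulo `3` and those with
number `j` are kept. -/
def third {X : Type} (j : Fin 3) : Fin 3 → List X → List X
  | _, [] => []
  | k, a :: l => if k = j then a :: third j (k + 1) l else third j (k + 1) l

theorem third_ofFn {X : Type} (j : Fin 3) {N : ℕ} (f : Fin (N * 3) → X) :
    third j 0 (List.ofFn f) = List.ofFn fun i : Fin N => f (finProdFinEquiv (i, j)) := by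
  induction N with
  | zero => rfl
  | succ N ih =>
    have h0 : List.ofFn f = f ⟨0, by omega⟩ :: f ⟨1, by omega⟩ :: f ⟨2, by omega⟩ ::
        List.ofFn fun i : Fin (N * 3) => f ⟨i + 3, by omega⟩ := by
      have e : ∀ g : Fin (N * 3 + 3) → X,
          List.ofFn g = g ⟨0, by omega⟩ :: g ⟨1, by omega⟩ :: g ⟨2, by omega⟩ ::
            List.ofFn fun i : Fin (N * 3) => g ⟨i + 3, by omega⟩ := by
        intro g
        rw [List.ofFn_succ, List.ofFn_succ, List.ofFn_succ]
        rfl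
      exact (List.ofFn_congr (Nat.succ_mul N 3) f).trans (e _)
    have h2 : third j 0 (List.ofFn f) = f (finProdFinEquiv (0, j)) ::
        third j 0 (List.ofFn fun i : Fin (N * 3) => f ⟨i + 3, by omega⟩) := by
      rw [h0]
      fin_cases j
      · simp [third]; rfl
      · simp [third]; rfl
      · simp [third]; rfl
    rw [h2, List.ofFn_succ, ih]
    congr 2

/-- Keeps, in the code of a point and a training set, the point and every third element of the
training set. The first component of a state is the number modulo `3` of the current element of the
training set, or `none` in the point; the second component is `0` before a flag, `1` before a
payload bit, and `2` before a label. -/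
def splitTransducer (j : Fin 3) : Transducer where
  State := Option (Fin 3) × Fin 3
  fin := inferInstance
  start := (none, 0)
  next t b :=
    if t.2 = 0 then (if b then (t.1, 1) else match t.1 with
      | none => (some 0, 0)
      | some k => (some k, 2))
    else if t.2 = 1 then (t.1, 0)
    else (t.1.map (· + 1), 0)
  emit t b := if t.1 = none ∨ t.1 = some j then [b] else []
  last _ := []

/-- The input of a learner, with every third element of the training set only. -/
def split (j : Fin 3) (w : List Bool) : List Bool := (splitTransducer j).run w

theorem polyTime_split (j : Fin 3) : PolyTime (split j) := PolyTime.transducer _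

theorem splitTransducer_pairCode (j : Fin 3) (p : Option (Fin 3)) (u v : List Bool) :
    (splitTransducer j).out (p, 0) (pairCode u v) = if p = none ∨ p = some j then
      pairCode u ((splitTransducer j).out ((splitTransducer j).next (p, 0) false) v)
      else (splitTransducer j).out ((splitTransducer j).next (p, 0) false) v := by
  induction u with
  | nil =>
    by_cases h : p = none ∨ p = some j <;> simp [pairCode, Transducer.out, splitTransducer, h]
  | cons b u ih =>
    have e : (splitTransducer j).out (p, 0) (pairCode (b :: u) v) =
        (splitTransducer j).emit (p, 0) true ++ ((splitTransducer j).emit (p, 1) b ++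
          (splitTransducer j).out (p, 0) (pairCode u v)) := rfl
    rw [e, ih]
    by_cases h : p = none ∨ p = some j <;> simp [splitTransducer, h, pairCode]

theorem splitTransducer_trainingCode {n : ℕ} (j k : Fin 3) (T : List ((Fin n → Bool) × Bool)) :
    (splitTransducer j).out (some k, 0) (trainingCode T) = trainingCode (third j k T) := by
  induction T generalizing k with
  | nil => rfl
  | cons a T ih =>
    obtain ⟨x, y⟩ := a
    rw [trainingCode_cons, splitTransducer_pairCode]
    have e : (splitTransducer j).out ((splitTransducer j).next (some k, 0) false)
        (y :: trainingCode T) = (splitTransducer j).emit (some k, 2) y ++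
          (splitTransducer j).out (some (k + 1), 0) (trainingCode T) := rfl
    rw [e, ih]
    by_cases h : k = j <;> simp [splitTransducer, third, h, trainingCode_cons]

theorem split_learnerInput {n N : ℕ} (j : Fin 3) (x : Fin n → Bool) (c : (Fin n → Bool) → Bool)
    (xs : Fin (N * 3) → (Fin n → Bool)) :
    split j (learnerInput x (trainingSet c xs)) =
      learnerInput x (trainingSet c fun i => xs (finProdFinEquiv (i, j))) := by
  rw [split, Transducer.run]
  refine (splitTransducer_pairCode j none _ _).trans ?_
  have := splitTransducer_trainingCode j 0 (trainingSet c xs)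
  rw [if_pos (Or.inl rfl)]
  refine congrArg (pairCode (bitString x)) (this.trans ?_)
  rw [trainingSet, third_ofFn]
  rfl

/-! ### Amplification of quantum learners -/

/-- The majority vote of a quantum algorithm over three parts of the training set. -/
noncomputable def QuantumAlgorithm.amplify (A : QuantumAlgorithm) : QuantumAlgorithm where
  circuit w := majCircuit fun j => A.circuit (split j w)
  polyTime := by
    have hA : PolyTime A.circuit := A.polyTime
    exact polyTime_majCircuit (Q := fun w j => A.circuit (split j w)) fun j =>
      hA.comp (polyTime_split j)

theorem PMF.sum_toReal {X : Type*} [Fintype X] (μ : PMF X) : ∑ x, (μ x).toReal = 1 := by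
  rw [← ENNReal.toReal_sum fun x _ => μ.apply_ne_top x,
    ← tsum_fintype (L := SummationFilter.unconditional X), μ.tsum_coe]
  rfl

/-- The probability that an algorithm outputs `b` on `x` and a random training set. -/
noncomputable def outputProbAvg (P : List Bool → Bool → ℝ) {n : ℕ} (N : ℕ)
    (μ : PMF (Fin n → Bool)) (c : (Fin n → Bool) → Bool) (x : Fin n → Bool) (b : Bool) : ℝ :=
  ∑ xs : Fin N → (Fin n → Bool),
    (∏ i, (μ (xs i)).toReal) * P (learnerInput x (trainingSet c xs)) b

theorem sum_prod_toReal {X : Type} [Fintype X] (μ : PMF X) (N : ℕ) :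
    ∑ xs : Fin N → X, ∏ i, (μ (xs i)).toReal = 1 := by
  classical
  rw [← Fintype.sum_pow (fun x => (μ x).toReal) N, PMF.sum_toReal, one_pow]

theorem outputProbAvg_add {P : List Bool → Bool → ℝ} (hP : ∀ w, P w true + P w false = 1) {n : ℕ}
    (N : ℕ) (μ : PMF (Fin n → Bool)) (c : (Fin n → Bool) → Bool) (x : Fin n → Bool) :
    outputProbAvg P N μ c x true + outputProbAvg P N μ c x false = 1 := by
  rw [outputProbAvg, outputProbAvg, ← Finset.sum_add_distrib]
  simp only [← mul_add, hP, mul_one]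
  exact sum_prod_toReal μ N

theorem outputProbAvg_amplify (A : QuantumAlgorithm) {n : ℕ} (N : ℕ) (μ : PMF (Fin n → Bool))
    (c : (Fin n → Bool) → Bool) (x : Fin n → Bool) (b : Bool) :
    outputProbAvg A.amplify.outputProb (N * 3) μ c x b =
      ∑ y : Fin 3 → Bool, if maj y = b then ∏ j, outputProbAvg A.outputProb N μ c x (y j)
        else 0 := by
  let e : (Fin 3 → Fin N → (Fin n → Bool)) ≃ (Fin (N * 3) → (Fin n → Bool)) :=
    ((Equiv.curry (Fin 3) (Fin N) (Fin n → Bool)).symm).trans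
      ((Equiv.prodComm (Fin 3) (Fin N)).trans finProdFinEquiv |>.arrowCongr (Equiv.refl _))
  have he : ∀ ys j i, e ys (finProdFinEquiv (i, j)) = ys j i := by
    intro ys j i
    simp [e, Equiv.arrowCongr]
  have hprod : ∀ ys, ∏ i, (μ (e ys i)).toReal = ∏ j, ∏ i, (μ (ys j i)).toReal := by
    intro ys
    rw [← Equiv.prod_comp finProdFinEquiv, Fintype.prod_prod_type, Finset.prod_comm]
    simp only [he]
  rw [outputProbAvg, ← Equiv.sum_comp e]
  have h1 : ∀ ys, A.amplify.outputProb (learnerInput x (trainingSet c (e ys))) b =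
      ∑ y : Fin 3 → Bool, if maj y = b then
        ∏ j, A.outputProb (learnerInput x (trainingSet c (ys j))) (y j) else 0 := by
    intro ys
    refine (majCircuit_outputProb _ b).trans ?_
    refine Finset.sum_congr rfl fun y _ => ?_
    simp only [split_learnerInput, he]
    rfl
  simp only [h1, hprod, Finset.mul_sum]
  rw [Finset.sum_comm]
  refine Finset.sum_congr rfl fun y _ => ?_
  by_cases hy : maj y = b
  · simp only [if_pos hy, outputProbAvg, Finset.prod_univ_sum, Fintype.piFinset_univ,
      Finset.prod_mul_distrib]
  · simp [hy]

theorem QuantumAlgorithm.outputProb_add (A : QuantumAlgorithm) (w : List Bool) :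
    A.outputProb w true + A.outputProb w false = 1 :=
  (A.circuit w).outputProb_add

theorem QuantumAlgorithm.outputProb_nonneg (A : QuantumAlgorithm) (w : List Bool) (b : Bool) :
    0 ≤ A.outputProb w b :=
  (A.circuit w).outputProb_nonneg b

theorem outputProbAvg_nonneg (A : QuantumAlgorithm) {n : ℕ} (N : ℕ) (μ : PMF (Fin n → Bool))
    (c : (Fin n → Bool) → Bool) (x : Fin n → Bool) (b : Bool) :
    0 ≤ outputProbAvg A.outputProb N μ c x b :=
  Finset.sum_nonneg fun _ _ => mul_nonneg (Finset.prod_nonneg fun _ _ => ENNReal.toReal_nonneg)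
    (A.outputProb_nonneg _ _)

theorem sum_maj (p : Bool → ℝ) (hp : p true + p false = 1) (b : Bool) :
    ∑ y : Fin 3 → Bool, (if maj y = b then ∏ j, p (y j) else 0) =
      3 * p b ^ 2 - 2 * p b ^ 3 := by
  have h : ∀ f : (Fin 3 → Bool) → ℝ, ∑ y, f y = ∑ a, ∑ b, ∑ c, f ![a, b, c] := by
    intro f
    rw [← (Fin.consEquiv fun _ : Fin 3 => Bool).sum_comp, Fintype.sum_prod_type]
    refine Finset.sum_congr rfl fun a _ => ?_
    rw [← (Fin.consEquiv fun _ : Fin 2 => Bool).sum_comp, Fintype.sum_prod_type]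
    refine Finset.sum_congr rfl fun b _ => ?_
    rw [← (Fin.consEquiv fun _ : Fin 1 => Bool).sum_comp, Fintype.sum_prod_type]
    refine Finset.sum_congr rfl fun c _ => ?_
    rw [Fintype.sum_unique]
    refine congrArg f ?_
    funext i
    fin_cases i <;> rfl
  rw [h]
  have hf : p false = 1 - p true := by linarith
  cases b <;> simp [maj, Fin.prod_univ_three, hf] <;> ring

/-- The majority of three runs raises the success probability `s` to `3 s ^ 2 - 2 s ^ 3`. -/
theorem successProb_amplify (A : QuantumAlgorithm) {n : ℕ} (N : ℕ) (μ : PMF (Fin n → Bool))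
    (c : (Fin n → Bool) → Bool) (x : Fin n → Bool) :
    successProb A.amplify.outputProb (N * 3) μ c x =
      3 * successProb A.outputProb N μ c x ^ 2 - 2 * successProb A.outputProb N μ c x ^ 3 := by
  have h := outputProbAvg_amplify A N μ c x (c x)
  rw [sum_maj _ (outputProbAvg_add A.outputProb_add N μ c x)] at h
  exact h

theorem successProb_mem (A : QuantumAlgorithm) {n : ℕ} (N : ℕ) (μ : PMF (Fin n → Bool))
    (c : (Fin n → Bool) → Bool) (x : Fin n → Bool) :
    0 ≤ successProb A.outputProb N μ c x ∧ successProb A.outputProb N μ c x ≤ 1 := by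
  have h0 := outputProbAvg_nonneg A N μ c x
  have h1 := outputProbAvg_add A.outputProb_add N μ c x
  have h2 := h0 true
  have h3 := h0 false
  change 0 ≤ outputProbAvg A.outputProb N μ c x (c x) ∧ outputProbAvg A.outputProb N μ c x (c x) ≤ 1
  cases c x <;> constructor <;> linarith

theorem successProb_amplify_ge (A : QuantumAlgorithm) {n : ℕ} (N : ℕ) (μ : PMF (Fin n → Bool))
    (c : (Fin n → Bool) → Bool) (x : Fin n → Bool) {s : ℝ} (hs : 0 ≤ s)
    (h : s ≤ successProb A.outputProb N μ c x) :
    3 * s ^ 2 - 2 * s ^ 3 ≤ successProb A.amplify.outputProb (N * 3) μ c x := by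
  rw [successProb_amplify]
  obtain ⟨-, h1⟩ := successProb_mem A N μ c x
  generalize successProb A.outputProb N μ c x = t at *
  have h2 : 0 ≤ t - s := by linarith
  have h3 : 0 ≤ 1 - t := by linarith
  have h4 : 0 ≤ 1 - s := by linarith
  have h5 : 0 ≤ t := by linarith
  -- The difference is `(t - s) * (3 * (t + s) - 2 * (t ^ 2 + t * s + s ^ 2))`.
  have h6 : 0 ≤ 3 * (t + s) - 2 * (t ^ 2 + t * s + s ^ 2) := by
    nlinarith [mul_nonneg h5 h3, mul_nonneg hs h4, mul_nonneg hs h3, mul_nonneg h5 h4]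
  nlinarith [mul_nonneg h2 h6]

/-- Three rounds of amplification raise the success probability `2 / 3` above `11 / 12`. -/
theorem successProb_amplify_three (A : QuantumAlgorithm) {n : ℕ} (N : ℕ) (μ : PMF (Fin n → Bool))
    (c : (Fin n → Bool) → Bool) (x : Fin n → Bool)
    (h : 2 / 3 ≤ successProb A.outputProb N μ c x) :
    11 / 12 ≤ successProb A.amplify.amplify.amplify.outputProb (N * 3 * 3 * 3) μ c x := by
  have h1 := successProb_amplify_ge A N μ c x (by norm_num) h
  have h2 := successProb_amplify_ge A.amplify _ μ c x (by norm_num) h1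
  have h3 := successProb_amplify_ge A.amplify.amplify _ μ c x (by norm_num) h2
  refine le_trans ?_ h3
  norm_num

/-! ### Finite probability -/

section Prob

/-- The weight of a sequence of independent points. -/
def powWeight {Ω : Type*} (w : Ω → ℝ) (N : ℕ) (f : Fin N → Ω) : ℝ := ∏ i, w (f i)

theorem powWeight_nonneg {Ω : Type*} {w : Ω → ℝ} (hw : ∀ ω, 0 ≤ w ω) (N : ℕ) (f : Fin N → Ω) :
    0 ≤ powWeight w N f :=
  Finset.prod_nonneg fun _ _ => hw _

variable {Ω : Type*} [Fintype Ω] {w : Ω → ℝ}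

open Classical in
/-- The total weight of the points with property `P`. -/
noncomputable def prob (w : Ω → ℝ) (P : Ω → Prop) : ℝ := ∑ ω, if P ω then w ω else 0

theorem prob_nonneg (hw : ∀ ω, 0 ≤ w ω) (P : Ω → Prop) : 0 ≤ prob w P :=
  Finset.sum_nonneg fun ω _ => by split_ifs <;> simp [hw]

theorem prob_mono (hw : ∀ ω, 0 ≤ w ω) {P P' : Ω → Prop} (h : ∀ ω, P ω → P' ω) :
    prob w P ≤ prob w P' := by
  refine Finset.sum_le_sum fun ω _ => ?_
  by_cases hP : P ω
  · simp [hP, h ω hP]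
  · rw [if_neg hP]
    split_ifs <;> simp [hw]

theorem prob_add_prob_not (P : Ω → Prop) : prob w P + prob w (fun ω => ¬P ω) = ∑ ω, w ω := by
  rw [prob, prob, ← Finset.sum_add_distrib]
  exact Finset.sum_congr rfl fun ω _ => by by_cases h : P ω <;> simp [h]

theorem prob_or_le (hw : ∀ ω, 0 ≤ w ω) (P P' : Ω → Prop) :
    prob w (fun ω => P ω ∨ P' ω) ≤ prob w P + prob w P' := by
  rw [prob, prob, prob, ← Finset.sum_add_distrib]
  refine Finset.sum_le_sum fun ω _ => ?_
  have := hw ω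
  by_cases h : P ω <;> by_cases h' : P' ω <;> simp [h, h', this]

theorem prob_exists_le (hw : ∀ ω, 0 ≤ w ω) {J : Type*} (s : Finset J) (P : J → Ω → Prop) :
    prob w (fun ω => ∃ j ∈ s, P j ω) ≤ ∑ j ∈ s, prob w (P j) := by
  classical
  induction s using Finset.induction_on with
  | empty => simp [prob]
  | insert j s hj ih =>
    rw [Finset.sum_insert hj]
    refine le_trans ?_ ((prob_or_le hw (P j) fun ω => ∃ j ∈ s, P j ω).trans
      (add_le_add_right ih _))
    exact prob_mono hw fun ω h => by simpa using h

theorem exists_not_of_prob_lt_one (hw : ∑ ω, w ω = 1) {P : Ω → Prop} (h : prob w P < 1) :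
    ∃ ω, ¬P ω := by
  by_contra hcon
  push Not at hcon
  have : prob w P = ∑ ω, w ω := Finset.sum_congr rfl fun ω _ => if_pos (hcon ω)
  linarith

/-- Markov's inequality for a success probability `q ω` of mean at least `11 / 12`. -/
theorem prob_lt_two_thirds_le (hw0 : ∀ ω, 0 ≤ w ω) (hw1 : ∑ ω, w ω = 1) (q : Ω → ℝ)
    (hq : ∀ ω, q ω ≤ 1) (h : 11 / 12 ≤ ∑ ω, w ω * q ω) :
    prob w (fun ω => q ω < 2 / 3) ≤ 1 / 3 := by
  have h1 : prob w (fun ω => q ω < 2 / 3) ≤ ∑ ω, 3 * (w ω * (1 - q ω)) := by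
    refine Finset.sum_le_sum fun ω _ => ?_
    have := hw0 ω
    have := hq ω
    split_ifs with h'
    · nlinarith
    · nlinarith [mul_nonneg (hw0 ω) (sub_nonneg.2 (hq ω))]
  have h2 : ∑ ω, 3 * (w ω * (1 - q ω)) = 3 * (1 - ∑ ω, w ω * q ω) := by
    simp only [← Finset.mul_sum, mul_sub, mul_one, Finset.sum_sub_distrib, hw1]
  linarith

theorem sum_powWeight (hw : ∑ ω, w ω = 1) (N : ℕ) : ∑ f, powWeight w N f = 1 := by
  classical
  rw [← one_pow N, ← hw, Fintype.sum_pow]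
  rfl

/-- The marginal distribution of one point in a sequence of independent points. -/
theorem prob_powWeight_apply (hw : ∑ ω, w ω = 1) {N : ℕ} (i : Fin N) (P : Ω → Prop) :
    prob (powWeight w N) (fun f => P (f i)) = prob w P := by
  classical
  have h : ∀ f : Fin N → Ω, (if P (f i) then powWeight w N f else 0) =
      ∏ k, if k = i then (if P (f k) then w (f k) else 0) else w (f k) := by
    intro f
    by_cases hf : P (f i)
    · rw [if_pos hf]
      refine Finset.prod_congr rfl fun k _ => ?_
      by_cases hk : k = i
      · subst hk; simp [hf]
      · simp [hk]
    · rw [if_neg hf]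
      exact (Finset.prod_eq_zero (Finset.mem_univ i) (by simp [hf])).symm
  have h2 := Finset.prod_univ_sum (fun _ : Fin N => (Finset.univ : Finset Ω))
    fun k ω => if k = i then (if P ω then w ω else 0) else w ω
  rw [Fintype.piFinset_univ] at h2
  have h3 : prob (powWeight w N) (fun f => P (f i)) =
      ∑ f : Fin N → Ω, ∏ k, if k = i then (if P (f k) then w (f k) else 0) else w (f k) := by
    rw [prob]
    exact Finset.sum_congr rfl fun f _ => by rw [← h]
  rw [h3, ← h2, Finset.prod_eq_single i]
  · simp only [if_true, prob]
  · intro k _ hk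
    simp [hk, hw]
  · simp

theorem prob_powWeight_forall (N : ℕ) (P : Ω → Prop) :
    prob (powWeight w N) (fun f => ∀ i, P (f i)) = prob w P ^ N := by
  classical
  have h : ∀ f : Fin N → Ω, (if ∀ i, P (f i) then powWeight w N f else 0) =
      ∏ k, if P (f k) then w (f k) else 0 := by
    intro f
    by_cases hf : ∀ i, P (f i)
    · rw [if_pos hf]
      exact Finset.prod_congr rfl fun k _ => by simp [hf k]
    · rw [if_neg hf]
      push Not at hf
      obtain ⟨i, hi⟩ := hf
      exact (Finset.prod_eq_zero (Finset.mem_univ i) (by simp [hi])).symm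
  have h3 : prob (powWeight w N) (fun f => ∀ i, P (f i)) =
      ∑ f : Fin N → Ω, ∏ k, if P (f k) then w (f k) else 0 := by
    rw [prob]
    refine Finset.sum_congr rfl fun f _ => ?_
    rw [← h]
    congr
  rw [h3, ← Fintype.sum_pow (fun ω => if P ω then w ω else 0) N, prob]

open Classical in
/-- The number of points of a sequence that have property `B`. -/
noncomputable def badCount {N : ℕ} (B : Ω → Prop) (f : Fin N → Ω) : ℕ :=
  (Finset.univ.filter fun i => B (f i)).card

/-- Chernoff bound: if an event has probability at most `1 / 3`, then it occurs in at least half of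
`2 * h` independent trials with probability at most `(8 / 9) ^ h`. -/
theorem prob_le_badCount_le (hw0 : ∀ ω, 0 ≤ w ω) (hw1 : ∑ ω, w ω = 1) (B : Ω → Prop)
    (hB : prob w B ≤ 1 / 3) (h : ℕ) :
    prob (powWeight w (2 * h)) (fun f => h ≤ badCount B f) ≤ (8 / 9) ^ h := by
  classical
  -- The exponential moment `2 ^ badCount B f` has mean `(1 + prob w B) ^ (2 * h)`.
  have key : ∀ f : Fin (2 * h) → Ω, (if h ≤ badCount B f then powWeight w (2 * h) f else 0) ≤
      (∏ i, if B (f i) then 2 * w (f i) else w (f i)) / 2 ^ h := by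
    intro f
    have e : (∏ i, if B (f i) then 2 * w (f i) else w (f i)) =
        2 ^ badCount B f * powWeight w (2 * h) f := by
      have : ∀ i, (if B (f i) then 2 * w (f i) else w (f i)) =
          (if B (f i) then 2 else 1) * w (f i) := fun i => by split_ifs <;> ring
      simp only [this, Finset.prod_mul_distrib, powWeight]
      congr 1
      rw [Finset.prod_ite]
      simp only [Finset.prod_const, one_pow, mul_one, badCount]
    have hp := powWeight_nonneg hw0 (2 * h) f
    rw [e, le_div_iff₀ (by positivity)]
    split_ifs with hb
    · rw [mul_comm]
      exact mul_le_mul_of_nonneg_right (pow_le_pow_right₀ (by norm_num) hb) hp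
    · rw [zero_mul]; positivity
  have h1 : prob (powWeight w (2 * h)) (fun f => h ≤ badCount B f) ≤
      (∑ ω, if B ω then 2 * w ω else w ω) ^ (2 * h) / 2 ^ h := by
    rw [Fintype.sum_pow, Finset.sum_div]
    refine Finset.sum_le_sum fun f _ => ?_
    refine le_trans (le_of_eq ?_) (key f)
    congr
  have h2 : (∑ ω, if B ω then 2 * w ω else w ω) = 1 + prob w B := by
    rw [← hw1, prob, ← Finset.sum_add_distrib]
    exact Finset.sum_congr rfl fun ω _ => by by_cases hb : B ω <;> simp [hb]; ring
  have h3 := prob_nonneg hw0 B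
  refine h1.trans ?_
  rw [h2, pow_mul, ← div_pow]
  refine pow_le_pow_left₀ (by positivity) ?_ h
  have : (1 + prob w B) ^ 2 ≤ (1 + 1 / 3) ^ 2 := by gcongr
  linarith

/-- Union bound over at most `2 ^ r` events: in `12 * (r + 1)` trials, all of them occur in less
than half of the trials with probability at least `1 / 2`. -/
theorem prob_exists_le_badCount_le (hw0 : ∀ ω, 0 ≤ w ω) (hw1 : ∑ ω, w ω = 1) {J : Type*}
    (s : Finset J) (B : J → Ω → Prop) (hB : ∀ j ∈ s, prob w (B j) ≤ 1 / 3) (r : ℕ)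
    (hr : s.card ≤ 2 ^ r) :
    prob (powWeight w (2 * (6 * (r + 1)))) (fun f => ∃ j ∈ s, 6 * (r + 1) ≤ badCount (B j) f) ≤
      1 / 2 := by
  refine (prob_exists_le (powWeight_nonneg hw0 _) s _).trans ?_
  refine (Finset.sum_le_card_nsmul s _ ((8 / 9) ^ (6 * (r + 1)))
    fun j hj => prob_le_badCount_le hw0 hw1 (B j) (hB j hj) _).trans ?_
  have h1 : ((8 / 9 : ℝ) ^ (6 * (r + 1))) ≤ (1 / 2) ^ (r + 1) := by
    rw [pow_mul]
    exact pow_le_pow_left₀ (by norm_num) (by norm_num) _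
  have h2 : (s.card : ℝ) ≤ 2 ^ r := by exact_mod_cast hr
  calc s.card • ((8 / 9 : ℝ) ^ (6 * (r + 1))) ≤ 2 ^ r * (1 / 2) ^ (r + 1) := by
        rw [nsmul_eq_mul]; gcongr
    _ = 1 / 2 := by
        rw [pow_succ, ← mul_assoc, ← mul_pow]; norm_num

end Prob

/-! ### Learners determine the concepts: a bound for the number of learnable concepts -/

theorem trainingSet_congr {n N : ℕ} {c c' : (Fin n → Bool) → Bool} {xs : Fin N → (Fin n → Bool)}
    (h : ∀ i, c (xs i) = c' (xs i)) : trainingSet c xs = trainingSet c' xs := by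
  simp [trainingSet, h]

section Counting

variable {n N : ℕ} {w : (Fin n → Bool) → ℝ}
  (pred : (Fin n → Bool) → List ((Fin n → Bool) × Bool) → Bool)

/-- The prediction for the point `x` from the training points `xs`, labelled by `c`, is wrong. -/
def Errs (c : (Fin n → Bool) → Bool) (x : Fin n → Bool) (xs : Fin N → (Fin n → Bool)) : Prop :=
  pred x (trainingSet c xs) ≠ c x

/-- If a predictor with one third of errors learns every concept in `C` from `N` labelled samples,
then there are few concepts in `C`: with `12 * (n + 1)` training sets, the majority vote is correct
everywhere for at least half of the concepts, and those are determined by the labels of all the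
samples. -/
theorem card_le_of_learns (hw0 : ∀ x, 0 ≤ w x) (hw1 : ∑ x, w x = 1)
    (C : Finset ((Fin n → Bool) → Bool))
    (hC : ∀ c ∈ C, ∀ x, prob (powWeight w N) (Errs pred c x) ≤ 1 / 3) :
    C.card ≤ 2 ^ (2 * (6 * (n + 1)) * N + 1) := by
  classical
  set h := 6 * (n + 1) with hh
  let W := powWeight (powWeight w N) (2 * h)
  have hN0 := powWeight_nonneg hw0 N
  have hN1 := sum_powWeight hw1 N
  have hW0 : ∀ f, 0 ≤ W f := powWeight_nonneg hN0 _
  have hW1 : ∑ f, W f = 1 := sum_powWeight hN1 _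
  let good (c : (Fin n → Bool) → Bool) (f : Fin (2 * h) → Fin N → (Fin n → Bool)) : Prop :=
    ∀ x, badCount (Errs pred c x) f < h
  have h1 : ∀ c ∈ C, 1 / 2 ≤ prob W (good c) := by
    intro c hc
    have := prob_exists_le_badCount_le hN0 hN1 (Finset.univ : Finset (Fin n → Bool))
      (fun x => Errs pred c x) (fun x _ => hC c hc x) n (by simp)
    have h2 := prob_add_prob_not (w := W) (good c)
    have h3 : prob W (fun f => ¬good c f) ≤ 1 / 2 := by
      refine le_trans (prob_mono hW0 fun f hf => ?_) this
      simp only [good] at hf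
      push Not at hf
      obtain ⟨x, hx⟩ := hf
      exact ⟨x, Finset.mem_univ x, hx⟩
    linarith
  have h4 : ∀ f, (C.filter fun c => good c f).card ≤ 2 ^ (2 * h * N) := by
    intro f
    have hcard : Fintype.card (Fin (2 * h) → Fin N → Bool) = 2 ^ (2 * h * N) := by
      simp [mul_comm, pow_mul]
    rw [← hcard, ← Finset.card_univ]
    refine Finset.card_le_card_of_injOn (fun c i k => c (f i k)) (fun _ _ => Finset.mem_univ _) ?_
    intro c hc c' hc' heq
    rw [Finset.mem_coe, Finset.mem_filter] at hc hc'
    funext x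
    by_contra hne
    have hx := hc.2 x
    have hx' := hc'.2 x
    have hT : ∀ i, trainingSet c (f i) = trainingSet c' (f i) := fun i =>
      trainingSet_congr fun k => congrFun (congrFun heq i) k
    have hall : (Finset.univ : Finset (Fin (2 * h))) ⊆
        (Finset.univ.filter fun i => Errs pred c x (f i)) ∪
        (Finset.univ.filter fun i => Errs pred c' x (f i)) := by
      intro i _
      simp only [Finset.mem_union, Finset.mem_filter, Finset.mem_univ, true_and]
      by_contra hcon
      rw [not_or] at hcon
      have h1 : pred x (trainingSet c (f i)) = c x := not_not.1 hcon.1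
      have h2 : pred x (trainingSet c' (f i)) = c' x := not_not.1 hcon.2
      rw [hT i] at h1
      exact hne (h1.symm.trans h2)
    have hle := (Finset.card_le_card hall).trans (Finset.card_union_le _ _)
    rw [Finset.card_univ, Fintype.card_fin] at hle
    have e1 : (Finset.univ.filter fun i => Errs pred c x (f i)).card = badCount (Errs pred c x) f :=
      by unfold badCount; congr
    have e2 : (Finset.univ.filter fun i => Errs pred c' x (f i)).card =
      badCount (Errs pred c' x) f := by unfold badCount; congr
    omega
  have h5 : (C.card : ℝ) * (1 / 2) ≤ 2 ^ (2 * h * N) := by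
    calc (C.card : ℝ) * (1 / 2) ≤ ∑ c ∈ C, prob W (good c) := by
          rw [← nsmul_eq_mul]
          exact Finset.card_nsmul_le_sum C _ _ h1
      _ = ∑ f, W f * (C.filter fun c => good c f).card := by
          simp only [prob]
          rw [Finset.sum_comm]
          refine Finset.sum_congr rfl fun f _ => ?_
          rw [mul_comm, ← nsmul_eq_mul, ← Finset.sum_const, Finset.sum_filter]
          exact Finset.sum_congr rfl fun c _ => by congr
      _ ≤ ∑ f, W f * 2 ^ (2 * h * N) := by
          refine Finset.sum_le_sum fun f _ => mul_le_mul_of_nonneg_left ?_ (hW0 f)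
          exact_mod_cast h4 f
      _ = 2 ^ (2 * h * N) := by rw [← Finset.sum_mul, hW1, one_mul]
  have h6 : (C.card : ℝ) ≤ 2 ^ (2 * h * N + 1) := by
    rw [pow_succ]
    linarith
  exact_mod_cast h6

/-- A fixed family of training points suffices to predict all concepts in `C` everywhere, by
majority vote. -/
theorem exists_training_points (hw0 : ∀ x, 0 ≤ w x) (hw1 : ∑ x, w x = 1)
    (C : Finset ((Fin n → Bool) → Bool))
    (hC : ∀ c ∈ C, ∀ x, prob (powWeight w N) (Errs pred c x) ≤ 1 / 3) (h : ℕ)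
    (hh : h = 6 * (2 * (6 * (n + 1)) * N + 1 + n + 1)) :
    ∃ f : Fin (2 * h) → Fin N → (Fin n → Bool), ∀ c ∈ C, ∀ x, badCount (Errs pred c x) f < h := by
  subst hh
  have hcard := card_le_of_learns pred hw0 hw1 C hC
  have h1 := prob_exists_le_badCount_le (powWeight_nonneg hw0 N) (sum_powWeight hw1 N)
    (C ×ˢ (Finset.univ : Finset (Fin n → Bool))) (fun p => Errs pred p.1 p.2)
    (fun p hp => hC p.1 (Finset.mem_product.1 hp).1 p.2) (2 * (6 * (n + 1)) * N + 1 + n) (by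
      rw [Finset.card_product, pow_add _ _ n]
      simpa using hcard)
  obtain ⟨f, hf⟩ := exists_not_of_prob_lt_one (sum_powWeight (sum_powWeight hw1 N) _)
    (lt_of_le_of_lt h1 (by norm_num))
  push Not at hf
  exact ⟨f, fun c hc x => hf (c, x) (by simp [hc])⟩

end Counting

/-! ### Majority votes with few errors -/

theorem countP_ofFn {X : Type} {N : ℕ} (g : Fin N → X) (p : X → Bool) :
    (List.ofFn g).countP p = (Finset.univ.filter fun i => p (g i) = true).card := by
  induction N with
  | zero => simp
  | succ N ih =>
    rw [List.ofFn_succ, List.countP_cons, ih, Fin.card_filter_univ_succ]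
    split_ifs <;> simp

theorem majority_eq_of_badCount_lt {σ Ω : Type} (G : σ × List Bool → Bool) (a : σ) {h : ℕ}
    (u : Ω → List Bool) (f : Fin (2 * h) → Ω) (b : Bool) (B : Ω → Prop)
    (hB : ∀ i, ¬B (f i) → G (a, u (f i)) = b) (hlt : badCount B f < h) :
    majority G (a, itemsCode (List.ofFn fun i => u (f i))) = b := by
  classical
  rw [majority_itemsCode, countP_ofFn, countP_ofFn]
  have h1 : (Finset.univ.filter fun i => ¬G (a, u (f i)) = b).card < h := by
    refine lt_of_le_of_lt (Finset.card_le_card fun i hi => ?_) hlt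
    rw [Finset.mem_filter] at hi ⊢
    exact ⟨hi.1, by_contra fun hc => hi.2 (hB i hc)⟩
  have h2 := Finset.card_filter_add_card_filter_not (s := (Finset.univ : Finset (Fin (2 * h))))
    fun i => G (a, u (f i)) = b
  rw [Finset.card_univ, Fintype.card_fin] at h2
  cases b
  · simp only [Bool.not_eq_false] at h1 h2
    simp only [Bool.not_eq_true', decide_eq_false_iff_not, not_lt]
    omega
  · simp only [Bool.not_eq_true] at h1 h2
    simp only [Bool.not_eq_true', decide_eq_true_eq]
    omega

theorem length_itemsCode_le (l : List (List Bool)) (B : ℕ) (h : ∀ u ∈ l, u.length ≤ B) :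
    (itemsCode l).length ≤ l.length * (2 * B + 1) := by
  induction l with
  | nil => simp [itemsCode]
  | cons u l ih =>
    have h1 := h u (by simp)
    have h2 := ih fun v hv => h v (by simp [hv])
    rw [itemsCode, length_pairCode, List.length_cons, add_mul]
    omega

@[simp] theorem length_bitString {n : ℕ} (x : Fin n → Bool) : (bitString x).length = n := by
  simp [bitString]

@[simp] theorem length_trainingSet {n N : ℕ} (c : (Fin n → Bool) → Bool)
    (xs : Fin N → (Fin n → Bool)) : (trainingSet c xs).length = N := by
  simp [trainingSet]

theorem length_learnerInput {n N : ℕ} (x : Fin n → Bool) (c : (Fin n → Bool) → Bool)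
    (xs : Fin N → (Fin n → Bool)) :
    (learnerInput x (trainingSet c xs)).length = 2 * n + 1 + N * (2 * n + 2) := by
  rw [learnerInput, length_pairCode, length_trainingCode, length_bitString, length_trainingSet]

/-! ### A language in BQP outside P/poly yields a concept class -/

/-- The concept class with exactly one concept for every input length, given by a language. -/
noncomputable def languageClass (L : Language Bool) : ConceptClass := fun _ =>
  open Classical in {fun x => decide (bitString x ∈ L)}

theorem quantumLearnable_languageClass {L : Language Bool} (hL : L ∈ BQP) :
    QuantumLearnable (languageClass L) := by
  classical
  obtain ⟨A, hA⟩ := hL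
  have hc : PolyTime A.circuit := A.polyTime
  refine ⟨⟨fun w => A.circuit (unpairFst w), hc.comp polyTime_unpairFst⟩,
    fun n => PMF.pure fun _ => false, 0, fun n c hcn x => ?_⟩
  have hcx : c x = decide (bitString x ∈ L) := by
    have : c = fun x => decide (bitString x ∈ L) := hcn
    rw [this]
  have h1 : 2 / 3 ≤ A.outputProb (bitString x) (c x) := by
    rw [hcx]
    by_cases hx : bitString x ∈ L
    · rw [decide_eq_true hx]; exact (hA _).1 hx
    · rw [decide_eq_false hx]; exact (hA _).2 hx
  rw [successProb]
  refine h1.trans (le_of_eq ?_)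
  have h2 : ∀ T : List ((Fin n → Bool) × Bool), QuantumAlgorithm.outputProb
      ⟨fun w => A.circuit (unpairFst w), hc.comp polyTime_unpairFst⟩ (learnerInput x T) (c x) =
        A.outputProb (bitString x) (c x) := by
    intro T
    simp only [QuantumAlgorithm.outputProb, learnerInput, unpairFst_pairCode]
  simp only [h2, ← Finset.sum_mul, sum_prod_toReal, one_mul]

theorem RandomizedAlgorithm.outputProb_eq_sum (A : RandomizedAlgorithm) (w : List Bool) (b : Bool)
    {k : ℕ} (hk : k = A.coins.eval w.length) :
    A.outputProb w b =
      ∑ r : Fin k → Bool, if A.run w (List.ofFn r) = b then (1 / 2 ^ k : ℝ) else 0 := by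
  subst hk
  rw [RandomizedAlgorithm.outputProb, ← Finset.sum_filter, Finset.sum_const, nsmul_eq_mul]
  ring

/-- A classical learner of a single concept can be derandomized: some list of training sets and coin
flips predicts the concept everywhere by majority vote. -/
theorem exists_training_coins (A : RandomizedAlgorithm) {n N : ℕ} (μ : PMF (Fin n → Bool))
    (c : (Fin n → Bool) → Bool) (hc : ∀ x, 2 / 3 ≤ successProb A.outputProb N μ c x) (k : ℕ)
    (hk : k = A.coins.eval (2 * n + 1 + N * (2 * n + 2))) :
    ∃ f : Fin (2 * (6 * (n + 1))) → (Fin N → (Fin n → Bool)) × (Fin k → Bool), ∀ x,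
      badCount (fun ω => A.run (learnerInput x (trainingSet c ω.1)) (List.ofFn ω.2) ≠ c x) f <
        6 * (n + 1) := by
  classical
  let w : (Fin N → (Fin n → Bool)) × (Fin k → Bool) → ℝ := fun ω =>
    (∏ i, (μ (ω.1 i)).toReal) * (1 / 2 ^ k)
  have hw0 : ∀ ω, 0 ≤ w ω := fun ω => by
    have : 0 ≤ ∏ i, (μ (ω.1 i)).toReal := Finset.prod_nonneg fun _ _ => ENNReal.toReal_nonneg
    positivity
  have hw1 : ∑ ω, w ω = 1 := by
    rw [Fintype.sum_prod_type, ← sum_prod_toReal μ N]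
    refine Finset.sum_congr rfl fun xs _ => ?_
    simp only [w, Finset.sum_const, Finset.card_univ, Fintype.card_fun, Fintype.card_fin,
      Fintype.card_bool, nsmul_eq_mul, Nat.cast_pow, Nat.cast_ofNat]
    field_simp
  have hB : ∀ x ∈ (Finset.univ : Finset (Fin n → Bool)),
      prob w (fun ω => A.run (learnerInput x (trainingSet c ω.1)) (List.ofFn ω.2) ≠ c x) ≤
        1 / 3 := by
    intro x _
    have h1 := prob_add_prob_not (w := w)
      fun ω => A.run (learnerInput x (trainingSet c ω.1)) (List.ofFn ω.2) = c x
    have h2 : prob w (fun ω => A.run (learnerInput x (trainingSet c ω.1)) (List.ofFn ω.2) = c x) =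
        successProb A.outputProb N μ c x := by
      rw [prob, Fintype.sum_prod_type, successProb]
      refine Finset.sum_congr rfl fun xs _ => ?_
      rw [A.outputProb_eq_sum _ _ (k := k) (by rw [hk, length_learnerInput]), Finset.mul_sum]
      refine Finset.sum_congr rfl fun r _ => ?_
      by_cases h : A.run (learnerInput x (trainingSet c xs)) (List.ofFn r) = c x <;> simp [h, w]
    have h3 := hc x
    rw [hw1, h2] at h1
    linarith
  have h1 := prob_exists_le_badCount_le hw0 hw1 Finset.univ _ hB n (by simp)
  obtain ⟨f, hf⟩ := exists_not_of_prob_lt_one (sum_powWeight hw1 _)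
    (lt_of_le_of_lt h1 (by norm_num))
  push Not at hf
  exact ⟨f, fun x => hf x (Finset.mem_univ x)⟩

/-- The training sets and coin flips of a classical learner serve as advice for the language. -/
theorem mem_pPoly_of_classicallyLearnable {L : Language Bool}
    (h : ClassicallyLearnable (languageClass L)) : L ∈ PPoly := by
  classical
  obtain ⟨A, D, p, hA⟩ := h
  let c (n : ℕ) (x : Fin n → Bool) : Bool := decide (bitString x ∈ L)
  let k (n : ℕ) : ℕ := A.coins.eval (2 * n + 1 + p.eval n * (2 * n + 2))
  have hex : ∀ n, _ := fun n => exists_training_coins A (N := p.eval n) (D n) (c n)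
    (fun x => hA n (c n) rfl x) (k n) rfl
  choose f hf using hex
  let u (n : ℕ) (ω : (Fin (p.eval n) → (Fin n → Bool)) × (Fin (k n) → Bool)) : List Bool :=
    pairCode (trainingCode (trainingSet (c n) ω.1)) (List.ofFn ω.2)
  let a (n : ℕ) : List Bool := itemsCode (List.ofFn fun i => u n (f n i))
  let G (z : List Bool × List Bool) : Bool :=
    A.run (pairCode z.1 (unpairFst z.2)) (unpairSnd z.2)
  have hrun : PolyTime fun z : List Bool × List Bool => A.run z.1 z.2 := A.polyTime
  have id' : PolyTime fun z : List Bool × List Bool => z := PolyTime.id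
  have hG : PolyTime G :=
    hrun.comp ((id'.fst.pairCode id'.snd.unpairFst).pair id'.snd.unpairSnd)
  refine ⟨fun x y => majority G (x, y), PolyTime.majority hG, a, ?_, fun x => ?_⟩
  · refine ⟨2 * (6 * (Polynomial.X + 1)) * (2 * (2 * (p * (2 * Polynomial.X + 2)) + 1 +
      A.coins.comp (2 * Polynomial.X + 1 + p * (2 * Polynomial.X + 2))) + 1), fun n => ?_⟩
    refine (length_itemsCode_le _ (2 * (p.eval n * (2 * n + 2)) + 1 + k n) fun v hv => ?_).trans ?_
    · obtain ⟨i, rfl⟩ := List.mem_ofFn.1 hv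
      simp [u, length_trainingCode]
    · simp [k]
      omega
  · obtain ⟨n, y, rfl⟩ : ∃ (n : ℕ) (y : Fin n → Bool), x = bitString y :=
      ⟨x.length, x.get, (List.ofFn_get x).symm⟩
    have hmaj : majority G (bitString y, a n) = c n y := by
      refine majority_eq_of_badCount_lt G (bitString y) (u n) (f n) (c n y) _ (fun i hi => ?_)
        (hf n y)
      rw [ne_eq, not_not] at hi
      simpa [G, u, learnerInput] using hi
    change majority G (bitString y, a (bitString y).length) = true ↔ _
    rw [length_bitString, hmaj]
    exact decide_eq_true_iff

/-! ### Encoding a string in the set of training points -/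

/-- The point that follows the point `v` of the cube at distance `j`. -/
def shift {n : ℕ} (j : ℕ) (v : Fin n → Bool) : Fin n → Bool := fun i =>
  (inc^[j] (bitString v)).get (i.cast (by rw [length_iterate_inc, length_bitString]))

theorem bitString_shift {n : ℕ} (j : ℕ) (v : Fin n → Bool) :
    bitString (shift j v) = inc^[j] (bitString v) := by
  have h : (inc^[j] (bitString v)).length = n := by rw [length_iterate_inc, length_bitString]
  refine List.ext_get (by rw [length_bitString, h]) fun i h1 h2 => ?_
  simp [bitString, shift, -Fin.val_cast]
  rfl

theorem shift_injective {n : ℕ} (j : ℕ) : Function.Injective (shift (n := n) j) := by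
  intro u v h
  have h1 := congrArg bitString h
  rw [bitString_shift, bitString_shift] at h1
  exact bitString_injective (iterate_inc_injective j (by simp) h1)

theorem shift_inj {n i j : ℕ} (hi : i < 2 ^ n) (hj : j < 2 ^ n) {v : Fin n → Bool}
    (h : shift i v = shift j v) : i = j := by
  have h1 := congrArg bitString h
  rw [bitString_shift, bitString_shift] at h1
  exact iterate_inc_inj (by simpa using hi) (by simpa using hj) h1

/-- Every string `bits` can be encoded, relative to some key `v`, in a set `S` of points that
contains a given set `X`, unless the cube is small. -/
theorem exists_encoding {n : ℕ} (X : Finset (Fin n → Bool)) (bits : List Bool) :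
    ∃ (v : Fin n → Bool) (S : Finset (Fin n → Bool)), v ∈ S ∧
      S.card ≤ (X.card + 1) * (bits.length + 1) ∧
      (S = Finset.univ ∨ X ⊆ S ∧
        ∀ (j : ℕ) (hj : j < bits.length), shift (j + 1) v ∈ S ↔ bits[j] = true) := by
  classical
  rcases le_or_gt (2 ^ n) ((X.card + 1) * bits.length) with hle | hlt
  · refine ⟨fun _ => false, Finset.univ, Finset.mem_univ _, ?_, Or.inl rfl⟩
    rw [Finset.card_univ, Fintype.card_fun, Fintype.card_bool, Fintype.card_fin]
    exact hle.trans (Nat.mul_le_mul_left _ (Nat.le_succ _))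
  -- The keys for which a codeword position would collide with `X` are few.
  let bad : Finset (Fin n → Bool) := (Finset.range bits.length).biUnion fun j =>
    X.preimage (shift (j + 1)) (shift_injective _).injOn
  have hbad : bad.card < (Finset.univ : Finset (Fin n → Bool)).card := by
    refine lt_of_le_of_lt (Finset.card_biUnion_le_card_mul _ _ X.card fun j _ => ?_) ?_
    · rw [Finset.card_preimage]
      exact Finset.card_le_card (Finset.filter_subset _ _)
    · rw [Finset.card_range, Finset.card_univ, Fintype.card_fun, Fintype.card_bool,
        Fintype.card_fin]
      rw [add_mul, one_mul, mul_comm] at hlt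
      omega
  obtain ⟨v, -, hv⟩ := Finset.exists_mem_notMem_of_card_lt_card hbad
  have hv' : ∀ j < bits.length, shift (j + 1) v ∉ X := fun j hj hX =>
    hv (Finset.mem_biUnion.2 ⟨j, Finset.mem_range.2 hj, Finset.mem_preimage.2 hX⟩)
  have hlen : bits.length < 2 ^ n := lt_of_le_of_lt (Nat.le_mul_of_pos_left _ (by omega)) hlt
  let E : Finset (Fin n → Bool) :=
    ((Finset.range bits.length).filter fun j => bits.getD j false = true).image
      fun j => shift (j + 1) v
  have hE : E.card ≤ bits.length := by
    refine Finset.card_image_le.trans ((Finset.card_filter_le _ _).trans ?_)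
    rw [Finset.card_range]
  refine ⟨v, insert v (X ∪ E), Finset.mem_insert_self _ _, ?_, Or.inr ⟨?_, fun j hj => ?_⟩⟩
  · have h1 := Finset.card_insert_le v (X ∪ E)
    have h2 := Finset.card_union_le X E
    nlinarith [Nat.zero_le (X.card * bits.length)]
  · exact fun x hx => Finset.mem_insert_of_mem (Finset.mem_union_left _ hx)
  · have hv0 : shift (j + 1) v ≠ v := by
      intro h
      have h0 : shift 0 v = v := bitString_injective (by rw [bitString_shift]; rfl)
      have := shift_inj (i := j + 1) (j := 0) (by omega) (by positivity) (h.trans h0.symm)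
      omega
    rw [Finset.mem_insert, Finset.mem_union, or_iff_right hv0, or_iff_right (hv' j hj)]
    simp only [E, Finset.mem_image, Finset.mem_filter, Finset.mem_range]
    constructor
    · rintro ⟨i, ⟨hi, hbit⟩, heq⟩
      have := shift_inj (by omega) (by omega) heq
      obtain rfl : i = j := by omega
      simpa [hj] using hbit
    · intro hbit
      exact ⟨j, ⟨hj, by simpa [hj] using hbit⟩, rfl⟩

/-! ### A learner that reads the advice from the training points -/

/-- The prediction of `M` with advice `z.1.2.2` for the point `z.1.1`, from the training points
in `z.2`, labelled according to the training set `z.1.2.1`. -/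
def relabelPredict (M : List Bool → List Bool → Bool)
    (z : (List Bool × List Bool × List Bool) × List Bool) : Bool :=
  M (pairCode z.1.1 (relabel (z.2, z.1.2.1))) z.1.2.2

/-- The prediction for the point `z.1` from the training set `z.2`: points of the training set have
their label. For other points, the training set contains an advice for `M` and some lists of
training points, whose labels it also contains; the prediction is the majority vote of the
predictions of `M` from these lists. -/
def advicePredict (M : List Bool → List Bool → Bool) (z : List Bool × List Bool) : Bool :=
  if (lookup (z.2, z.1)).isEmpty then
    majority (relabelPredict M)
      ((z.1, z.2, unpairFst (unpairFst (readBits (unpairFst z.2, z.2)))),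
        unpairSnd (unpairFst (readBits (unpairFst z.2, z.2))))
  else (lookup (z.2, z.1)).headD false

theorem polyTime_advicePredict {M : List Bool → List Bool → Bool} (hM : PolyTimeDecider M) :
    PolyTime (advicePredict M) := by
  have hM' : PolyTime fun z : List Bool × List Bool => M z.1 z.2 := hM
  have idP : PolyTime fun z : (List Bool × List Bool × List Bool) × List Bool => z := PolyTime.id
  have hG : PolyTime (relabelPredict M) :=
    hM'.comp ((idP.fst.fst.pairCode (polyTime_relabel.comp (idP.snd.pair idP.fst.snd.fst))).pair
      idP.fst.snd.snd)
  have id' : PolyTime fun z : List Bool × List Bool => z := PolyTime.id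
  have hlk := polyTime_lookup.comp (id'.snd.pair id'.fst)
  have hadv := (polyTime_readBits.comp (id'.snd.unpairFst.pair id'.snd)).unpairFst
  exact hlk.isEmpty.ite ((PolyTime.majority hG).comp
    ((id'.fst.pair (id'.snd.pair hadv.unpairFst)).pair hadv.unpairSnd)) hlk.head

/-- The deterministic learner with the predictions of `advicePredict M`. -/
noncomputable def adviceLearner (M : List Bool → List Bool → Bool) (hM : PolyTimeDecider M) :
    RandomizedAlgorithm where
  coins := 0
  run w _ := advicePredict M (unpairFst w, unpairSnd w)
  polyTime := by
    have id' : PolyTime fun z : List Bool × List Bool => z := PolyTime.id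
    exact (polyTime_advicePredict hM).comp (id'.fst.unpairFst.pair id'.fst.unpairSnd)

theorem adviceLearner_outputProb (M : List Bool → List Bool → Bool) (hM : PolyTimeDecider M)
    {n : ℕ} (x : Fin n → Bool) (T : List ((Fin n → Bool) × Bool)) (b : Bool) :
    (adviceLearner M hM).outputProb (learnerInput x T) b =
      if advicePredict M (bitString x, trainingCode T) = b then 1 else 0 := by
  rw [RandomizedAlgorithm.outputProb_eq_sum _ _ _ (k := 0) (by simp [adviceLearner])]
  simp [adviceLearner, learnerInput]

theorem unpairFst_append (u v w : List Bool) : unpairFst (pairCode u v ++ w) = u := by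
  rw [← pairCode_append, unpairFst_pairCode]

/-- The string that provides the advice `a` and the training points `X`; their labels in this string
are arbitrary. -/
def adviceBits {n N k : ℕ} (a : List Bool) (X : Fin k → Fin N → (Fin n → Bool)) : List Bool :=
  pairCode (pairCode a (itemsCode
    (List.ofFn fun i => trainingCode (trainingSet (fun _ => false) (X i))))) []

theorem length_adviceBits_le {n N k : ℕ} (a : List Bool) (X : Fin k → Fin N → (Fin n → Bool)) :
    (adviceBits a X).length ≤
      2 * (2 * a.length + 1 + k * (2 * (N * (2 * n + 2)) + 1)) + 1 := by
  have h := length_itemsCode_le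
    (List.ofFn fun i => trainingCode (trainingSet (fun _ => false) (X i))) (N * (2 * n + 2))
    fun u hu => by
      obtain ⟨i, rfl⟩ := List.mem_ofFn.1 hu
      rw [length_trainingCode, length_trainingSet]
  rw [List.length_ofFn] at h
  simp only [adviceBits, length_pairCode, List.length_nil]
  omega

theorem mem_trainingSet {n N : ℕ} {c : (Fin n → Bool) → Bool} {xs : Fin N → (Fin n → Bool)}
    {a : (Fin n → Bool) × Bool} (ha : a ∈ trainingSet c xs) : a.2 = c a.1 := by
  obtain ⟨i, rfl⟩ := List.mem_ofFn.1 ha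
  rfl

theorem mem_map_fst_trainingSet {n N : ℕ} {c : (Fin n → Bool) → Bool}
    {xs : Fin N → (Fin n → Bool)} {x : Fin n → Bool} :
    x ∈ (trainingSet c xs).map Prod.fst ↔ ∃ i, xs i = x := by
  simp [trainingSet, List.map_ofFn, List.mem_ofFn]

/-- The learner is correct if the training points form the set `S` that encodes the advice and
the first training point is the key `v`. -/
theorem advicePredict_eq {n N N' h : ℕ} (M : List Bool → List Bool → Bool) (a : List Bool)
    (X : Fin (2 * h) → Fin N → (Fin n → Bool)) (v : Fin n → Bool) (S : Finset (Fin n → Bool))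
    (hS : S = Finset.univ ∨ (∀ i k, X i k ∈ S) ∧
      ∀ (j : ℕ) (hj : j < (adviceBits a X).length),
        shift (j + 1) v ∈ S ↔ (adviceBits a X)[j] = true)
    (c : (Fin n → Bool) → Bool) (x : Fin n → Bool)
    (hx : badCount (Errs (fun x T => M (learnerInput x T) a) c x) X < h)
    (hN' : (adviceBits a X).length ≤ N') (h0 : 0 < N') (xs : Fin N' → (Fin n → Bool))
    (hv : xs ⟨0, h0⟩ = v) (hxs : ∀ y, y ∈ S ↔ ∃ i, xs i = y) :
    advicePredict M (bitString x, trainingCode (trainingSet c xs)) = c x := by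
  set T := trainingSet c xs with hT
  have hlab : ∀ b ∈ T, b.2 = c b.1 := fun b hb => mem_trainingSet hb
  have hmem : ∀ y, y ∈ T.map Prod.fst ↔ y ∈ S := fun y =>
    mem_map_fst_trainingSet.trans (hxs y).symm
  have hlk : ∀ y, lookup (trainingCode T, bitString y) = if y ∈ S then [c y] else [] := by
    intro y
    rw [lookup_trainingCode T c hlab]
    simp only [hmem]
  rw [advicePredict, hlk]
  by_cases hxS : x ∈ S
  · simp [hxS]
  -- If `S` is the whole cube, then every point has a label.
  rcases hS with rfl | ⟨hX, hbits⟩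
  · exact absurd (Finset.mem_univ x) hxS
  have hkey : unpairFst (trainingCode T) = bitString v := by
    obtain ⟨N', rfl⟩ : ∃ k, N' = k + 1 := ⟨N' - 1, by omega⟩
    rw [hT, trainingSet, List.ofFn_succ, trainingCode_cons, unpairFst_pairCode, ← hv]
    rfl
  have hread : ∃ w, readBits (bitString v, trainingCode T) = adviceBits a X ++ w := by
    have hlen : (adviceBits a X).length ≤ (trainingCode T).length := by
      rw [length_trainingCode, hT, length_trainingSet]
      exact hN'.trans (Nat.le_mul_of_pos_right _ (by omega))
    refine ⟨(readBits (bitString v, trainingCode T)).drop (adviceBits a X).length, ?_⟩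
    rw [readBits_eq]
    conv_lhs => rw [← List.take_append_drop (adviceBits a X).length
      ((List.range _).map fun j => !(lookup (trainingCode T, inc^[j + 1] (bitString v))).isEmpty)]
    congr 1
    refine List.ext_getElem (by simp [hlen]) fun j h1 h2 => ?_
    rw [List.getElem_take, List.getElem_map, List.getElem_range, ← bitString_shift, hlk]
    have := hbits j h2
    by_cases hj : shift (j + 1) v ∈ S
    · simp [hj, this.1 hj]
    · have h3 : (adviceBits a X)[j] = false := by simpa [hj] using this
      simp [hj, h3]
  -- The string that is read continues with bits `w` that carry no information, but the code of a
  -- pair marks the end of its first component.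
  obtain ⟨w, hw⟩ := hread
  have hfst : unpairFst (readBits (unpairFst (trainingCode T), trainingCode T)) =
      pairCode a (itemsCode
        (List.ofFn fun i => trainingCode (trainingSet (fun _ => false) (X i)))) := by
    rw [hkey, hw, adviceBits, unpairFst_append]
  simp only [hfst, unpairFst_pairCode, unpairSnd_pairCode, hxS, if_false, List.isEmpty_nil, if_true]
  refine majority_eq_of_badCount_lt (relabelPredict M) (bitString x, trainingCode T, a)
    (fun ys => trainingCode (trainingSet (fun _ => false) ys)) X (c x) _ (fun i hi => ?_) hx
  have hi' : M (learnerInput x (trainingSet c (X i))) a = c x := not_not.1 hi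
  rw [relabelPredict, relabel_trainingCode _ T c hlab fun b hb => ?_]
  · rw [← hi', learnerInput]
    simp [trainingSet, List.map_ofFn, Function.comp_def]
  · obtain ⟨k, rfl⟩ := List.mem_ofFn.1 hb
    exact (hmem _).2 (hX i k)

/-! ### A distribution that reveals a set of points -/

theorem exists_pmf {Ω : Type} [Fintype Ω] {w : Ω → ℝ} (hw0 : ∀ x, 0 ≤ w x) (hw1 : ∑ x, w x = 1) :
    ∃ μ : PMF Ω, ∀ x, (μ x).toReal = w x := by
  refine ⟨PMF.ofFintype (fun x => ENNReal.ofReal (w x)) ?_, fun x => ?_⟩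
  · rw [← ENNReal.ofReal_sum_of_nonneg fun x _ => hw0 x, hw1, ENNReal.ofReal_one]
  · rw [PMF.ofFintype_apply, ENNReal.toReal_ofReal (hw0 x)]

/-- A bound for the probability that one of `s` points, each of weight at least `1 / (10 * s)`, is
missing among the samples. -/
theorem one_sub_pow_le (s : ℕ) (hs : 0 < s) :
    (s : ℝ) * (1 - 1 / (10 * s)) ^ (10 * s * (s + 4)) ≤ 1 / 16 := by
  have hs' : (1 : ℝ) ≤ s := by exact_mod_cast hs
  have h1 : (1 - 1 / (10 * s) : ℝ) ^ (10 * s) ≤ 1 / 2 := by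
    have h := Real.one_sub_div_pow_le_exp_neg (n := 10 * s) (t := 1) (by push_cast; linarith)
    push_cast at h
    have := Real.exp_neg_one_lt_d9
    linarith
  have h0 : (0 : ℝ) ≤ 1 - 1 / (10 * s) := by
    rw [sub_nonneg, div_le_one (by linarith)]
    linarith
  have h2 : (s : ℝ) ≤ 2 ^ s := by exact_mod_cast Nat.lt_two_pow_self.le
  calc (s : ℝ) * (1 - 1 / (10 * s)) ^ (10 * s * (s + 4)) ≤ 2 ^ s * (1 / 2) ^ (s + 4) := by
        rw [pow_mul]
        gcongr
    _ = 1 / 16 := by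
        rw [pow_add, ← mul_assoc, ← mul_pow]
        norm_num

/-- For some distribution, with probability at least `2 / 3` the first sample is `v` and the samples
form the set `S`. The distribution gives the weight `9 / 10` to `v`, and spreads the rest evenly
over `S`. -/
theorem exists_pmf_reveal {Ω : Type} [Fintype Ω] (v : Ω) (S : Finset Ω) (hv : v ∈ S)
    (s : ℕ) (hs : S.card ≤ s) (h0 : 0 < 10 * s * (s + 4)) :
    ∃ μ : PMF Ω, 2 / 3 ≤ prob (powWeight (fun x => (μ x).toReal) (10 * s * (s + 4)))
      fun xs => xs ⟨0, h0⟩ = v ∧ ∀ y, y ∈ S ↔ ∃ i, xs i = y := by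
  classical
  have hs0 : 0 < s := (Finset.card_pos.2 ⟨v, hv⟩).trans_le hs
  have hc0 : (0 : ℝ) < S.card := by exact_mod_cast Finset.card_pos.2 ⟨v, hv⟩
  let w (x : Ω) : ℝ := (if x = v then 9 / 10 else 0) +
    if x ∈ S then (1 / (10 * S.card) : ℝ) else 0
  have hw0 : ∀ x, 0 ≤ w x := fun x => by
    simp only [w]
    positivity
  have hw1 : ∑ x, w x = 1 := by
    simp only [w, Finset.sum_add_distrib, Finset.sum_ite_eq', Finset.mem_univ, if_true,
      Finset.sum_ite_mem, Finset.univ_inter, Finset.sum_const, nsmul_eq_mul]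
    field_simp
    norm_num
  obtain ⟨μ, hμ⟩ := exists_pmf hw0 hw1
  refine ⟨μ, ?_⟩
  rw [show (fun x => (μ x).toReal) = w from funext hμ]
  set N := 10 * s * (s + 4)
  have hN0 := powWeight_nonneg hw0 N
  have heq : ∀ y, prob w (fun x => x ≠ y) = 1 - w y := by
    intro y
    have h := prob_add_prob_not (w := w) fun x => x = y
    have h' : prob w (fun x => x = y) = w y := by simp [prob]
    rw [hw1, h'] at h
    have : prob w (fun x => x ≠ y) = prob w fun x => ¬x = y := rfl
    linarith
  have h1 : prob (powWeight w N) (fun xs => xs ⟨0, h0⟩ ≠ v) ≤ 1 / 10 := by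
    rw [prob_powWeight_apply hw1 ⟨0, h0⟩ fun x => x ≠ v, heq]
    have : 0 ≤ (1 : ℝ) / (10 * S.card) := by positivity
    simp only [w, hv, if_true]
    linarith
  have h2 : prob (powWeight w N) (fun xs => ∃ y ∈ S, ∀ i, xs i ≠ y) ≤ 1 / 16 := by
    refine le_trans ?_ (one_sub_pow_le s hs0)
    refine (prob_exists_le hN0 S fun y xs => ∀ i, xs i ≠ y).trans
      ((Finset.sum_le_card_nsmul S _ ((1 - 1 / (10 * s) : ℝ) ^ N) fun y hy => ?_).trans ?_)
    · rw [prob_powWeight_forall N fun x => x ≠ y]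
      refine pow_le_pow_left₀ (prob_nonneg hw0 _) ?_ N
      rw [heq]
      have h3 : (1 : ℝ) / (10 * s) ≤ 1 / (10 * S.card) := by gcongr
      have h4 : (1 : ℝ) / (10 * S.card) ≤ w y := by
        simp only [w, hy, if_true, le_add_iff_nonneg_left]
        positivity
      linarith
    · rw [nsmul_eq_mul]
      have : (0 : ℝ) ≤ 1 - 1 / (10 * s) := by
        have : (1 : ℝ) ≤ s := by exact_mod_cast hs0
        rw [sub_nonneg, div_le_one (by linarith)]
        linarith
      gcongr
  have h3 : prob (powWeight w N) (fun xs => ∃ i ∈ Finset.univ, xs i ∉ S) ≤ 0 := by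
    refine (prob_exists_le hN0 _ fun i xs => xs i ∉ S).trans (Finset.sum_nonpos fun i _ => ?_)
    rw [prob_powWeight_apply hw1 i fun x => x ∉ S, prob]
    refine Finset.sum_nonpos fun x _ => ?_
    by_cases hx : x ∈ S
    · simp [hx]
    · have hxv : x ≠ v := fun h => hx (h ▸ hv)
      simp [w, hx, hxv]
  have h4 := prob_add_prob_not (w := powWeight w N)
    fun xs => xs ⟨0, h0⟩ = v ∧ ∀ y, y ∈ S ↔ ∃ i, xs i = y
  rw [sum_powWeight hw1] at h4
  have h5 : prob (powWeight w N)
      (fun xs => ¬(xs ⟨0, h0⟩ = v ∧ ∀ y, y ∈ S ↔ ∃ i, xs i = y)) ≤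
      prob (powWeight w N) (fun xs => xs ⟨0, h0⟩ ≠ v ∨ (∃ y ∈ S, ∀ i, xs i ≠ y) ∨
        ∃ i ∈ Finset.univ, xs i ∉ S) := by
    refine prob_mono hN0 fun xs hxs => ?_
    by_contra hcon
    push Not at hcon
    obtain ⟨ha, hb, hc⟩ := hcon
    exact hxs ⟨ha, fun y => ⟨fun hy => hb y hy, fun ⟨i, hi⟩ => hi ▸ hc i (Finset.mem_univ i)⟩⟩
  have h6 := prob_or_le hN0 (fun xs => xs ⟨0, h0⟩ ≠ v)
    fun xs => (∃ y ∈ S, ∀ i, xs i ≠ y) ∨ ∃ i ∈ Finset.univ, xs i ∉ S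
  have h7 := prob_or_le hN0 (fun xs => ∃ y ∈ S, ∀ i, xs i ≠ y)
    fun xs => ∃ i ∈ Finset.univ, xs i ∉ S
  linarith

/-- If the training points `X` suffice to predict concepts by majority vote, then for some
distribution the learner succeeds on these concepts. -/
theorem exists_pmf_adviceLearner {n N h : ℕ} (M : List Bool → List Bool → Bool)
    (hM : PolyTimeDecider M) (a : List Bool) (X : Fin (2 * h) → Fin N → (Fin n → Bool)) (s : ℕ)
    (hs : (2 * h * N + 1) * ((adviceBits a X).length + 1) ≤ s) :
    ∃ μ : PMF (Fin n → Bool), ∀ c : (Fin n → Bool) → Bool,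
      (∀ x, badCount (Errs (fun x T => M (learnerInput x T) a) c x) X < h) →
        ∀ x, 2 / 3 ≤ successProb (adviceLearner M hM).outputProb (10 * s * (s + 4)) μ c x := by
  classical
  let X' : Finset (Fin n → Bool) :=
    (Finset.univ : Finset (Fin (2 * h) × Fin N)).image fun i => X i.1 i.2
  have hX' : X'.card ≤ 2 * h * N := by
    refine Finset.card_image_le.trans (le_of_eq ?_)
    simp
  obtain ⟨v, S, hv, hcard, hS⟩ := exists_encoding X' (adviceBits a X)
  have hle : (adviceBits a X).length + 1 ≤ s :=
    (Nat.le_mul_of_pos_left _ (by omega)).trans hs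
  have h0 : 0 < 10 * s * (s + 4) := by
    have : 0 < s := by omega
    positivity
  obtain ⟨μ, hμ⟩ := exists_pmf_reveal v S hv s (hcard.trans ((Nat.mul_le_mul_right _
    (by omega)).trans hs)) h0
  refine ⟨μ, fun c hc x => hμ.trans ?_⟩
  rw [prob, successProb]
  refine Finset.sum_le_sum fun xs _ => ?_
  rw [adviceLearner_outputProb, powWeight]
  have hp : 0 ≤ ∏ i, (μ (xs i)).toReal := Finset.prod_nonneg fun _ _ => ENNReal.toReal_nonneg
  by_cases hxs : xs ⟨0, h0⟩ = v ∧ ∀ y, y ∈ S ↔ ∃ i, xs i = y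
  · rw [if_pos hxs, if_pos, mul_one]
    refine advicePredict_eq M a X v S (hS.imp id fun hS => ⟨fun i k => hS.1 ?_, hS.2⟩) c x (hc x)
      (by nlinarith) h0 xs hxs.1 hxs.2
    exact Finset.mem_image.2 ⟨(i, k), Finset.mem_univ _, rfl⟩
  · rw [if_neg hxs]
    split_ifs <;> simp [hp]

/-! ### Quantum learners and polynomial advice -/

/-- If promise problems with quantum algorithms have polynomial advice, then the predictions of a
quantum learner can be made with polynomial advice instead. -/
theorem exists_advice_of_learnsWorstCase (hsub : PromiseBQP ⊆ PromisePPoly) (A : QuantumAlgorithm)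
    (C : ConceptClass) (D : (n : ℕ) → PMF (Fin n → Bool)) (p : Polynomial ℕ)
    (hA : ∀ n, ∀ c ∈ C n, ∀ x, 2 / 3 ≤ successProb A.outputProb (p.eval n) (D n) c x) :
    ∃ (M : List Bool → List Bool → Bool) (a : ℕ → List Bool) (N : Polynomial ℕ),
      PolyTimeDecider M ∧ PolyAdvice a ∧ ∀ n, ∀ c ∈ C n, ∀ x,
        prob (powWeight (fun x => (D n x).toReal) (N.eval n))
          (Errs (fun x T => M (learnerInput x T) (a n)) c x) ≤ 1 / 3 := by
  let B := A.amplify.amplify.amplify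
  -- The inputs on which the amplified learner has a clear answer.
  let P : PromiseProblem :=
    { yes := {w | 2 / 3 ≤ B.outputProb w true}
      no := {w | 2 / 3 ≤ B.outputProb w false}
      disjoint := Set.disjoint_left.2 fun w h1 h2 => by
        change 2 / 3 ≤ B.outputProb w true at h1
        change 2 / 3 ≤ B.outputProb w false at h2
        have := B.outputProb_add w
        linarith }
  obtain ⟨M, hM, a, ⟨q, hq⟩, hyes, hno⟩ := hsub
    (show P ∈ PromiseBQP from ⟨B, fun _ h => h, fun _ h => h⟩)
  have hP : ∀ w b, 2 / 3 ≤ B.outputProb w b → M w (a w.length) = b := by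
    rintro w (_ | _) h
    · exact hno w h
    · exact hyes w h
  let N : Polynomial ℕ := p * 3 * 3 * 3
  have hN : ∀ n, N.eval n = p.eval n * 3 * 3 * 3 := fun n => by simp [N]
  refine ⟨M, fun n => a (2 * n + 1 + N.eval n * (2 * n + 2)), N, hM,
    ⟨q.comp (2 * Polynomial.X + 1 + N * (2 * Polynomial.X + 2)), fun n => ?_⟩,
    fun n c hc x => ?_⟩
  · simpa using hq (2 * n + 1 + N.eval n * (2 * n + 2))
  · have hw0 : ∀ x, 0 ≤ (D n x).toReal := fun _ => ENNReal.toReal_nonneg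
    have h1 := successProb_amplify_three A (p.eval n) (D n) c x (hA n c hc x)
    rw [← hN] at h1
    refine le_trans (prob_mono (powWeight_nonneg hw0 _) fun xs hxs => ?_)
      (prob_lt_two_thirds_le (powWeight_nonneg hw0 _) (sum_powWeight (PMF.sum_toReal _) _)
        (fun xs => B.outputProb (learnerInput x (trainingSet c xs)) (c x)) (fun xs => ?_) h1)
    · by_contra hcon
      refine hxs ?_
      have := hP _ _ (not_lt.1 hcon)
      rwa [length_learnerInput] at this
    · have h2 := B.outputProb_add (learnerInput x (trainingSet c xs))
      have h3 := B.outputProb_nonneg (learnerInput x (trainingSet c xs))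
      have h4 := h3 true
      have h5 := h3 false
      cases c x <;> linarith

/-- Polynomial advice for quantum algorithms makes quantum learners classical. -/
theorem classicallyLearnable_of_quantumLearnable (hsub : PromiseBQP ⊆ PromisePPoly)
    {C : ConceptClass} (hC : QuantumLearnable C) : ClassicallyLearnable C := by
  classical
  obtain ⟨A, D, p, hA⟩ := hC
  obtain ⟨M, a, N, hM, ⟨q, hq⟩, herr⟩ := exists_advice_of_learnsWorstCase hsub A C D p hA
  let h (n : ℕ) : ℕ := 6 * (2 * (6 * (n + 1)) * N.eval n + 1 + n + 1)
  have hex : ∀ n, ∃ f : Fin (2 * h n) → Fin (N.eval n) → (Fin n → Bool), ∀ c ∈ C n, ∀ x,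
      badCount (Errs (fun x T => M (learnerInput x T) (a n)) c x) f < h n := fun n => by
    obtain ⟨f, hf⟩ := exists_training_points (fun x T => M (learnerInput x T) (a n))
      (w := fun x => (D n x).toReal) (N := N.eval n) (fun _ => ENNReal.toReal_nonneg)
      (PMF.sum_toReal _) (C n).toFinite.toFinset
      (fun c hc x => herr n c ((C n).toFinite.mem_toFinset.1 hc) x) (h n) rfl
    exact ⟨f, fun c hc => hf c ((C n).toFinite.mem_toFinset.2 hc)⟩
  choose X hX using hex
  let H : Polynomial ℕ := 6 * (2 * (6 * (Polynomial.X + 1)) * N + 1 + Polynomial.X + 1)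
  let s : Polynomial ℕ := (2 * H * N + 1) *
    (2 * (2 * q + 1 + 2 * H * (2 * (N * (2 * Polynomial.X + 2)) + 1)) + 1 + 1)
  have hs : ∀ n, (2 * h n * N.eval n + 1) * ((adviceBits (a n) (X n)).length + 1) ≤ s.eval n := by
    intro n
    have h1 := length_adviceBits_le (a n) (X n)
    have h2 := hq n
    have h3 : H.eval n = h n := by simp [H, h]
    simp only [s, Polynomial.eval_mul, Polynomial.eval_add, Polynomial.eval_ofNat,
      Polynomial.eval_one, Polynomial.eval_X, h3]
    exact Nat.mul_le_mul_left _ (by omega)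
  have hμ := fun n => exists_pmf_adviceLearner M hM (a n) (X n) (s.eval n) (hs n)
  choose D' hD' using hμ
  refine ⟨adviceLearner M hM, D', 10 * s * (s + 4), fun n c hc x => ?_⟩
  have := hD' n c (hX n c hc) x
  simpa using this

end WorstCaseLearning

theorem theorem4 :
    (¬ WorstCaseLearning.BQP ⊆ WorstCaseLearning.PPoly →
      ∃ C : WorstCaseLearning.ConceptClass,
        WorstCaseLearning.QuantumLearnable C ∧ ¬ WorstCaseLearning.ClassicallyLearnable C) ∧
    ((∃ C : WorstCaseLearning.ConceptClass,
        WorstCaseLearning.QuantumLearnable C ∧ ¬ WorstCaseLearning.ClassicallyLearnable C) →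
      ¬ WorstCaseLearning.PromiseBQP ⊆ WorstCaseLearning.PromisePPoly) := by
  refine ⟨fun h => ?_, fun ⟨C, hq, hc⟩ hsub =>
    hc (WorstCaseLearning.classicallyLearnable_of_quantumLearnable hsub hq)⟩
  obtain ⟨L, hL, hL'⟩ := Set.not_subset.1 h
  exact ⟨WorstCaseLearning.languageClass L, WorstCaseLearning.quantumLearnable_languageClass hL,
    fun hc => hL' (WorstCaseLearning.mem_pPoly_of_classicallyLearnable hc)⟩
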